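/- **Conventions.** A regular closed curve of class $C^r$ is a $2\pi$-periodic map $\gamma:\mathbb R\to\mathbb R^2=\mathbb C$ of class $C^r$ with $\gamma'(t)\neq 0$ for all $t$. Two such curves $\gamma_0,\gamma_1$ are *$C^r$-regularly homotopic* if there are regular closed $C^r$ curves $H_s$, $0\le s\le 1$, with $H_0=\gamma_0$, $H_1=\gamma_1$, such that $(s,t)\mapsto H_s^{(j)}(t)$ is continuous for every $0\le j\le r$. The *Whitney index* of $\gamma$ is the degree $n\in\mathbb Z$ of its Gauss map $\gamma'/|\gamma'|$, i.e. $2\pi n$ is the total increase of a continuous angle of $\gamma'$ over one period. The *Euler functional* is $U(\gamma)=\int\kappa^2\,ds$ ($\kappa$ the curvature, $s$ the arc length), considered on the space $E$ of closed $C^2$ curves of length $2\pi$ parametrized by arc length, with the $C^2$ topology. A *normal form* of a regular closed $C^2$ curve $\gamma$ is a local minimum $N\in E$ of $U$ on $E$ that is regularly homotopic to $\gamma$. Two curves $N,N'$ *have the same shape* if $N'(t)=a\,N(t+\tau)+b$ for all $t$, for some $a,b\in\mathbb C$, $|a|=1$, $\tau\in\mathbb R$ (orientation-preserving motion of the plane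 and change of starting point). For $n\ne0$ let $c_n(t)=e^{int}/n$ (a circle of length $2\pi$ in total, passed $|n|$ times, counterclockwise if $n>0$ and clockwise if $n<0$). A *figure eight elastica (passed once)* is a curve $\gamma\in E$ with no positive period smaller than $2\pi$ for which $\gamma'(t)=e^{i(\alpha(t)+\theta)}$ for some constant $\theta\in\mathbb R$ and some $2\pi$-periodic $C^2$ function $\alpha:\mathbb R\to\mathbb R$ satisfying the pendulum equation $\alpha''+\omega^2\sin\alpha=0$ with some $\omega>0$. **Theorem.** Let $r\in\{1,2\}$, and let regular homotopy mean $C^r$-regular homotopy. 1. Every regular closed plane $C^2$ curve has a normal form, and its normal forms are exactly the curves of one and the same shape. 2. Two regular closed plane $C^2$ curves are regularly homotopic if and only if they have the same normal form (i.e. they have normal forms of the same shape). 3. (Whitney–Graustein) Every regular closed plane $C^2$ curve has a unique Whitney index, and two such curves are regularly homotopic if and only if their Whitney indices are equal. 4. For every $n\in\mathbb Z$ the local minima of $U$ on $E$ of Whitney index $n$ exist and form exactly one shape. For $n\neq 0$ they are exactly the curves of the same shape as $c_n$; for $n=0$ they are exactly the figure eight elasticae passed once. -/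

import Mathlib

open Complex ComplexConjugate

/-- A regular closed plane curve of class `C^r`. The plane `ℝ²` is identified with `ℂ`, and a map
from the circle with a `2π`-periodic function on `ℝ`. -/
structure IsRegularClosedCurve (r : ℕ) (γ : ℝ → ℂ) : Prop where
  contDiff : ContDiff ℝ r γ
  periodic : Function.Periodic γ (2 * Real.pi)
  deriv_ne_zero : ∀ t, deriv γ t ≠ 0

/-- `C^r`-regular homotopy: a path `s ↦ H s`, `0 ≤ s ≤ 1`, of regular closed curves of class `C^r`
whose derivatives of order at most `r` along the curve depend continuously on both variables.
For `r = 1` this is Whitney's notion; for general `r` it is a path in the space of regular closed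
`C^r` curves with the `C^r` topology. -/
def RegularlyHomotopic (r : ℕ) (γ₀ γ₁ : ℝ → ℂ) : Prop :=
  ∃ H : ℝ → ℝ → ℂ,
    H 0 = γ₀ ∧ H 1 = γ₁ ∧
    (∀ s ∈ Set.Icc (0 : ℝ) 1, IsRegularClosedCurve r (H s)) ∧
    ∀ j ≤ r, ContinuousOn (fun p : ℝ × ℝ => iteratedDeriv j (H p.1) p.2)
      (Set.Icc (0 : ℝ) 1 ×ˢ Set.univ)

/-- The signed curvature `(x' y'' - y' x'') / |γ'|³` of `γ = x + i y` at the parameter `t`. -/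
noncomputable def signedCurvature (γ : ℝ → ℂ) (t : ℝ) : ℝ :=
  (conj (deriv γ t) * deriv (deriv γ) t).im / ‖deriv γ t‖ ^ 3

/-- The Euler functional: the integral of the squared curvature with respect to arc length. -/
noncomputable def eulerFunctional (γ : ℝ → ℂ) : ℝ :=
  ∫ t in (0 : ℝ)..(2 * Real.pi), signedCurvature γ t ^ 2 * ‖deriv γ t‖

/-- The configuration space of the Euler functional: closed plane curves of class `C²` and of
length `2π`, parametrized by arc length. -/
structure IsArcLengthCurve (γ : ℝ → ℂ) : Prop where
  contDiff : ContDiff ℝ 2 γ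
  periodic : Function.Periodic γ (2 * Real.pi)
  norm_deriv : ∀ t, ‖deriv γ t‖ = 1

/-- `N` is a local minimum of the Euler functional on the space of closed arc length parametrized
`C²` curves of length `2π`, with respect to the `C²` topology. -/
def IsEulerLocalMin (N : ℝ → ℂ) : Prop :=
  IsArcLengthCurve N ∧
    ∃ ε > (0 : ℝ), ∀ γ : ℝ → ℂ, IsArcLengthCurve γ →
      (∀ j ≤ 2, ∀ t, ‖iteratedDeriv j γ t - iteratedDeriv j N t‖ < ε) →
      eulerFunctional N ≤ eulerFunctional γ

/-- `N` is a normal form of `γ`: a local minimum of the Euler functional in the regular homotopy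
class of `γ`. -/
def IsNormalFormOf (r : ℕ) (γ N : ℝ → ℂ) : Prop :=
  IsEulerLocalMin N ∧ RegularlyHomotopic r γ N

/-- Two closed curves are the same as oriented curves up to an orientation preserving motion of the
plane and a change of the starting point. -/
def SameShape (γ₁ γ₂ : ℝ → ℂ) : Prop :=
  ∃ (a b : ℂ) (τ : ℝ), ‖a‖ = 1 ∧ ∀ t, γ₂ t = a * γ₁ (t + τ) + b

/-- `n` is the Whitney index of `γ`, the degree of the Gauss map `γ' / |γ'|`: a continuous angle of
the tangent vector increases by `2πn` when the curve is traversed once. -/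
def HasWhitneyIndex (γ : ℝ → ℂ) (n : ℤ) : Prop :=
  ∃ α : ℝ → ℝ, Continuous α ∧
    (∀ t, deriv γ t = (‖deriv γ t‖ : ℂ) * exp ((α t : ℂ) * I)) ∧
    α (2 * Real.pi) - α 0 = 2 * Real.pi * n

/-- The circle of radius `1 / |n|` traversed `|n|` times with unit speed, counterclockwise for
`n > 0` and clockwise for `n < 0`. It is only used for `n ≠ 0`. -/
noncomputable def multiCircle (n : ℤ) (t : ℝ) : ℂ :=
  exp ((n : ℂ) * (t : ℂ) * I) / n

/-- `γ` is Bernoulli's closed figure eight elastica, of length `2π` and passed once: an arc length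
parametrized closed curve whose tangent angle is, up to a rotation of the plane by `θ`, a periodic
solution of the pendulum equation `α'' + ω² sin α = 0` with `ω > 0`, and which has no period
smaller than `2π`. -/
def IsFigureEightElastica (γ : ℝ → ℂ) : Prop :=
  IsArcLengthCurve γ ∧
    (∃ (α : ℝ → ℝ) (θ ω : ℝ), 0 < ω ∧ ContDiff ℝ 2 α ∧
      Function.Periodic α (2 * Real.pi) ∧
      (∀ t, deriv γ t = exp (((α t + θ : ℝ) : ℂ) * I)) ∧
      ∀ t, deriv (deriv α) t + ω ^ 2 * Real.sin (α t) = 0) ∧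
    ∀ T : ℝ, 0 < T → Function.Periodic γ T → 2 * Real.pi ≤ T

open scoped Real Topology

/-! ### Generalities -/

/-! The index is locally constant along a regular homotopy, and two curves of equal index are joined
by interpolating logarithms of their tangents. Homotopy classes are therefore labelled by the
integers, and it remains to show that the local minima of each index form exactly one shape.

Homotopy. Write the tangents as `exp w₀`, `exp w₁`, where both logarithms increase by `2πni` over a
period, and let `W s` run from one to the other. Subtract from `exp (W s)` the multiple `c s` of its
own modulus that makes the integral vanish. As long as the direction `im (W s)` is not constant, the
triangle inequality is strict, so `‖c s‖ < 1` and the corrected tangent has no zeros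
(`regularlyHomotopic_of_log_family`). For `n ≠ 0` the direction cannot be constant. For `n = 0` the
two angles are first slid so that their maxima coincide.

Elasticae. In terms of the tangent angle `α` the energy is `∫ α'²`, under the constraint `∫ exp (iα)
= 0`. The linearized closing condition is onto, so every infinitesimally admissible variation is
tangent to a family of closed curves (`exists_admissible_family`). At a local minimum this yields
the pendulum equation up to a rotation (`IsClosedAngle.exists_isPendulum`) and a second variation
inequality (`IsClosedAngle.second_variation`).

Nonzero index. The angle is monotone, and conservation of energy together with `∫ cos α = 0` forces
`ω = 0` (`IsClosedAngle.omega_eq_zero`), hence a circle. Circles do minimize, since `∫ (α' - n)² ≥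
0`.

Index zero. The pendulum oscillates about a rest position, with half period `π / j`. For `j = 1` it
is the figure eight, which is the unique global minimizer of its index up to shape
(`IsEightAngle.integral_sq_le`). The reason is a hidden convexity: `cos v` is convex as a function
of `v²` for `|v| ≤ π`, so the action dominates a quadratic form, and the angle `u` of the eight is a
positive null solution of that form. Picone's identity then makes the form nonnegative. Minimality
against each other also gives uniqueness of the eight.

For `j ≥ 2` the curve is unstable (`IsClosedAngle.not_isEulerLocalMin`). The function `g = cos (α /
2)` is an eigenfunction of the second variation with eigenvalue `-l`; the variations `g cos t` and
`g sin t` are admissible because frequency one is orthogonal to functions of period `2π / j`, and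
their second variations add up to `(1 - l) π`. Here `l` is `j²` times its value for the eight, which
exceeds `1/4` by the explicit elliptic parametrization in `exists_isEightAngle`. -/

theorem eq_of_forall_int_mul {f : ℝ → ℝ} (hf : Continuous f)
    (h : ∀ t, ∃ k : ℤ, f t = 2 * π * k) (s t : ℝ) : f s = f t := by
  choose k hk using h
  have hk' : ∀ t, ((k t : ℤ) : ℝ) = f t / (2 * π) := fun t => by
    rw [hk]; field_simp
  have hc : Continuous k := by
    rw [Int.isClosedEmbedding_coe_real.isInducing.continuous_iff]
    exact (hf.div_const _).congr fun t => (hk' t).symm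
  rw [hk, hk, PreconnectedSpace.constant inferInstance hc (x := s) (y := t)]

theorem eq_zero_of_integral_nonpos {f : ℝ → ℝ} {a b : ℝ} (hab : a < b)
    (hf : ContinuousOn f (Set.Icc a b)) (h0 : ∀ t ∈ Set.Icc a b, 0 ≤ f t)
    (h : ∫ t in a..b, f t ≤ 0) : ∀ t ∈ Set.Icc a b, f t = 0 := by
  intro t ht
  by_contra hne
  have := intervalIntegral.integral_pos hab hf (fun x hx => h0 x (Set.Ioc_subset_Icc_self hx))
    ⟨t, ht, lt_of_le_of_ne (h0 t ht) (Ne.symm hne)⟩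
  linarith

theorem exp_ofReal_mul_I_inj {x y : ℝ} (h : exp (x * I) = exp (y * I)) :
    ∃ k : ℤ, x - y = 2 * π * k := by
  obtain ⟨k, hk⟩ := Complex.exp_eq_exp_iff_exists_int.1 h
  refine ⟨k, ?_⟩
  have := congrArg Complex.im hk
  simp at this
  linarith

theorem contDiff_one_of_hasDerivAt {E : Type*} [NormedAddCommGroup E] [NormedSpace ℝ E]
    {f f' : ℝ → E} (h : ∀ t, HasDerivAt f (f' t) t) (hc : Continuous f') : ContDiff ℝ 1 f := by
  rw [contDiff_one_iff_deriv]
  refine ⟨fun t => (h t).differentiableAt, ?_⟩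
  rwa [funext fun t => (h t).deriv]

theorem contDiff_two_of_hasDerivAt {E : Type*} [NormedAddCommGroup E] [NormedSpace ℝ E]
    {f f' : ℝ → E} (h : ∀ t, HasDerivAt f (f' t) t) (hc : ContDiff ℝ 1 f') : ContDiff ℝ 2 f := by
  have h2 : (2 : WithTop ℕ∞) = 1 + 1 := by norm_num
  rw [h2, contDiff_succ_iff_deriv]
  refine ⟨fun t => (h t).differentiableAt, by simp, ?_⟩
  rwa [funext fun t => (h t).deriv]

theorem ContDiff.contDiff_one_deriv {E : Type*} [NormedAddCommGroup E] [NormedSpace ℝ E]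
    {f : ℝ → E} (h : ContDiff ℝ 2 f) : ContDiff ℝ 1 (deriv f) := by
  have h2 : (2 : WithTop ℕ∞) = 1 + 1 := by norm_num
  rw [h2, contDiff_succ_iff_deriv] at h
  exact h.2.2

theorem ContDiff.hasDerivAt_deriv {E : Type*} [NormedAddCommGroup E] [NormedSpace ℝ E]
    {f : ℝ → E} {n : WithTop ℕ∞} (h : ContDiff ℝ n f) (hn : n ≠ 0) (t : ℝ) :
    HasDerivAt f (deriv f t) t :=
  (h.differentiable hn t).hasDerivAt

theorem hasDerivAt_integral_zero {E : Type*} [NormedAddCommGroup E] [NormedSpace ℝ E]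
    [CompleteSpace E] {f : ℝ → E} (hf : Continuous f) (t : ℝ) :
    HasDerivAt (fun x => ∫ u in (0 : ℝ)..x, f u) (f t) t :=
  intervalIntegral.integral_hasDerivAt_right (hf.intervalIntegrable _ _)
    (hf.stronglyMeasurableAtFilter _ _) hf.continuousAt

theorem Function.Periodic.deriv {E : Type*} [NormedAddCommGroup E] [NormedSpace ℝ E]
    {f : ℝ → E} {c : ℝ} (h : Function.Periodic f c) : Function.Periodic (deriv f) c := by
  intro t
  rw [← deriv_comp_add_const]
  congr 1
  exact funext h

theorem periodic_integral_of_integral_eq_zero {E : Type*} [NormedAddCommGroup E]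
    [NormedSpace ℝ E] [CompleteSpace E] {f : ℝ → E} {c : ℝ} (hf : Continuous f)
    (hp : Function.Periodic f c) (h0 : ∫ u in (0 : ℝ)..c, f u = 0) :
    Function.Periodic (fun t => ∫ u in (0 : ℝ)..t, f u) c := by
  intro t
  have hi : ∀ a b, IntervalIntegrable f MeasureTheory.volume a b :=
    fun a b => hf.intervalIntegrable a b
  have h1 := hp.intervalIntegral_add_eq t 0
  simp only [zero_add] at h1
  show ∫ u in (0 : ℝ)..(t + c), f u = ∫ u in (0 : ℝ)..t, f u
  rw [← intervalIntegral.integral_add_adjacent_intervals (hi 0 t) (hi t (t + c)), h1, h0, add_zero]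

/-! ### Logarithms of nonvanishing curves and the Whitney index -/

/-- A primitive of `z' / z`, started at a logarithm of `z 0`, works because `z * exp (-w)` has zero
derivative. No covering theory is needed. -/
theorem exists_contDiff_log {z : ℝ → ℂ} (hz : ContDiff ℝ 1 z) (h0 : ∀ t, z t ≠ 0) :
    ∃ w : ℝ → ℂ, ContDiff ℝ 1 w ∧ ∀ t, z t = exp (w t) := by
  have hzc : Continuous z := hz.continuous
  have hq : Continuous fun t => deriv z t / z t :=
    (hz.continuous_deriv le_rfl).div hzc h0
  have hw : ∀ t, HasDerivAt (fun t => Complex.log (z 0) + ∫ u in (0 : ℝ)..t, deriv z u / z u)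
      (deriv z t / z t) t := fun t => (hasDerivAt_integral_zero hq t).const_add _
  refine ⟨_, contDiff_one_of_hasDerivAt hw hq, ?_⟩
  set w : ℝ → ℂ := fun t => Complex.log (z 0) + ∫ u in (0 : ℝ)..t, deriv z u / z u
  have hd : ∀ t, HasDerivAt (fun t => z t * exp (-w t)) 0 t := by
    intro t
    have h1 := (hz.hasDerivAt_deriv one_ne_zero t).mul (hw t).neg.cexp
    refine h1.congr_deriv ?_
    have := h0 t
    field_simp
    simp
  intro t
  have h1 := is_const_of_deriv_eq_zero (fun t => (hd t).differentiableAt)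
    (fun t => (hd t).deriv) t 0
  have h2 : z 0 * exp (-w 0) = 1 := by
    simp [w, Complex.exp_neg, Complex.exp_log (h0 0), h0 0]
  rw [h2, Complex.exp_neg] at h1
  field_simp at h1
  exact h1

theorem eq_add_of_exp_periodic {w : ℝ → ℂ} (hw : Continuous w)
    (hp : ∀ t, exp (w (t + 2 * π)) = exp (w t)) :
    ∃ n : ℤ, ∀ t, w (t + 2 * π) = w t + 2 * π * n * I := by
  have h : ∀ t, ∃ k : ℤ, w (t + 2 * π) = w t + k * (2 * π * I) := fun t =>
    Complex.exp_eq_exp_iff_exists_int.1 (hp t)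
  have hc : Continuous fun t => (w (t + 2 * π) - w t).im := by fun_prop
  have h' := eq_of_forall_int_mul hc fun t => by
    obtain ⟨k, hk⟩ := h t
    exact ⟨k, by rw [hk]; simp; ring⟩
  obtain ⟨n, hn⟩ := h 0
  refine ⟨n, fun t => ?_⟩
  obtain ⟨k, hk⟩ := h t
  have h1 := h' t 0
  rw [hk, hn] at h1
  have h2 : (k : ℝ) = n := by
    have : (k : ℝ) * (2 * π) = n * (2 * π) := by simpa using h1
    exact mul_right_cancel₀ (by positivity) this
  have h3 : k = n := by exact_mod_cast h2
  rw [hk, h3]; ring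

theorem IsRegularClosedCurve.exists_log {γ : ℝ → ℂ} (h : IsRegularClosedCurve 2 γ) :
    ∃ (w : ℝ → ℂ) (n : ℤ), ContDiff ℝ 1 w ∧ (∀ t, deriv γ t = exp (w t)) ∧
      ∀ t, w (t + 2 * π) = w t + 2 * π * n * I := by
  obtain ⟨w, hw, hγ⟩ := exists_contDiff_log h.contDiff.contDiff_one_deriv h.deriv_ne_zero
  obtain ⟨n, hn⟩ := eq_add_of_exp_periodic hw.continuous
    fun t => by rw [← hγ, ← hγ, h.periodic.deriv t]
  exact ⟨w, n, hw, hγ, hn⟩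

theorem hasWhitneyIndex_of_log {γ : ℝ → ℂ} {w : ℝ → ℂ} {n : ℤ} (hw : Continuous w)
    (hγ : ∀ t, deriv γ t = exp (w t)) (hn : ∀ t, w (t + 2 * π) = w t + 2 * π * n * I) :
    HasWhitneyIndex γ n := by
  refine ⟨fun t => (w t).im, Complex.continuous_im.comp hw, fun t => ?_, ?_⟩
  · rw [hγ, Complex.norm_exp, Complex.ofReal_exp, ← Complex.exp_add, Complex.re_add_im]
  · have := congrArg Complex.im (hn 0)
    simp at this
    simp [this]

theorem HasWhitneyIndex.unique {γ : ℝ → ℂ} {m n : ℤ} (h0 : ∀ t, deriv γ t ≠ 0)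
    (hm : HasWhitneyIndex γ m) (hn : HasWhitneyIndex γ n) : m = n := by
  obtain ⟨α, hα, hα1, hα2⟩ := hm
  obtain ⟨β, hβ, hβ1, hβ2⟩ := hn
  have h := eq_of_forall_int_mul (hα.sub hβ) (fun t => exp_ofReal_mul_I_inj (by
    have h1 : (‖deriv γ t‖ : ℂ) ≠ 0 := by simpa using h0 t
    exact mul_left_cancel₀ h1 ((hα1 t).symm.trans (hβ1 t)))) (2 * π) 0
  have h2 : 2 * π * (m : ℝ) = 2 * π * n := by
    simp only [Pi.sub_apply] at h
    linarith
  exact_mod_cast mul_left_cancel₀ (by positivity) h2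

/-- The quotient of the tangents stays in the open unit disc about `1`. Its principal argument is
thus continuous and periodic, and adding it to an angle of the first curve gives an angle of the
second with the same total increase. -/
theorem HasWhitneyIndex.of_norm_sub_lt {γ₀ γ₁ : ℝ → ℂ} {n : ℤ} (h : HasWhitneyIndex γ₀ n)
    (h0 : Continuous (deriv γ₀)) (h1 : Continuous (deriv γ₁))
    (hp0 : Function.Periodic (deriv γ₀) (2 * π))
    (hp1 : Function.Periodic (deriv γ₁) (2 * π))
    (hlt : ∀ t, ‖deriv γ₁ t - deriv γ₀ t‖ < ‖deriv γ₀ t‖) :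
    HasWhitneyIndex γ₁ n := by
  obtain ⟨α, hα, hα1, hα2⟩ := h
  have hne : ∀ t, deriv γ₀ t ≠ 0 := fun t =>
    norm_pos_iff.1 ((norm_nonneg _).trans_lt (hlt t))
  set q : ℝ → ℂ := fun t => deriv γ₁ t / deriv γ₀ t
  have hq : Continuous q := h1.div h0 hne
  have hqs : ∀ t, q t ∈ Complex.slitPlane := by
    intro t
    left
    have h2 : ‖q t - 1‖ < 1 := by
      have : q t - 1 = (deriv γ₁ t - deriv γ₀ t) / deriv γ₀ t := by
        simp only [q]; field_simp [hne t]
      rw [this, norm_div, div_lt_one (norm_pos_iff.2 (hne t))]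
      exact hlt t
    have h3 := (abs_le.1 (Complex.abs_re_le_norm (q t - 1))).1
    simp at h3
    linarith
  refine ⟨fun t => α t + (q t).arg, hα.add ?_, fun t => ?_, ?_⟩
  · exact continuous_iff_continuousAt.2 fun t =>
      (Complex.continuousAt_arg (hqs t)).comp hq.continuousAt
  · have h2 : deriv γ₁ t = deriv γ₀ t * q t := by
      simp only [q]; field_simp [hne t]
    have h3 : ‖deriv γ₁ t‖ = ‖deriv γ₀ t‖ * ‖q t‖ := by rw [h2, norm_mul]
    rw [h3]
    conv_lhs => rw [h2, hα1 t, ← Complex.norm_mul_exp_arg_mul_I (q t)]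
    push_cast
    rw [add_mul, Complex.exp_add]
    ring
  · have : q (2 * π) = q 0 := by
      have e0 := hp0 0
      have e1 := hp1 0
      rw [zero_add] at e0 e1
      simp only [q, e0, e1]
    simp only [this]
    linarith

/-! ### Regular homotopies -/

theorem IsRegularClosedCurve.of_le {r k : ℕ} {γ : ℝ → ℂ} (h : IsRegularClosedCurve k γ)
    (hr : r ≤ k) : IsRegularClosedCurve r γ :=
  ⟨h.contDiff.of_le (by exact_mod_cast hr), h.periodic, h.deriv_ne_zero⟩

/-- By compactness the speed has a positive lower bound over the whole homotopy, and uniform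
continuity keeps the tangents of nearby stages closer than that. Finitely many short steps then
carry the index from one end to the other. -/
theorem RegularlyHomotopic.hasWhitneyIndex {r : ℕ} (hr : 1 ≤ r) {γ₀ γ₁ : ℝ → ℂ} {n : ℤ}
    (h : RegularlyHomotopic r γ₀ γ₁) (hn : HasWhitneyIndex γ₀ n) : HasWhitneyIndex γ₁ n := by
  obtain ⟨H, hH0, hH1, hH, hc⟩ := h
  have hc1 := hc 1 hr
  simp only [iteratedDeriv_one] at hc1
  set D : ℝ × ℝ → ℂ := fun p => deriv (H p.1) p.2
  set K : Set (ℝ × ℝ) := Set.Icc (0 : ℝ) 1 ×ˢ Set.Icc (0 : ℝ) (2 * π)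
  have hK : IsCompact K := isCompact_Icc.prod isCompact_Icc
  have hcK : ContinuousOn D K := hc1.mono (Set.prod_mono le_rfl (Set.subset_univ _))
  have hne : K.Nonempty := ⟨(0, 0), by simp [K, Real.pi_pos.le]⟩
  obtain ⟨p, hp, hmin⟩ := hK.exists_isMinOn hne hcK.norm
  have hpos : 0 < ‖D p‖ := norm_pos_iff.2 ((hH p.1 hp.1).deriv_ne_zero _)
  obtain ⟨δ, hδ, hu⟩ := Metric.uniformContinuousOn_iff.1
    (hK.uniformContinuousOn_of_continuous hcK) _ hpos
  have hper : ∀ s ∈ Set.Icc (0 : ℝ) 1, Function.Periodic (deriv (H s)) (2 * π) :=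
    fun s hs => (hH s hs).periodic.deriv
  have hcont : ∀ s ∈ Set.Icc (0 : ℝ) 1, Continuous (deriv (H s)) := fun s hs =>
    (hH s hs).contDiff.continuous_deriv (by exact_mod_cast hr)
  have hstep : ∀ s ∈ Set.Icc (0 : ℝ) 1, ∀ s' ∈ Set.Icc (0 : ℝ) 1, |s' - s| < δ →
      HasWhitneyIndex (H s) n → HasWhitneyIndex (H s') n := by
    intro s hs s' hs' hd hi
    refine hi.of_norm_sub_lt (hcont s hs) (hcont s' hs') (hper s hs) (hper s' hs') fun t => ?_
    have hpp : Function.Periodic (fun t => (deriv (H s') t, deriv (H s) t)) (2 * π) :=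
      fun t => Prod.ext (hper s' hs' t) (hper s hs t)
    obtain ⟨u, hu', e⟩ := hpp.exists_mem_Ico₀ Real.two_pi_pos t
    obtain ⟨e1, e2⟩ := Prod.ext_iff.1 e
    simp only at e1 e2
    rw [e1, e2, ← dist_eq_norm]
    have hu0 := Set.Ico_subset_Icc_self hu'
    exact (hu (s', u) ⟨hs', hu0⟩ (s, u) ⟨hs, hu0⟩ (by simpa [Prod.dist_eq, Real.dist_eq])).trans_le
      (hmin (a := (s, u)) ⟨hs, hu0⟩)
  obtain ⟨N, hN⟩ := exists_nat_one_div_lt hδ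
  have hmem : ∀ k ≤ N + 1, (k : ℝ) / (N + 1) ∈ Set.Icc (0 : ℝ) 1 := fun k hk =>
    ⟨by positivity, (div_le_one (by positivity)).2 (by exact_mod_cast hk)⟩
  have hind : ∀ k ≤ N + 1, HasWhitneyIndex (H ((k : ℝ) / (N + 1))) n := by
    intro k
    induction k with
    | zero => intro _; simpa [hH0] using hn
    | succ k ih =>
      intro hk
      refine hstep _ (hmem k (by omega)) _ (hmem _ hk) ?_ (ih (by omega))
      rw [← sub_div]
      push_cast
      rw [add_sub_cancel_left, abs_of_pos (by positivity)]
      exact hN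
  have := hind (N + 1) le_rfl
  push_cast at this
  rwa [div_self (by positivity), hH1] at this

/-! ### Closing up a family of tangents -/

/-- This is the equality case of the triangle inequality for integrals. After rotating the integral
`Z` to the positive axis, the nonnegative function `|exp W| (1 - cos (im W - arg Z))` has
nonpositive integral, so it vanishes and `im W - arg Z` takes values in `2πℤ`. -/
theorem im_eq_of_integral_norm_le {W : ℝ → ℂ} (hW : Continuous W)
    (h : ∫ t in (0 : ℝ)..2 * π, Real.exp (W t).re ≤ ‖∫ t in (0 : ℝ)..2 * π, exp (W t)‖) :
    ∀ t ∈ Set.Icc 0 (2 * π), (W t).im = (W 0).im := by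
  set Z := ∫ t in (0 : ℝ)..2 * π, exp (W t) with hZ
  have hre : ∫ t in (0 : ℝ)..2 * π, Real.exp (W t).re * Real.cos ((W t).im - Z.arg) = ‖Z‖ := by
    have h1 : (∫ t in (0 : ℝ)..2 * π, exp (W t) * exp (-(Z.arg * I))) = ‖Z‖ := by
      rw [intervalIntegral.integral_mul_const, ← hZ, Complex.exp_neg]
      have := Complex.norm_mul_exp_arg_mul_I Z
      rw [← div_eq_mul_inv, div_eq_iff (Complex.exp_ne_zero _), this]
    have h2 := congrArg Complex.reCLM h1
    rw [← ContinuousLinearMap.intervalIntegral_comp_comm _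
      (Continuous.intervalIntegrable (by fun_prop) _ _)] at h2
    simp only [Complex.reCLM_apply, Complex.ofReal_re] at h2
    rw [← h2]
    refine intervalIntegral.integral_congr fun t _ => ?_
    simp only [← Complex.exp_add, Complex.exp_re]
    simp [sub_eq_add_neg]
  have hz := eq_zero_of_integral_nonpos (f := fun t => Real.exp (W t).re
    - Real.exp (W t).re * Real.cos ((W t).im - Z.arg)) Real.two_pi_pos
    (Continuous.continuousOn (by fun_prop)) (fun t _ => ?_) ?_
  · have hint : ∀ t ∈ Set.Icc 0 (2 * π), ∃ k : ℤ, (W t).im - Z.arg = 2 * π * k := by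
      intro t ht
      have h1 := hz t ht
      have h2 : Real.cos ((W t).im - Z.arg) = 1 := by
        have h3 : Real.exp (W t).re * (1 - Real.cos ((W t).im - Z.arg)) = 0 := by linarith
        have := (mul_eq_zero.1 h3).resolve_left (Real.exp_pos _).ne'
        linarith
      obtain ⟨k, hk⟩ := (Real.cos_eq_one_iff _).1 h2
      exact ⟨k, by rw [← hk]; ring⟩
    -- Clamping the parameter to the interval gives a function on all of `ℝ`, as
    -- `eq_of_forall_int_mul` requires.
    have hcl : ∀ t : ℝ, max 0 (min t (2 * π)) ∈ Set.Icc 0 (2 * π) := fun t =>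
      ⟨le_max_left _ _, max_le Real.two_pi_pos.le (min_le_right _ _)⟩
    have hconst := eq_of_forall_int_mul (f := fun t => (W (max 0 (min t (2 * π)))).im - Z.arg)
      (by fun_prop) fun t => hint _ (hcl t)
    intro t ht
    have h1 := hconst t 0
    simp only [min_eq_left ht.2, max_eq_right ht.1, min_eq_left Real.two_pi_pos.le,
      max_self] at h1
    linarith
  · have := Real.exp_pos (W t).re
    nlinarith [Real.cos_le_one ((W t).im - Z.arg)]
  · rw [intervalIntegral.integral_sub (Continuous.intervalIntegrable (by fun_prop) _ _)
      (Continuous.intervalIntegrable (by fun_prop) _ _), hre]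
    linarith

/-- The corrected tangent is `v = exp W - |exp W| c`, where `c` is the mean direction weighted by
speed. Its integral vanishes by the choice of `c`, and it has no zeros because `‖c‖ < 1`. At the two
ends the given curves are closed, so `c = 0` and nothing is changed. -/
theorem regularlyHomotopic_of_log_family {r : ℕ} (hr : r ≤ 2) {γ₀ γ₁ : ℝ → ℂ} {n : ℤ}
    {W W' : ℝ → ℝ → ℂ}
    (h₀ : IsRegularClosedCurve 2 γ₀) (h₁ : IsRegularClosedCurve 2 γ₁)
    (hγ₀ : ∀ t, deriv γ₀ t = exp (W 0 t)) (hγ₁ : ∀ t, deriv γ₁ t = exp (W 1 t))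
    (hW : ∀ s t, HasDerivAt (W s) (W' s t) t)
    (hWc : Continuous fun p : ℝ × ℝ => W p.1 p.2) (hWc' : Continuous fun p : ℝ × ℝ => W' p.1 p.2)
    (hWp : ∀ s t, W s (t + 2 * π) = W s t + 2 * π * n * I)
    (hne : ∀ s ∈ Set.Icc (0 : ℝ) 1, ∃ t ∈ Set.Icc 0 (2 * π), (W s t).im ≠ (W s 0).im) :
    RegularlyHomotopic r γ₀ γ₁ := by
  have hWs : ∀ s, Continuous (W s) := fun s => hWc.comp (Continuous.prodMk_right s)
  set J : ℝ → ℝ := fun s => ∫ t in (0 : ℝ)..2 * π, Real.exp (W s t).re with hJd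
  set c : ℝ → ℂ := fun s => (∫ t in (0 : ℝ)..2 * π, exp (W s t)) / J s with hcd
  have hJpos : ∀ s, 0 < J s := fun s =>
    intervalIntegral.intervalIntegral_pos_of_pos
      (Continuous.intervalIntegrable (by have := hWs s; fun_prop) _ _)
      (fun _ => Real.exp_pos _) Real.two_pi_pos
  have hcc : Continuous c := by
    refine Continuous.div ?_ (Complex.continuous_ofReal.comp ?_) fun s => ?_
    · exact intervalIntegral.continuous_parametric_intervalIntegral_of_continuous'
        (f := fun s t => exp (W s t)) (by unfold Function.uncurry; fun_prop) _ _
    · exact intervalIntegral.continuous_parametric_intervalIntegral_of_continuous'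
        (f := fun s t => Real.exp (W s t).re) (by unfold Function.uncurry; fun_prop) _ _
    · exact_mod_cast (hJpos s).ne'
  have hc1 : ∀ s ∈ Set.Icc (0 : ℝ) 1, ‖c s‖ < 1 := by
    intro s hs
    by_contra hcon
    obtain ⟨t, ht, hne⟩ := hne s hs
    refine hne (im_eq_of_integral_norm_le (hWs s) ?_ t ht)
    rw [not_lt] at hcon
    simp only [hcd, norm_div, Complex.norm_real, Real.norm_eq_abs, abs_of_pos (hJpos s)] at hcon
    rwa [one_le_div (hJpos s)] at hcon
  set v : ℝ → ℝ → ℂ := fun s t => exp (W s t) - Real.exp (W s t).re * c s with hvd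
  set v' : ℝ → ℝ → ℂ := fun s t =>
    exp (W s t) * W' s t - (Real.exp (W s t).re * (W' s t).re : ℝ) * c s with hv'd
  have hv : ∀ s t, HasDerivAt (v s) (v' s t) t := by
    intro s t
    have hre : HasDerivAt (fun t => (W s t).re) (W' s t).re t :=
      Complex.reCLM.hasFDerivAt.comp_hasDerivAt t (hW s t)
    exact (hW s t).cexp.sub ((hre.exp.ofReal_comp).mul_const _)
  have hvc : Continuous fun p : ℝ × ℝ => v p.1 p.2 := by fun_prop
  have hvc' : Continuous fun p : ℝ × ℝ => v' p.1 p.2 := by fun_prop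
  have hvs : ∀ s, Continuous (v s) := fun s => hvc.comp (Continuous.prodMk_right s)
  have hvs' : ∀ s, Continuous (v' s) := fun s => hvc'.comp (Continuous.prodMk_right s)
  have hv0 : ∀ s ∈ Set.Icc (0 : ℝ) 1, ∀ t, v s t ≠ 0 := by
    intro s hs t h0
    have h1 := congrArg norm (sub_eq_zero.1 h0)
    rw [Complex.norm_exp, norm_mul, Complex.norm_real, Real.norm_eq_abs, Real.abs_exp] at h1
    nlinarith [hc1 s hs, Real.exp_pos (W s t).re]
  have hvp : ∀ s, Function.Periodic (v s) (2 * π) := by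
    intro s t
    have e1 : exp (W s (t + 2 * π)) = exp (W s t) :=
      Complex.exp_eq_exp_iff_exists_int.2 ⟨n, by rw [hWp]; ring⟩
    have e2 : (W s (t + 2 * π)).re = (W s t).re := by
      rw [hWp]; simp
    simp only [hvd, e1, e2]
  have hvi : ∀ s, ∫ t in (0 : ℝ)..2 * π, v s t = 0 := by
    intro s
    have := hWs s
    simp only [hvd]
    rw [intervalIntegral.integral_sub (Continuous.intervalIntegrable (by fun_prop) _ _)
      (Continuous.intervalIntegrable (by fun_prop) _ _), intervalIntegral.integral_mul_const,
      intervalIntegral.integral_ofReal]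
    simp only [hcd]
    rw [mul_div_cancel₀, sub_self]
    exact_mod_cast (hJpos s).ne'
  -- The base points are joined by a segment, so that the end stages are the given curves themselves
  -- and not translates of them.
  set H : ℝ → ℝ → ℂ := fun s t =>
    ((1 - s) * γ₀ 0 + s * γ₁ 0) + ∫ u in (0 : ℝ)..t, v s u with hHd
  have hH : ∀ s t, HasDerivAt (H s) (v s t) t := fun s t =>
    (hasDerivAt_integral_zero (hvs s) t).const_add _
  have hend : ∀ {γ : ℝ → ℂ} {s : ℝ}, IsRegularClosedCurve 2 γ →
      (∀ t, deriv γ t = exp (W s t)) → (1 - s) * γ₀ 0 + s * γ₁ 0 = γ 0 → H s = γ := by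
    intro γ s hγ hw h0
    have e : ∀ t, exp (W s t) = deriv γ t := fun t => (hw t).symm
    have hint : ∀ t, ∫ u in (0 : ℝ)..t, deriv γ u = γ t - γ 0 := fun t =>
      intervalIntegral.integral_deriv_eq_sub
        (fun x _ => hγ.contDiff.differentiable (by norm_num) x)
        ((hγ.contDiff.continuous_deriv (by norm_num)).intervalIntegrable _ _)
    have hc0 : c s = 0 := by
      have := hγ.periodic 0
      rw [zero_add] at this
      simp only [hcd, e, hint, this, sub_self, zero_div]
    funext t
    simp only [hHd, hvd, hc0, e, mul_zero, sub_zero, hint, h0]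
    ring
  have hreg : ∀ s ∈ Set.Icc (0 : ℝ) 1, IsRegularClosedCurve 2 (H s) := by
    intro s hs
    refine ⟨contDiff_two_of_hasDerivAt (hH s) (contDiff_one_of_hasDerivAt (hv s) (hvs' s)),
      fun t => ?_, fun t => by rw [(hH s t).deriv]; exact hv0 s hs t⟩
    simp only [hHd]
    exact congrArg _ (periodic_integral_of_integral_eq_zero (hvs s) (hvp s) (hvi s) t)
  refine ⟨H, hend h₀ hγ₀ (by simp), hend h₁ hγ₁ (by simp),
    fun s hs => (hreg s hs).of_le hr, ?_⟩
  intro j hj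
  have hd : ∀ s, deriv (H s) = v s := fun s => funext fun t => (hH s t).deriv
  have hd' : ∀ s, deriv (v s) = v' s := fun s => funext fun t => (hv s t).deriv
  have hj2 := hj.trans hr
  interval_cases j
  · simp only [iteratedDeriv_zero]
    refine Continuous.continuousOn ?_
    have := intervalIntegral.continuous_parametric_intervalIntegral_of_continuous
      (μ := MeasureTheory.volume) (a₀ := 0)
      (f := fun (p : ℝ × ℝ) u => v p.1 u) (s := Prod.snd)
      (hvc.comp (by fun_prop : Continuous fun q : (ℝ × ℝ) × ℝ => (q.1.1, q.2))) continuous_snd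
    simp only [hHd]
    fun_prop
  · simp only [iteratedDeriv_one, hd]
    exact hvc.continuousOn
  · simp only [iteratedDeriv_succ, iteratedDeriv_zero, hd, hd']
    exact hvc'.continuousOn

/-- While the logarithms are interpolated, their parameters are slid relative to each other by a
total of `d`. The shifts vanish for the logarithm that survives at `s = 0` and at `s = 1`. Equal
increments `2πni` make every stage have the same increment. -/
theorem regularlyHomotopic_of_log {r : ℕ} (hr : r ≤ 2) {γ₀ γ₁ w₀ w₁ : ℝ → ℂ} {n : ℤ} {d : ℝ}
    (h₀ : IsRegularClosedCurve 2 γ₀) (h₁ : IsRegularClosedCurve 2 γ₁)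
    (hw₀ : ContDiff ℝ 1 w₀) (hw₁ : ContDiff ℝ 1 w₁)
    (hγ₀ : ∀ t, deriv γ₀ t = exp (w₀ t)) (hγ₁ : ∀ t, deriv γ₁ t = exp (w₁ t))
    (hn₀ : ∀ t, w₀ (t + 2 * π) = w₀ t + 2 * π * n * I)
    (hn₁ : ∀ t, w₁ (t + 2 * π) = w₁ t + 2 * π * n * I)
    (hne : ∀ s ∈ Set.Icc (0 : ℝ) 1, ∃ t ∈ Set.Icc 0 (2 * π),
      ((1 - s) * w₀ (t + s * d) + s * w₁ (t - (1 - s) * d)).im ≠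
        ((1 - s) * w₀ (0 + s * d) + s * w₁ (0 - (1 - s) * d)).im) :
    RegularlyHomotopic r γ₀ γ₁ := by
  have c₀ := hw₀.continuous
  have c₁ := hw₁.continuous
  have c₀' := hw₀.continuous_deriv le_rfl
  have c₁' := hw₁.continuous_deriv le_rfl
  refine regularlyHomotopic_of_log_family hr h₀ h₁ (n := n)
    (W := fun s t => (1 - s) * w₀ (t + s * d) + s * w₁ (t - (1 - s) * d))
    (W' := fun s t => (1 - s) * deriv w₀ (t + s * d) + s * deriv w₁ (t - (1 - s) * d))
    (fun t => by simp [hγ₀]) (fun t => by simp [hγ₁]) (fun s t => ?_) (by fun_prop) (by fun_prop)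
    (fun s t => ?_) hne
  · exact (((hw₀.hasDerivAt_deriv one_ne_zero _).comp_add_const t (s * d)).const_mul _).add
      (((hw₁.hasDerivAt_deriv one_ne_zero _).comp_sub_const t ((1 - s) * d)).const_mul _)
  · rw [show t + 2 * π + s * d = (t + s * d) + 2 * π by ring,
      show t + 2 * π - (1 - s) * d = (t - (1 - s) * d) + 2 * π by ring, hn₀, hn₁]
    ring

theorem regularlyHomotopic_of_hasWhitneyIndex {r : ℕ} (hr : r ≤ 2) {γ₀ γ₁ : ℝ → ℂ} {n : ℤ}
    (h₀ : IsRegularClosedCurve 2 γ₀) (h₁ : IsRegularClosedCurve 2 γ₁)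
    (hn₀ : HasWhitneyIndex γ₀ n) (hn₁ : HasWhitneyIndex γ₁ n) : RegularlyHomotopic r γ₀ γ₁ := by
  obtain ⟨w₀, m₀, hw₀, hγ₀, hp₀⟩ := h₀.exists_log
  obtain ⟨w₁, m₁, hw₁, hγ₁, hp₁⟩ := h₁.exists_log
  obtain rfl := (hasWhitneyIndex_of_log hw₀.continuous hγ₀ hp₀).unique h₀.deriv_ne_zero hn₀
  obtain rfl := (hasWhitneyIndex_of_log hw₁.continuous hγ₁ hp₁).unique h₁.deriv_ne_zero hn₁
  rename' m₁ => n
  by_cases hn : n = 0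
  · subst hn
    -- For index zero the angle is periodic and so attains a maximum. It is not constant, since a
    -- curve moving in a fixed direction never closes.
    have hmax : ∀ {γ w : ℝ → ℂ}, IsRegularClosedCurve 2 γ → ContDiff ℝ 1 w →
        (∀ t, deriv γ t = exp (w t)) → (∀ t, w (t + 2 * π) = w t + 2 * π * (0 : ℤ) * I) →
        ∃ a, (∀ t, (w t).im ≤ (w a).im) ∧ ∃ t, (w t).im ≠ (w a).im := by
      intro γ w h hw hγ hp
      have hwc := hw.continuous
      have hper : Function.Periodic w (2 * π) := fun t => by simpa using hp t
      have him : Continuous fun t => (w t).im := by fun_prop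
      obtain ⟨a, ha, hmax⟩ := isCompact_Icc.exists_isMaxOn
        (Set.nonempty_Icc.2 Real.two_pi_pos.le) him.continuousOn
      refine ⟨a, fun t => ?_, ?_⟩
      · obtain ⟨u, hu, e⟩ := hper.exists_mem_Ico₀ Real.two_pi_pos t
        rw [e]
        exact hmax (Set.Ico_subset_Icc_self hu)
      · by_contra! hcon
        have h1 : ∫ t in (0 : ℝ)..2 * π, deriv γ t = γ (2 * π) - γ 0 :=
          intervalIntegral.integral_deriv_eq_sub
            (fun x _ => h.contDiff.differentiable (by norm_num) x)
            ((h.contDiff.continuous_deriv (by norm_num)).intervalIntegrable _ _)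
        have h2 : γ (2 * π) = γ 0 := by simpa using h.periodic 0
        have h3 : ∀ t, deriv γ t = (Real.exp (w t).re : ℂ) * exp ((w a).im * I) := fun t => by
          rw [hγ, ← hcon t, Complex.ofReal_exp, ← Complex.exp_add, Complex.re_add_im]
        simp only [h3, intervalIntegral.integral_mul_const, h2, sub_self,
          intervalIntegral.integral_ofReal] at h1
        have h4 := (mul_eq_zero.1 h1).resolve_right (Complex.exp_ne_zero _)
        have h5 : 0 < ∫ t in (0 : ℝ)..2 * π, Real.exp (w t).re :=
          intervalIntegral.intervalIntegral_pos_of_pos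
            (Continuous.intervalIntegrable (by fun_prop) _ _)
            (fun _ => Real.exp_pos _) Real.two_pi_pos
        exact h5.ne' (by exact_mod_cast h4)
    obtain ⟨a, ha, ta, hta⟩ := hmax h₀ hw₀ hγ₀ hp₀
    obtain ⟨b, hb, tb, htb⟩ := hmax h₁ hw₁ hγ₁ hp₁
    -- With `d = a - b` both shifted angles are maximal at `t = a - s (a - b)`. If a convex
    -- combination of them were constant, every angle occurring with positive weight would be
    -- constant.
    refine regularlyHomotopic_of_log hr h₀ h₁ hw₀ hw₁ hγ₀ hγ₁ hp₀ hp₁ (d := a - b) fun s hs => ?_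
    set f : ℝ → ℝ := fun t => ((1 - s : ℂ) * w₀ (t + s * (a - b)) +
      s * w₁ (t - (1 - s) * (a - b))).im with hf
    by_contra! hcon
    have hfv : ∀ t, f t = (1 - s) * (w₀ (t + s * (a - b))).im +
        s * (w₁ (t - (1 - s) * (a - b))).im := fun t => by
      simp [hf]
    have hfp : Function.Periodic f (2 * π) := fun t => by
      rw [hfv, hfv, show t + 2 * π + s * (a - b) = (t + s * (a - b)) + 2 * π by ring,
        show t + 2 * π - (1 - s) * (a - b) = (t - (1 - s) * (a - b)) + 2 * π by ring, hp₀, hp₁]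
      simp
    have hfc : ∀ t, f t = f 0 := fun t => by
      obtain ⟨u, hu, e⟩ := hfp.exists_mem_Ico₀ Real.two_pi_pos t
      rw [e]
      exact hcon u (Set.Ico_subset_Icc_self hu)
    have hkey : ∀ t, (1 - s) * (w₀ (t + s * (a - b))).im + s * (w₁ (t - (1 - s) * (a - b))).im =
        (1 - s) * (w₀ a).im + s * (w₁ b).im := fun t => by
      have h1 := (hfc t).trans (hfc (a - s * (a - b))).symm
      rw [hfv, hfv] at h1
      rw [h1]
      congr 4 <;> ring
    rcases hs.1.eq_or_lt with h0 | h0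
    · subst h0
      have := hkey ta
      simp at this
      exact hta this
    · have h1 := hkey (tb + (1 - s) * (a - b))
      rw [add_sub_cancel_right] at h1
      have h2 := mul_le_mul_of_nonneg_left (ha (tb + (1 - s) * (a - b) + s * (a - b)))
        (sub_nonneg.2 hs.2)
      have h3 := mul_lt_mul_of_pos_left (lt_of_le_of_ne (hb tb) htb) h0
      linarith
  -- No sliding is needed: over one period the interpolated angle increases by `2πn ≠ 0`.
  · refine regularlyHomotopic_of_log hr h₀ h₁ hw₀ hw₁ hγ₀ hγ₁ hp₀ hp₁ (d := 0) fun s hs =>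
      ⟨2 * π, Set.right_mem_Icc.2 Real.two_pi_pos.le, ?_⟩
    have e0 := hp₀ 0
    have e1 := hp₁ 0
    simp only [zero_add] at e0 e1
    simp only [mul_zero, add_zero, sub_zero, e0, e1]
    intro h
    have h1 : 2 * π * (n : ℝ) = 0 := by
      have h2 := congrArg id h
      simp at h2
      nlinarith
    exact hn (by simpa [Real.pi_ne_zero] using h1)

/-! ### The pendulum equation -/

/-- `u` solves the pendulum equation `u'' + ω² sin u = 0`, and `u'` is its derivative. -/
structure IsPendulum (ω : ℝ) (u u' : ℝ → ℝ) : Prop where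
  hasDerivAt : ∀ t, HasDerivAt u (u' t) t
  hasDerivAt' : ∀ t, HasDerivAt u' (-(ω ^ 2 * Real.sin (u t))) t

namespace IsPendulum

variable {ω : ℝ} {u u' v v' : ℝ → ℝ}

theorem continuous (h : IsPendulum ω u u') : Continuous u :=
  continuous_iff_continuousAt.2 fun t => (h.hasDerivAt t).continuousAt

theorem continuous' (h : IsPendulum ω u u') : Continuous u' :=
  continuous_iff_continuousAt.2 fun t => (h.hasDerivAt' t).continuousAt

theorem unique (hu : IsPendulum ω u u') (hv : IsPendulum ω v v') {t₀ : ℝ} (h0 : u t₀ = v t₀)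
    (h1 : u' t₀ = v' t₀) (t : ℝ) : u t = v t := by
  let F : ℝ × ℝ → ℝ × ℝ := fun p => (p.2, -(ω ^ 2 * Real.sin p.1))
  have hF : LipschitzWith (max 1 (Real.nnabs (ω ^ 2) * 1)) F := by
    refine LipschitzWith.prodMk LipschitzWith.prod_snd ?_
    refine LipschitzWith.of_dist_le_mul fun p q => ?_
    rw [dist_neg_neg, Real.dist_eq, ← mul_sub, abs_mul]
    have h2 : |Real.sin p.1 - Real.sin q.1| ≤ |p.1 - q.1| := by
      simpa [Real.dist_eq] using Real.lipschitzWith_sin.dist_le_mul p.1 q.1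
    have h3 : |p.1 - q.1| ≤ dist p q := by
      rw [Prod.dist_eq, Real.dist_eq]; exact le_max_left _ _
    exact (mul_le_mul_of_nonneg_left (h2.trans h3) (abs_nonneg _)).trans_eq (by simp)
  have h := ODE_solution_unique_univ (v := fun _ => F) (s := fun _ => Set.univ)
    (f := fun t => (u t, u' t)) (g := fun t => (v t, v' t)) (t₀ := t₀)
    (fun _ => hF.lipschitzOnWith)
    (fun t => ⟨(hu.hasDerivAt t).prodMk (hu.hasDerivAt' t), Set.mem_univ _⟩)
    (fun t => ⟨(hv.hasDerivAt t).prodMk (hv.hasDerivAt' t), Set.mem_univ _⟩)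
    (Prod.ext h0 h1)
  exact congrArg Prod.fst (congrFun h t)

theorem comp_add_const (h : IsPendulum ω u u') (c : ℝ) :
    IsPendulum ω (fun t => u (t + c)) (fun t => u' (t + c)) :=
  ⟨fun t => (h.hasDerivAt _).comp_add_const t c, fun t => (h.hasDerivAt' _).comp_add_const t c⟩

theorem neg (h : IsPendulum ω u u') : IsPendulum ω (fun t => -u t) (fun t => -u' t) :=
  ⟨fun t => (h.hasDerivAt t).neg, fun t => (h.hasDerivAt' t).neg.congr_deriv (by simp)⟩

theorem comp_const_sub (h : IsPendulum ω u u') (c : ℝ) :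
    IsPendulum ω (fun t => u (c - t)) (fun t => -u' (c - t)) :=
  ⟨fun t => (h.hasDerivAt _).comp_const_sub c t,
    fun t => ((h.hasDerivAt' _).comp_const_sub c t).neg.congr_deriv (by simp)⟩

theorem sub_int_mul (h : IsPendulum ω u u') (k : ℤ) : IsPendulum ω (fun t => u t - k * (2 * π)) u' :=
  ⟨fun t => (h.hasDerivAt t).sub_const _, fun t => by
    simpa [Real.sin_sub_int_mul_two_pi] using h.hasDerivAt' t⟩

theorem energy (h : IsPendulum ω u u') (s t : ℝ) :
    u' s ^ 2 / 2 - ω ^ 2 * Real.cos (u s) = u' t ^ 2 / 2 - ω ^ 2 * Real.cos (u t) := by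
  have hd : ∀ t, HasDerivAt (fun t => u' t ^ 2 / 2 - ω ^ 2 * Real.cos (u t)) 0 t := fun t => by
    refine ((((h.hasDerivAt' t).pow 2).div_const 2).sub
      ((h.hasDerivAt t).cos.const_mul (ω ^ 2))).congr_deriv ?_
    simp; ring
  exact is_const_of_deriv_eq_zero (fun t => (hd t).differentiableAt) (fun t => (hd t).deriv) s t

end IsPendulum

/-- A normalized tangent angle of a figure eight elastica passed once: it starts at one of the
two points of maximal curvature. -/
structure IsEightAngle (ω : ℝ) (u u' : ℝ → ℝ) : Prop extends IsPendulum ω u u' where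
  zero : u 0 = 0
  deriv_pos : 0 < u' 0
  pos : ∀ t ∈ Set.Ioo 0 π, 0 < u t
  abs_lt : ∀ t, |u t| < π
  antiperiodic : Function.Antiperiodic u π
  integral_cos : ∫ t in (0 : ℝ)..2 * π, Real.cos (u t) = 0

theorem IsPendulum.integral_sin_eq_zero {ω : ℝ} {u u' : ℝ → ℝ} (hω : ω ≠ 0)
    (h : IsPendulum ω u u') {T : ℝ} (hp : u' T = u' 0) :
    ∫ t in (0 : ℝ)..T, Real.sin (u t) = 0 := by
  have hc := h.continuous
  have h1 := intervalIntegral.integral_eq_sub_of_hasDerivAt (fun t _ => h.hasDerivAt' t)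
    (Continuous.intervalIntegrable (by fun_prop) 0 T)
  rw [hp, sub_self, intervalIntegral.integral_neg, intervalIntegral.integral_const_mul] at h1
  simpa [hω] using h1

theorem integral_exp_mul_I {u : ℝ → ℝ} (hu : Continuous u) (a b : ℝ) :
    ∫ t in a..b, exp (u t * I) =
      ((∫ t in a..b, Real.cos (u t) : ℝ) : ℂ) + ((∫ t in a..b, Real.sin (u t) : ℝ) : ℂ) * I := by
  rw [← intervalIntegral.integral_ofReal, ← intervalIntegral.integral_ofReal,
    ← intervalIntegral.integral_mul_const, ← intervalIntegral.integral_add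
      (Continuous.intervalIntegrable (by fun_prop) _ _)
      (Continuous.intervalIntegrable (by fun_prop) _ _)]
  refine intervalIntegral.integral_congr fun t _ => ?_
  simp only [Complex.exp_mul_I]
  push_cast
  rfl

/-- A periodic solution of the pendulum equation with `∫ cos u = 0` oscillates about a rest
position `2πk`. -/
theorem IsPendulum.exists_normalization {ω : ℝ} {u u' : ℝ → ℝ} (hω : 0 < ω)
    (h : IsPendulum ω u u') (hp : Function.Periodic u (2 * π))
    (hcos : ∫ t in (0 : ℝ)..2 * π, Real.cos (u t) = 0) :
    ∃ (t₀ : ℝ) (k : ℤ) (τ : ℝ) (v v' : ℝ → ℝ), IsPendulum ω v v' ∧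
      (∀ t, u (t + t₀) = v t + 2 * π * k) ∧ 0 < τ ∧ τ ≤ π ∧ v 0 = 0 ∧ 0 < v' 0 ∧
      (∀ t ∈ Set.Ioo 0 τ, 0 < v t) ∧ (∀ t, |v t| < π) ∧ Function.Antiperiodic v τ := by
  have huc := h.continuous
  have huc' := h.continuous'
  have hderiv : deriv u = u' := funext fun t => (h.hasDerivAt t).deriv
  have hp' : Function.Periodic u' (2 * π) := hderiv ▸ hp.deriv
  have hIcc : (Set.Icc (0 : ℝ) (2 * π)).Nonempty := Set.nonempty_Icc.2 Real.two_pi_pos.le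
  have hglob : ∀ {f : ℝ → ℝ}, Continuous f → Function.Periodic f (2 * π) →
      ∃ a, ∀ t, f t ≤ f a := by
    intro f hf hfp
    obtain ⟨a, _, hmax⟩ := isCompact_Icc.exists_isMaxOn hIcc hf.continuousOn
    refine ⟨a, fun t => ?_⟩
    obtain ⟨s, hs, e⟩ := hfp.exists_mem_Ico₀ Real.two_pi_pos t
    rw [e]
    exact hmax (Set.Ico_subset_Icc_self hs)
  -- At the greatest angular velocity, `t₀`, the equation gives `sin u = 0`; at the greatest angle,
  -- `t₁`, the velocity vanishes. Comparing energies at the two identifies `t₀` as a passage through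
  -- the lower rest position.
  obtain ⟨t₀, ht₀⟩ := hglob huc' hp'
  obtain ⟨t₁, ht₁⟩ := hglob huc hp
  have hu1 : u' t₁ = 0 := by
    have : IsLocalMax u t₁ := Filter.Eventually.of_forall ht₁
    rw [← hderiv]; exact this.deriv_eq_zero
  have hsin0 : Real.sin (u t₀) = 0 := by
    have h1 : IsLocalMax u' t₀ := Filter.Eventually.of_forall ht₀
    have h2 := h1.hasDerivAt_eq_zero (h.hasDerivAt' t₀)
    have : ω ^ 2 ≠ 0 := by positivity
    simpa [this] using h2
  have hconst : ¬ ∀ t, u t = u t₀ := by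
    intro hc
    simp only [hc, intervalIntegral.integral_const, smul_eq_mul] at hcos
    have h1 := Real.sin_sq_add_cos_sq (u t₀)
    rw [hsin0] at h1
    have h2 : Real.cos (u t₀) = 0 := by
      simpa [Real.pi_ne_zero] using hcos
    rw [h2] at h1
    norm_num at h1
  have hpos : 0 < u' t₀ := by
    by_contra hneg
    have hanti : Antitone u := antitone_of_deriv_nonpos (fun t => (h.hasDerivAt t).differentiableAt)
      fun t => by rw [hderiv]; exact (ht₀ t).trans (not_lt.1 hneg)
    refine hconst fun t => ?_
    have e1 : ∀ t ∈ Set.Icc t₀ (t₀ + 2 * π), u t = u t₀ := fun t ht =>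
      le_antisymm (hanti ht.1) ((hp t₀).symm.le.trans (hanti ht.2))
    have hp2 : Function.Periodic (fun s => u (s + t₀)) (2 * π) := fun s => by
      simpa [add_right_comm] using hp (s + t₀)
    obtain ⟨s, hs, e⟩ := hp2.exists_mem_Ico₀ Real.two_pi_pos (t - t₀)
    simp only [sub_add_cancel] at e
    rw [e]
    exact e1 _ ⟨by linarith [hs.1], by linarith [hs.2]⟩
  have hE1 := h.energy t₀ t₁
  rw [hu1] at hE1
  have hcos0 : Real.cos (u t₀) = 1 := by
    rcases Real.sin_eq_zero_iff_cos_eq.1 hsin0 with h1 | h1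
    · exact h1
    · rw [h1] at hE1
      nlinarith [Real.neg_one_le_cos (u t₁), sq_pos_of_pos hω, sq_pos_of_pos hpos,
        mul_nonneg (sq_nonneg ω) (by linarith [Real.neg_one_le_cos (u t₁)] :
          0 ≤ Real.cos (u t₁) + 1)]
  -- Velocity zero at the upper rest position would make the solution an equilibrium. By energy, no
  -- other time reaches a greater height.
  have hlt : -1 < Real.cos (u t₁) := by
    refine lt_of_le_of_ne (Real.neg_one_le_cos _) fun hc => ?_
    have hs : Real.sin (u t₁) = 0 := Real.sin_eq_zero_iff_cos_eq.2 (Or.inr hc.symm)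
    have hcst : IsPendulum ω (fun _ => u t₁) (fun _ => 0) :=
      ⟨fun t => hasDerivAt_const t _, fun t => by simpa [hs] using hasDerivAt_const t (0 : ℝ)⟩
    have h2 := h.unique hcst (t₀ := t₁) rfl hu1
    exact hconst fun t => (h2 t).trans (h2 t₀).symm
  have hltall : ∀ t, -1 < Real.cos (u t) := by
    intro t
    have h1 := h.energy t t₁
    rw [hu1] at h1
    nlinarith [sq_nonneg (u' t), sq_pos_of_pos hω]
  obtain ⟨k, hk⟩ := (Real.cos_eq_one_iff _).1 hcos0
  set v : ℝ → ℝ := fun t => u (t + t₀) - k * (2 * π) with hv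
  set v' : ℝ → ℝ := fun t => u' (t + t₀) with hv'
  have hvP : IsPendulum ω v v' := (h.comp_add_const t₀).sub_int_mul k
  have hvc := hvP.continuous
  have hv0 : v 0 = 0 := by simp [hv, hk]
  have hv'0 : 0 < v' 0 := by simpa [hv'] using hpos
  have hvcos : ∀ t, -1 < Real.cos (v t) := fun t => by
    simp only [hv, Real.cos_sub_int_mul_two_pi]; exact hltall _
  have habs : ∀ t, |v t| < π := by
    intro t
    by_contra! hcon
    have hrange : Set.Icc |v 0| |v t| ⊆ Set.range fun t => |v t| := by
      intro y hy
      exact mem_range_of_exists_le_of_exists_ge hvc.abs ⟨0, hy.1⟩ ⟨t, hy.2⟩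
    obtain ⟨s, hs⟩ := hrange ⟨by simp [hv0, Real.pi_pos.le], hcon⟩
    have h1 := hvcos s
    rw [← Real.cos_abs] at h1
    simp only at hs
    rw [hs, Real.cos_pi] at h1
    exact lt_irrefl _ h1
  -- Oddness and the period `2π` give the zero at `π`, which bounds the first positive zero `τ`.
  have hodd : ∀ t, v (-t) = -v t := by
    intro t
    have h1 := (hvP.comp_const_sub 0).unique hvP.neg (t₀ := 0) (by simp [hv0]) (by simp) t
    simpa using h1
  have hvp : Function.Periodic v (2 * π) := fun t => by
    simp only [hv]; rw [add_right_comm, hp]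
  have hvpi : v π = 0 := by
    have h1 := hvp (-π)
    rw [show -π + 2 * π = π by ring, hodd] at h1
    linarith
  obtain ⟨ε, hε, hεpos⟩ : ∃ ε > 0, ∀ t ∈ Set.Ioo 0 ε, 0 < v t := by
    have h1 := (hasDerivAt_iff_tendsto_slope.1 (hvP.hasDerivAt 0)).eventually (lt_mem_nhds hv'0)
    obtain ⟨ε, hε, hball⟩ := Metric.mem_nhdsWithin_iff.1 h1
    refine ⟨ε, hε, fun t ht => ?_⟩
    have h2 : 0 < slope v 0 t := hball ⟨by simpa [abs_of_pos ht.1] using ht.2, ht.1.ne'⟩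
    rw [slope_def_field, hv0, sub_zero, sub_zero] at h2
    exact (div_pos_iff_of_pos_right ht.1).1 h2
  have hεπ : ε ≤ π := by
    by_contra! hcon
    exact (hεpos π ⟨Real.pi_pos, hcon⟩).ne' hvpi
  -- The margin `ε` separates the zero at the origin from the others, so a least positive zero
  -- exists.
  obtain ⟨τ, ⟨hτ, hτ0⟩, hτmin⟩ := (isCompact_Icc.inter_right
    (isClosed_eq hvc continuous_const) : IsCompact (Set.Icc ε π ∩ {t | v t = 0})).exists_isLeast
    ⟨π, ⟨hεπ, le_rfl⟩, hvpi⟩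
  have hτpos : 0 < τ := hε.trans_le hτ.1
  have hvpos : ∀ t ∈ Set.Ioo 0 τ, 0 < v t := by
    intro t ht
    by_contra! hcon
    have hm : min t (ε / 2) ∈ Set.Ioo 0 ε :=
      ⟨lt_min ht.1 (by linarith), (min_le_right _ _).trans_lt (by linarith)⟩
    obtain ⟨s, hs, hs0⟩ := intermediate_value_Icc' (min_le_left t (ε / 2)) hvc.continuousOn
      ⟨hcon, (hεpos _ hm).le⟩
    have hsε : ε ≤ s := by
      by_contra! hlt'
      exact (hεpos s ⟨hm.1.trans_le hs.1, hlt'⟩).ne' hs0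
    exact absurd (hτmin ⟨⟨hsε, hs.2.trans (ht.2.le.trans hτ.2)⟩, hs0⟩) (not_le.2 (hs.2.trans_lt ht.2))
  have hv'τ : v' τ = -v' 0 := by
    have hE := hvP.energy τ 0
    have hτ0' : v τ = 0 := hτ0
    rw [hτ0', hv0] at hE
    have hle : v' τ ≤ 0 := by
      by_contra! hcon
      have h1 := (hasDerivAt_iff_tendsto_slope.1 (hvP.hasDerivAt τ)).eventually (lt_mem_nhds hcon)
      obtain ⟨δ, hδ, hball⟩ := Metric.mem_nhdsWithin_iff.1 h1
      have hx : max (τ / 2) (τ - δ / 2) < τ := max_lt (by linarith) (by linarith)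
      have h2 : 0 < slope v τ (max (τ / 2) (τ - δ / 2)) := hball ⟨by
        rw [Metric.mem_ball, Real.dist_eq, abs_sub_comm, abs_of_pos (by linarith)]
        linarith [le_max_right (τ / 2) (τ - δ / 2)], hx.ne⟩
      rw [slope_def_field, hτ0', sub_zero] at h2
      have h3 := hvpos (max (τ / 2) (τ - δ / 2))
        ⟨lt_of_lt_of_le (by linarith) (le_max_left _ _), hx⟩
      exact absurd h2 (not_lt.2 (div_nonpos_of_nonneg_of_nonpos h3.le (by linarith)))
    nlinarith
  refine ⟨t₀, k, τ, v, v', hvP, fun t => by simp only [hv]; ring, hτpos, hτ.2, hv0, hv'0, hvpos,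
    habs, fun t => ?_⟩
  exact (hvP.comp_add_const τ).unique hvP.neg (t₀ := 0) (by simpa [hv0] using hτ0)
    (by simpa using hv'τ) t

/-! ### Hidden convexity of the pendulum action -/

theorem sinc_lt_sinc {x y : ℝ} (hx : 0 < x) (hxy : x < y) (hy : y ≤ π) :
    Real.sin y / y < Real.sin x / x := by
  have hy0 : 0 < y := hx.trans hxy
  have h := strictConcaveOn_sin_Icc.2 (Set.left_mem_Icc.2 Real.pi_pos.le) ⟨hy0.le, hy⟩ hy0.ne
    (by rw [sub_pos, div_lt_one hy0]; exact hxy : (0 : ℝ) < 1 - x / y)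
    (by positivity : 0 < x / y) (by ring)
  simp only [Real.sin_zero, smul_eq_mul, mul_zero, zero_add] at h
  rw [div_mul_cancel₀ _ hy0.ne'] at h
  rw [lt_div_iff₀ hx]
  calc Real.sin y / y * x = x / y * Real.sin y := by ring
    _ < Real.sin x := h

/-- The comparison of the potential of the pendulum with its tangent in the variable `v²`. -/
noncomputable def quadraticComparison (x v : ℝ) : ℝ :=
  v ^ 2 / 2 * (Real.sin x / x) + Real.cos v

/-- The derivative in `v` is `v` times the difference of `sin x / x` and `sin v / v`. Since the
latter decreases on `(0, π]`, the function falls before `x` and rises after it. -/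
theorem quadraticComparison_le {x : ℝ} (hx : 0 < x) (hxπ : x < π) (y : ℝ) :
    quadraticComparison x x ≤ quadraticComparison x y ∧
      (quadraticComparison x y ≤ quadraticComparison x x → |y| = x) := by
  set s := Real.sin x / x with hs
  have hs0 : 0 < s := div_pos (Real.sin_pos_of_pos_of_lt_pi hx hxπ) hx
  have hd : ∀ v, HasDerivAt (quadraticComparison x) (v * s - Real.sin v) v := fun v => by
    refine ((((hasDerivAt_id v).pow 2).div_const 2).mul_const s |>.add
      (Real.hasDerivAt_cos v)).congr_deriv ?_
    simp; ring
  have hc : Continuous (quadraticComparison x) :=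
    continuous_iff_continuousAt.2 fun v => (hd v).continuousAt
  have hanti : StrictAntiOn (quadraticComparison x) (Set.Icc 0 x) := by
    refine strictAntiOn_of_deriv_neg (convex_Icc 0 x) hc.continuousOn fun v hv => ?_
    rw [interior_Icc] at hv
    rw [(hd v).deriv]
    have := sinc_lt_sinc hv.1 hv.2 hxπ.le
    rw [lt_div_iff₀ hv.1] at this
    linarith
  have hmono : StrictMonoOn (quadraticComparison x) (Set.Icc x π) := by
    refine strictMonoOn_of_deriv_pos (convex_Icc x π) hc.continuousOn fun v hv => ?_
    rw [interior_Icc] at hv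
    rw [(hd v).deriv]
    have := sinc_lt_sinc hx hv.1 hv.2.le
    rw [div_lt_iff₀ (hx.trans hv.1)] at this
    linarith
  have hkey : ∀ w ∈ Set.Icc 0 π, w ≠ x → quadraticComparison x x < quadraticComparison x w := by
    intro w hw hne
    rcases lt_or_gt_of_ne hne with h | h
    · exact hanti ⟨hw.1, h.le⟩ ⟨hx.le, le_rfl⟩ h
    · exact hmono ⟨le_rfl, hxπ.le⟩ ⟨h.le, hw.2⟩ h
  -- Folding `y` into `[0, π]` keeps the cosine and does not increase the square.
  set w := Real.arccos (Real.cos y) with hw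
  have hwm : w ∈ Set.Icc 0 π := ⟨Real.arccos_nonneg _, Real.arccos_le_pi _⟩
  have hcw : Real.cos w = Real.cos y :=
    Real.cos_arccos (Real.neg_one_le_cos y) (Real.cos_le_one y)
  have hwy : w ≤ |y| := by
    by_cases h : |y| ≤ π
    · rw [hw, ← Real.cos_abs, Real.arccos_cos (abs_nonneg y) h]
    · exact hwm.2.trans (not_le.1 h).le
  have hsq : w ^ 2 ≤ y ^ 2 := by
    rw [← sq_abs y]; exact pow_le_pow_left₀ hwm.1 hwy 2
  have hle : quadraticComparison x w ≤ quadraticComparison x y := by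
    unfold quadraticComparison
    rw [hcw, ← hs]
    nlinarith
  have hle' : quadraticComparison x x ≤ quadraticComparison x w := by
    by_cases h : w = x
    · rw [h]
    · exact (hkey w hwm h).le
  refine ⟨hle'.trans hle, fun h => ?_⟩
  have h1 : w = x := by
    by_contra hne
    exact absurd (hle.trans h) (not_le.2 (hkey w hwm hne))
  have h2 : quadraticComparison x w = quadraticComparison x y :=
    le_antisymm hle (h.trans hle')
  unfold quadraticComparison at h2
  rw [hcw, ← hs] at h2
  have h3 : (y ^ 2 - w ^ 2) * s = 0 := by linarith
  have h4 : y ^ 2 = w ^ 2 := by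
    rcases mul_eq_zero.1 h3 with h | h
    · linarith
    · exact absurd h hs0.ne'
  rw [← abs_of_pos hx, ← h1]
  exact (sq_eq_sq_iff_abs_eq_abs y w).1 h4

/-- At a common zero `v / u` tends to the ratio of the derivatives, so `v u' (v / u)` tends to `0`.
This agrees with the value of the quotient there, because division by zero gives `0`. -/
theorem continuousAt_sq_mul_div {u u' v : ℝ → ℝ} {a b c : ℝ} (hu : HasDerivAt u b a)
    (hv : HasDerivAt v c a) (hu0 : u a = 0) (hv0 : v a = 0) (hb : b ≠ 0)
    (hu' : ContinuousAt u' a) : ContinuousAt (fun t => v t ^ 2 * u' t / u t) a := by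
  rw [continuousAt_iff_punctured_nhds]
  have h1 : Filter.Tendsto (fun t => slope v a t / slope u a t) (nhdsWithin a {a}ᶜ)
      (nhds (c / b)) :=
    (hasDerivAt_iff_tendsto_slope.1 hv).div (hasDerivAt_iff_tendsto_slope.1 hu) hb
  have h2 : Filter.Tendsto (fun t => v t * u' t) (nhdsWithin a {a}ᶜ) (nhds (v a * u' a)) :=
    (hv.continuousAt.mul hu').tendsto.mono_left nhdsWithin_le_nhds
  have h3 := h2.mul h1
  rw [hv0, zero_mul, zero_mul] at h3
  simp only [hv0, ne_eq, OfNat.ofNat_ne_zero, not_false_eq_true, zero_pow, zero_mul, zero_div]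
  refine h3.congr' ?_
  filter_upwards [self_mem_nhdsWithin] with t ht
  have hta : t - a ≠ 0 := sub_ne_zero.2 ht
  rw [slope_def_field, slope_def_field, hu0, hv0, sub_zero, sub_zero, div_div_div_cancel_right₀ hta]
  ring

theorem integral_comp_add_of_periodic {E : Type*} [NormedAddCommGroup E] [NormedSpace ℝ E]
    {f : ℝ → E} {T : ℝ} (hp : Function.Periodic f T) (c : ℝ) :
    ∫ t in (0 : ℝ)..T, f (t + c) = ∫ t in (0 : ℝ)..T, f t := by
  rw [intervalIntegral.integral_comp_add_right]
  simpa [add_comm] using hp.intervalIntegral_add_eq c 0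

theorem integral_two_pi_eq_add {f : ℝ → ℝ} (hf : Continuous f) :
    ∫ t in (0 : ℝ)..2 * π, f t =
      (∫ t in (0 : ℝ)..π, f t) + ∫ t in (0 : ℝ)..π, f (t + π) := by
  rw [intervalIntegral.integral_comp_add_right,
    ← intervalIntegral.integral_add_adjacent_intervals (b := π)
      (hf.intervalIntegrable _ _) (hf.intervalIntegrable _ _)]
  congr 2 <;> ring

/-! ### The figure eight as the only minimizer of index zero -/

namespace IsEightAngle

variable {ω : ℝ} {u u' v v' : ℝ → ℝ}

theorem apply_pi (h : IsEightAngle ω u u') : u π = 0 := by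
  have := h.antiperiodic 0
  rw [zero_add, h.zero, neg_zero] at this
  exact this

theorem antiperiodic' (h : IsEightAngle ω u u') : Function.Antiperiodic u' π := by
  intro t
  have h1 := (h.hasDerivAt (t + π)).comp_add_const t π
  rw [show (fun x => u (x + π)) = fun x => -u x from funext h.antiperiodic] at h1
  exact h1.unique (h.hasDerivAt t).neg

theorem periodic (h : IsEightAngle ω u u') : Function.Periodic u (2 * π) := by
  intro t
  rw [two_mul, ← add_assoc, h.antiperiodic, h.antiperiodic, neg_neg]

theorem periodic' (h : IsEightAngle ω u u') : Function.Periodic u' (2 * π) := by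
  intro t
  rw [two_mul, ← add_assoc, h.antiperiodic', h.antiperiodic', neg_neg]

theorem integral_cos_half (h : IsEightAngle ω u u') :
    ∫ t in (0 : ℝ)..π, Real.cos (u t) = 0 := by
  have hc := h.continuous
  have h1 := h.integral_cos
  rw [integral_two_pi_eq_add (by fun_prop)] at h1
  simp only [h.antiperiodic _, Real.cos_neg] at h1
  linarith

theorem integral_sq_half (h : IsEightAngle ω u u') :
    ∫ t in (0 : ℝ)..2 * π, u' t ^ 2 = 2 * ∫ t in (0 : ℝ)..π, u' t ^ 2 := by
  have hc := h.continuous'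
  rw [integral_two_pi_eq_add (by fun_prop)]
  simp only [h.antiperiodic' _, neg_sq]
  ring

/-- The angle `u` is a solution of `y'' + ω² sinc (u) y = 0` that is positive on `(0, π)`. By
Picone's identity the integrand minus the derivative of `v² u' / u` is the square of `v' - v u' /
u`, and the boundary terms vanish. -/
theorem picone (h : IsEightAngle ω u u') (hv : ∀ t, HasDerivAt v (v' t) t) (hv' : Continuous v')
    (h0 : v 0 = 0) (hπ : v π = 0) :
    0 ≤ ∫ t in (0 : ℝ)..π, (v' t ^ 2 - ω ^ 2 * v t ^ 2 * Real.sinc (u t)) := by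
  have hc := h.continuous
  have hc' := h.continuous'
  have hvc : Continuous v := continuous_iff_continuousAt.2 fun t => (hv t).continuousAt
  have hsinc := Real.continuous_sinc
  have hfc : Continuous fun t => v' t ^ 2 - ω ^ 2 * v t ^ 2 * Real.sinc (u t) := by fun_prop
  set F : ℝ → ℝ := fun t => v t ^ 2 * u' t / u t with hF
  set G : ℝ → ℝ := fun t =>
    (∫ s in (0 : ℝ)..t, (v' s ^ 2 - ω ^ 2 * v s ^ 2 * Real.sinc (u s))) - F t with hG
  have hFc : ContinuousOn F (Set.Icc 0 π) := by
    intro t ht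
    refine ContinuousAt.continuousWithinAt ?_
    rcases ht.1.eq_or_lt with e | e
    · subst e
      exact continuousAt_sq_mul_div (h.hasDerivAt 0) (hv 0) h.zero h0 h.deriv_pos.ne'
        hc'.continuousAt
    rcases ht.2.eq_or_lt with e' | e'
    · subst e'
      refine continuousAt_sq_mul_div (h.hasDerivAt π) (hv π) h.apply_pi hπ ?_ hc'.continuousAt
      have := h.antiperiodic' 0
      rw [zero_add] at this
      rw [this]
      exact neg_ne_zero.2 h.deriv_pos.ne'
    · exact ((hvc.continuousAt.pow 2).mul hc'.continuousAt).div hc.continuousAt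
        (h.pos t ⟨e, e'⟩).ne'
  have hGd : ∀ t ∈ Set.Ioo 0 π, HasDerivAt G ((v' t - v t * u' t / u t) ^ 2) t := by
    intro t ht
    have hu0 := (h.pos t ht).ne'
    refine ((hasDerivAt_integral_zero hfc t).sub ((((hv t).pow 2).mul (h.hasDerivAt' t)).div
      (h.hasDerivAt t) hu0)).congr_deriv ?_
    rw [Real.sinc_of_ne_zero hu0]
    simp only [Pi.mul_apply, Pi.pow_apply]
    field_simp
    ring
  have hmono : MonotoneOn G (Set.Icc 0 π) := by
    refine monotoneOn_of_deriv_nonneg (convex_Icc _ _) ?_ ?_ ?_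
    · refine ContinuousOn.sub (Continuous.continuousOn ?_) hFc
      exact continuous_iff_continuousAt.2 fun t => (hasDerivAt_integral_zero hfc t).continuousAt
    · rw [interior_Icc]
      exact fun t ht => (hGd t ht).differentiableAt.differentiableWithinAt
    · rw [interior_Icc]
      intro t ht
      rw [(hGd t ht).deriv]
      positivity
  have h1 := hmono (Set.left_mem_Icc.2 Real.pi_pos.le) (Set.right_mem_Icc.2 Real.pi_pos.le)
    Real.pi_pos.le
  simpa [hG, hF, h0, hπ] using h1

/-- Integrating the derivative of `u u'` gives this: it is the equality case `v = u` of the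
quadratic form inequality `picone`. -/
theorem integral_sq_eq (h : IsEightAngle ω u u') :
    ∫ t in (0 : ℝ)..π, u' t ^ 2 = ∫ t in (0 : ℝ)..π, ω ^ 2 * u t ^ 2 * Real.sinc (u t) := by
  have hc := h.continuous
  have hc' := h.continuous'
  have hsinc := Real.continuous_sinc
  have h1 : ∀ t, HasDerivAt (fun t => u t * u' t)
      (u' t ^ 2 - ω ^ 2 * u t ^ 2 * Real.sinc (u t)) t := fun t => by
    refine ((h.hasDerivAt t).mul (h.hasDerivAt' t)).congr_deriv ?_
    by_cases h0 : u t = 0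
    · simp [h0]; ring
    · rw [Real.sinc_of_ne_zero h0]; field_simp; ring
  have h2 := intervalIntegral.integral_eq_sub_of_hasDerivAt (fun t _ => h1 t)
    (Continuous.intervalIntegrable (by fun_prop) 0 π)
  rw [h.zero, h.apply_pi, intervalIntegral.integral_sub
    (Continuous.intervalIntegrable (by fun_prop) _ _)
    (Continuous.intervalIntegrable (by fun_prop) _ _)] at h2
  linarith

/-- The pendulum action on `[0, π]` with Dirichlet boundary values is minimized by `u`. -/
theorem action_le (h : IsEightAngle ω u u') (hω : 0 < ω) (hv : ∀ t, HasDerivAt v (v' t) t)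
    (hv' : Continuous v') (h0 : v 0 = 0) (hπ : v π = 0) :
    (∫ t in (0 : ℝ)..π, u' t ^ 2) / 2 ≤
        (∫ t in (0 : ℝ)..π, v' t ^ 2) / 2 + ω ^ 2 * ∫ t in (0 : ℝ)..π, Real.cos (v t) ∧
      ((∫ t in (0 : ℝ)..π, v' t ^ 2) / 2 + ω ^ 2 * (∫ t in (0 : ℝ)..π, Real.cos (v t)) ≤
        (∫ t in (0 : ℝ)..π, u' t ^ 2) / 2 → ∀ t ∈ Set.Icc 0 π, |v t| = u t) := by
  have hc := h.continuous
  have hvc : Continuous v := continuous_iff_continuousAt.2 fun t => (hv t).continuousAt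
  have hsinc := Real.continuous_sinc
  -- `D` is the gap between the cosine and its tangent bound in the variable `v²`; the action
  -- exceeds that of `u` by at least `ω² ∫ D`, and at equality `D` vanishes pointwise.
  set D : ℝ → ℝ := fun t => (v t ^ 2 * Real.sinc (u t) / 2 + Real.cos (v t)) -
    (u t ^ 2 * Real.sinc (u t) / 2 + Real.cos (u t)) with hD
  have hDc : Continuous D := by fun_prop
  have hDq : ∀ t ∈ Set.Ioo 0 π, D t =
      quadraticComparison (u t) (v t) - quadraticComparison (u t) (u t) := fun t ht => by
    simp only [hD, quadraticComparison, Real.sinc_of_ne_zero (h.pos t ht).ne']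
    ring
  have huπ : ∀ t, u t < π := fun t => (_root_.abs_lt.1 (h.abs_lt t)).2
  have hcases : ∀ t ∈ Set.Icc 0 π, (t ∈ Set.Ioo 0 π) ∨ (u t = 0 ∧ v t = 0) := by
    intro t ht
    rcases ht.1.eq_or_lt with e | e
    · subst e; exact Or.inr ⟨h.zero, h0⟩
    rcases ht.2.eq_or_lt with e' | e'
    · subst e'; exact Or.inr ⟨h.apply_pi, hπ⟩
    · exact Or.inl ⟨e, e'⟩
  have hD0 : ∀ t ∈ Set.Icc 0 π, 0 ≤ D t := by
    intro t ht
    rcases hcases t ht with h1 | ⟨h1, h2⟩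
    · rw [hDq t h1, sub_nonneg]
      exact (quadraticComparison_le (h.pos t h1) (huπ t) (v t)).1
    · simp [hD, h1, h2]
  have hint : ω ^ 2 * ∫ t in (0 : ℝ)..π, D t ≤
      (∫ t in (0 : ℝ)..π, v' t ^ 2) / 2 + ω ^ 2 * (∫ t in (0 : ℝ)..π, Real.cos (v t)) -
        (∫ t in (0 : ℝ)..π, u' t ^ 2) / 2 := by
    have h1 := h.picone hv hv' h0 hπ
    have h2 := h.integral_sq_eq
    have h3 := h.integral_cos_half
    simp only [mul_assoc] at h1 h2
    rw [intervalIntegral.integral_sub (Continuous.intervalIntegrable (by fun_prop) _ _)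
      (Continuous.intervalIntegrable (by fun_prop) _ _),
      intervalIntegral.integral_const_mul] at h1
    rw [intervalIntegral.integral_const_mul] at h2
    simp only [hD]
    rw [intervalIntegral.integral_sub (Continuous.intervalIntegrable (by fun_prop) _ _)
      (Continuous.intervalIntegrable (by fun_prop) _ _),
      intervalIntegral.integral_add (Continuous.intervalIntegrable (by fun_prop) _ _)
      (Continuous.intervalIntegrable (by fun_prop) _ _),
      intervalIntegral.integral_add (Continuous.intervalIntegrable (by fun_prop) _ _)
      (Continuous.intervalIntegrable (by fun_prop) _ _), h3, h2,
      intervalIntegral.integral_div, intervalIntegral.integral_div]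
    linarith
  have hω2 : 0 < ω ^ 2 := by positivity
  refine ⟨?_, fun hle t ht => ?_⟩
  · have := intervalIntegral.integral_nonneg (μ := MeasureTheory.volume) Real.pi_pos.le hD0
    nlinarith
  · have hz := eq_zero_of_integral_nonpos Real.pi_pos hDc.continuousOn hD0
      (by by_contra! hcon; nlinarith) t ht
    rcases hcases t ht with h1 | ⟨h1, h2⟩
    · rw [hDq t h1] at hz
      exact (quadraticComparison_le (h.pos t h1) (huπ t) (v t)).2 (by linarith)
    · rw [h1, h2, abs_zero]

theorem eq_or_eq_neg (h : IsEightAngle ω u u') (hv : Continuous v)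
    (habs : ∀ t ∈ Set.Icc 0 π, |v t| = u t) :
    ∃ σ : ℝ, (σ = 1 ∨ σ = -1) ∧ ∀ t ∈ Set.Icc 0 π, v t = σ * u t := by
  have key : ∀ σ : ℝ, (∀ t ∈ Set.Ioo 0 π, v t = σ * u t) → ∀ t ∈ Set.Icc 0 π, v t = σ * u t := by
    intro σ hσ t ht
    have hz : u t = 0 → v t = σ * u t := fun h0 => by
      have h1 := habs t ht
      rw [h0, abs_eq_zero] at h1
      rw [h0, h1, mul_zero]
    rcases ht.1.eq_or_lt with e | e
    · subst e; exact hz h.zero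
    rcases ht.2.eq_or_lt with e' | e'
    · subst e'; exact hz h.apply_pi
    · exact hσ t ⟨e, e'⟩
  rcases (isPreconnected_Ioo (a := (0 : ℝ)) (b := π)).eq_or_eq_neg_of_sq_eq hv.continuousOn
    h.continuous.continuousOn (fun t ht => by
      simp only [Pi.pow_apply, ← habs t (Set.Ioo_subset_Icc_self ht), sq_abs])
    (fun {t} ht => (h.pos t ht).ne') with h1 | h1
  · exact ⟨1, Or.inl rfl, key 1 fun t ht => by rw [h1 ht, one_mul]⟩
  · exact ⟨-1, Or.inr rfl, key (-1) fun t ht => by rw [h1 ht]; simp⟩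

/-- The figure eight elastica minimizes `∫ κ² ds` among all closed curves of index zero, and it is
the only minimizer. -/
theorem integral_sq_le (h : IsEightAngle ω u u') (hω : 0 < ω) {β β' : ℝ → ℝ}
    (hβ : ∀ t, HasDerivAt β (β' t) t) (hβ' : Continuous β') (hp : Function.Periodic β (2 * π))
    (hclosed : ∫ t in (0 : ℝ)..2 * π, exp (β t * I) = 0) :
    ∫ t in (0 : ℝ)..2 * π, u' t ^ 2 ≤ ∫ t in (0 : ℝ)..2 * π, β' t ^ 2 ∧
      (∫ t in (0 : ℝ)..2 * π, β' t ^ 2 ≤ ∫ t in (0 : ℝ)..2 * π, u' t ^ 2 →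
        ∃ t₁ c : ℝ, ∀ t, β (t + t₁) = u t + c) := by
  have hβc : Continuous β := continuous_iff_continuousAt.2 fun t => (hβ t).continuousAt
  -- The difference `β (t + π) - β t` has opposite values at `0` and `π`. A zero of it splits the
  -- period into two halves on which the Dirichlet estimate applies to `β` minus a constant.
  obtain ⟨t₀, ht₀⟩ : ∃ t₀, β (t₀ + π) = β t₀ := by
    have hg : Continuous fun t => β (t + π) - β t := by fun_prop
    have e : β (π + π) = β 0 := by
      have := hp 0
      rwa [zero_add, two_mul] at this
    have hz : ∃ t, β (t + π) - β t = 0 := by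
      rcases le_total (β π) (β 0) with hle | hle
      · exact mem_range_of_exists_le_of_exists_ge hg ⟨0, by simpa using hle⟩
          ⟨π, by rw [e]; linarith⟩
      · exact mem_range_of_exists_le_of_exists_ge hg ⟨π, by rw [e]; linarith⟩
          ⟨0, by simpa using hle⟩
    obtain ⟨t, ht⟩ := hz
    exact ⟨t, by linarith⟩
  set v : ℝ → ℝ := fun t => β (t + t₀) - β t₀ with hv
  set v' : ℝ → ℝ := fun t => β' (t + t₀) with hv'
  have hvd : ∀ t, HasDerivAt v (v' t) t := fun t =>
    ((hβ (t + t₀)).comp_add_const t t₀).sub_const _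
  have hvc : Continuous v := by fun_prop
  have hvc' : Continuous v' := by fun_prop
  have hv0 : v 0 = 0 := by simp [hv]
  have hvπ : v π = 0 := by simp [hv, add_comm π, ht₀]
  have hvp : Function.Periodic v (2 * π) := fun t => by
    simp only [hv]; rw [add_right_comm, hp]
  have hv2π : v (π + π) = 0 := by
    have := hvp 0
    rw [zero_add, hv0, two_mul] at this
    exact this
  have hβp' : Function.Periodic β' (2 * π) := by
    have : deriv β = β' := funext fun t => (hβ t).deriv
    rw [← this]
    exact hp.deriv
  have hsq : ∫ t in (0 : ℝ)..2 * π, β' t ^ 2 =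
      (∫ t in (0 : ℝ)..π, v' t ^ 2) + ∫ t in (0 : ℝ)..π, v' (t + π) ^ 2 := by
    rw [← integral_comp_add_of_periodic (f := fun t => β' t ^ 2)
      (fun t => by simp only [hβp' t]) t₀]
    exact integral_two_pi_eq_add (f := fun t => v' t ^ 2) (by fun_prop)
  have hcos : (∫ t in (0 : ℝ)..π, Real.cos (v t)) + ∫ t in (0 : ℝ)..π, Real.cos (v (t + π)) = 0 := by
    rw [← integral_two_pi_eq_add (f := fun t => Real.cos (v t)) (by fun_prop)]
    have h1 : ∫ t in (0 : ℝ)..2 * π, exp (v t * I) = 0 := by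
      have h2 : ∀ t, exp (v t * I) = exp (β (t + t₀) * I) * exp (-(β t₀ * I)) := fun t => by
        rw [← Complex.exp_add]; simp only [hv]; push_cast; ring_nf
      simp only [h2]
      rw [intervalIntegral.integral_mul_const,
        integral_comp_add_of_periodic (f := fun t => exp (β t * I))
          (fun t => by simp only [hp t]) t₀, hclosed, zero_mul]
    rw [integral_exp_mul_I hvc] at h1
    simpa using congrArg Complex.re h1
  have hvd2 : ∀ t, HasDerivAt (fun t => v (t + π)) (v' (t + π)) t := fun t =>
    (hvd (t + π)).comp_add_const t π
  obtain ⟨hle1, heq1⟩ := h.action_le hω hvd hvc' hv0 hvπ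
  obtain ⟨hle2, heq2⟩ := h.action_le hω hvd2 (by fun_prop) (by simpa using hvπ) hv2π
  -- The potential terms of the two halves need not vanish separately, but closedness makes them
  -- cancel.
  have hcos' : ω ^ 2 * (∫ t in (0 : ℝ)..π, Real.cos (v t)) +
      ω ^ 2 * ∫ t in (0 : ℝ)..π, Real.cos (v (t + π)) = 0 := by
    rw [← mul_add, hcos, mul_zero]
  rw [h.integral_sq_half, hsq]
  refine ⟨by linarith, fun hle => ?_⟩
  obtain ⟨σ, hσ, hσv⟩ := h.eq_or_eq_neg hvc (heq1 (by linarith))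
  obtain ⟨ρ, hρ, hρv⟩ := h.eq_or_eq_neg (by fun_prop) (heq2 (by linarith))
  have hπ0 := Real.pi_pos
  -- The derivative at the junction `π`, taken from the left in the first half and from the right in
  -- the second, forces the two signs to be opposite.
  have hd1 : v' π = σ * u' π :=
    (uniqueDiffOn_Icc hπ0 π (Set.right_mem_Icc.2 hπ0.le)).eq_deriv _
      ((hvd π).hasDerivWithinAt.congr (fun t ht => (hσv t ht).symm)
        (hσv π (Set.right_mem_Icc.2 hπ0.le)).symm)
      ((h.hasDerivAt π).const_mul σ).hasDerivWithinAt
  have hd2 : v' (0 + π) = ρ * u' 0 :=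
    (uniqueDiffOn_Icc hπ0 0 (Set.left_mem_Icc.2 hπ0.le)).eq_deriv _
      ((hvd2 0).hasDerivWithinAt.congr (fun t ht => (hρv t ht).symm)
        (hρv 0 (Set.left_mem_Icc.2 hπ0.le)).symm)
      ((h.hasDerivAt 0).const_mul ρ).hasDerivWithinAt
  have hρσ : ρ = -σ := by
    have h1 := h.antiperiodic' 0
    rw [zero_add] at h1 hd2
    rw [hd1, h1] at hd2
    exact mul_right_cancel₀ h.deriv_pos.ne' (by linarith)
  have hall : ∀ t, v t = σ * u t := by
    have hper : Function.Periodic (fun t => v t - σ * u t) (2 * π) := fun t => by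
      simp only [hvp t, h.periodic t]
    intro t
    obtain ⟨s, hs, e⟩ := hper.exists_mem_Ico₀ Real.two_pi_pos t
    have hs0 : v s = σ * u s := by
      by_cases hsπ : s ≤ π
      · exact hσv s ⟨hs.1, hsπ⟩
      · have h1 := hρv (s - π) ⟨by linarith, by linarith [hs.2]⟩
        rw [sub_add_cancel, h.antiperiodic.sub_eq, hρσ] at h1
        rw [h1]; ring
    linarith
  rcases hσ with rfl | rfl
  · refine ⟨t₀, β t₀, fun t => ?_⟩
    have := hall t
    simp only [hv] at this
    linarith
  -- A negative sign is absorbed into a shift by the antiperiod `π`.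
  · refine ⟨π + t₀, β t₀, fun t => ?_⟩
    have := hall (t + π)
    rw [h.antiperiodic] at this
    simp only [hv, add_assoc] at this
    linarith

theorem integral_exp (h : IsEightAngle ω u u') (hω : 0 < ω) :
    ∫ t in (0 : ℝ)..2 * π, exp (u t * I) = 0 := by
  rw [integral_exp_mul_I h.continuous, h.integral_cos, h.integral_sin_eq_zero hω.ne'
    (by simpa using h.periodic' 0)]
  simp

/-- Any two normalized angles of figure eight elasticae passed once agree up to the starting
point, and have the same parameters. -/
theorem unique_shape {ω₁ ω₂ : ℝ} {u₁ u₁' u₂ u₂' : ℝ → ℝ} (h₁ : IsEightAngle ω₁ u₁ u₁')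
    (h₂ : IsEightAngle ω₂ u₂ u₂') (hω₁ : 0 < ω₁) (hω₂ : 0 < ω₂) :
    (∃ τ, ∀ t, u₂ (t + τ) = u₁ t) ∧ ω₂ ^ 2 = ω₁ ^ 2 ∧ u₂' 0 ^ 2 = u₁' 0 ^ 2 := by
  obtain ⟨τ, c, hτ⟩ := (h₁.integral_sq_le hω₁ h₂.hasDerivAt h₂.continuous' h₂.periodic
    (h₂.integral_exp hω₂)).2 (h₂.integral_sq_le hω₂ h₁.hasDerivAt h₁.continuous' h₁.periodic
    (h₁.integral_exp hω₁)).1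
  -- Both angles are antiperiodic, which excludes an additive constant.
  have hc : c = 0 := by
    have h1 := hτ (0 + π)
    rw [h₁.antiperiodic, add_right_comm, h₂.antiperiodic, hτ] at h1
    linarith
  have hτ' : ∀ t, u₂ (t + τ) = u₁ t := fun t => by rw [hτ, hc, add_zero]
  have e : (fun t => u₂ (t + τ)) = u₁ := funext hτ'
  have hs := h₂.toIsPendulum.comp_add_const τ
  have e' : (fun t => u₂' (t + τ)) = u₁' := by
    funext t
    have h1 := hs.hasDerivAt t
    rw [e] at h1
    exact h1.unique (h₁.hasDerivAt t)
  -- The frequencies are read off from the equation at `π / 2`, where `sin u₁ ≠ 0`.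
  have hω : ω₂ ^ 2 = ω₁ ^ 2 := by
    have h1 := hs.hasDerivAt' (π / 2)
    rw [e', hτ'] at h1
    have h2 := h1.unique (h₁.hasDerivAt' (π / 2))
    have h3 : 0 < Real.sin (u₁ (π / 2)) := Real.sin_pos_of_pos_of_lt_pi
      (h₁.pos _ ⟨by linarith [Real.pi_pos], by linarith [Real.pi_pos]⟩)
      (_root_.abs_lt.1 (h₁.abs_lt _)).2
    exact mul_right_cancel₀ h3.ne' (by linarith)
  refine ⟨⟨τ, hτ'⟩, hω, ?_⟩
  have h1 := h₂.energy 0 (0 + τ)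
  rw [hτ', show u₂' (0 + τ) = u₁' 0 from congrFun e' 0, h₁.zero, h₂.zero] at h1
  linarith

end IsEightAngle

/-! ### Existence of the figure eight -/

/-- The integrand `√(1 - m sin² φ)` of the elliptic integral of the second kind. -/
noncomputable def ellipticDelta (m φ : ℝ) : ℝ := √(1 - m * Real.sin φ ^ 2)

theorem mul_sin_sq_lt_one {m : ℝ} (hm0 : 0 ≤ m) (hm1 : m < 1) (φ : ℝ) :
    m * Real.sin φ ^ 2 < 1 := by
  nlinarith [Real.sin_sq_le_one φ, sq_nonneg (Real.sin φ)]

theorem ellipticDelta_pos {m : ℝ} (hm0 : 0 ≤ m) (hm1 : m < 1) (φ : ℝ) : 0 < ellipticDelta m φ :=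
  Real.sqrt_pos.2 (by linarith [mul_sin_sq_lt_one hm0 hm1 φ])

theorem ellipticDelta_sq {m : ℝ} (hm0 : 0 ≤ m) (hm1 : m < 1) (φ : ℝ) :
    ellipticDelta m φ ^ 2 = 1 - m * Real.sin φ ^ 2 :=
  Real.sq_sqrt (by linarith [mul_sin_sq_lt_one hm0 hm1 φ])

theorem ellipticDelta_le_one {m : ℝ} (hm0 : 0 ≤ m) (φ : ℝ) : ellipticDelta m φ ≤ 1 :=
  Real.sqrt_le_one.2 (by linarith [mul_nonneg hm0 (sq_nonneg (Real.sin φ))])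

theorem continuous_ellipticDelta (m : ℝ) : Continuous (ellipticDelta m) := by
  unfold ellipticDelta; fun_prop

/-- The right side is the quadratic polynomial in `y²` that touches `2y - 1/y` at `y = 3/5` and
meets it at `y = 1`. Being polynomial in `y²`, it can be integrated explicitly when `y² = 1 - m sin²
φ`. -/
theorem two_mul_sub_inv_le {y : ℝ} (hy0 : 0 < y) (hy1 : y ≤ 1) :
    2 * y - y⁻¹ ≤ -287 / 128 + 10165 / 1728 * y ^ 2 - 9125 / 3456 * (y ^ 2) ^ 2 := by
  have h : 0 ≤ (y - 3 / 5) ^ 2 * (1 - y) *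
      (9125 / 3456 * y ^ 2 + 20075 / 3456 * y + 25 / 9) / y := by
    have : 0 ≤ 1 - y := by linarith
    positivity
  have e : (y - 3 / 5) ^ 2 * (1 - y) * (9125 / 3456 * y ^ 2 + 20075 / 3456 * y + 25 / 9) / y =
      (-287 / 128 + 10165 / 1728 * y ^ 2 - 9125 / 3456 * (y ^ 2) ^ 2) - (2 * y - y⁻¹) := by
    field_simp
    ring
  linarith

theorem integral_ellipticDelta_neg :
    ∫ φ in (0 : ℝ)..2 * π, (2 * ellipticDelta (7 / 8) φ - (ellipticDelta (7 / 8) φ)⁻¹) < 0 := by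
  have hc := continuous_ellipticDelta (7 / 8)
  have hpos := ellipticDelta_pos (m := 7 / 8) (by norm_num) (by norm_num)
  have hle : ∀ φ, 2 * ellipticDelta (7 / 8) φ - (ellipticDelta (7 / 8) φ)⁻¹ ≤
      -287 / 128 + 10165 / 1728 * (1 - 7 / 8 * Real.sin φ ^ 2) -
        9125 / 3456 * (1 - 7 / 8 * Real.sin φ ^ 2) ^ 2 := fun φ => by
    rw [← ellipticDelta_sq (by norm_num) (by norm_num)]
    exact two_mul_sub_inv_le (hpos φ) (ellipticDelta_le_one (by norm_num) φ)
  have e2 : ∫ φ in (0 : ℝ)..2 * π, Real.sin φ ^ 2 = π := by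
    rw [integral_sin_sq]; simp
  have e4 : ∫ φ in (0 : ℝ)..2 * π, Real.sin φ ^ 4 = 3 / 4 * π := by
    rw [integral_sin_pow (n := 2), e2]; simp; ring
  refine (intervalIntegral.integral_mono Real.two_pi_pos.le
    (Continuous.intervalIntegrable (by fun_prop (disch := exact fun φ => (hpos φ).ne')) _ _)
    (Continuous.intervalIntegrable (by fun_prop) _ _) hle).trans_lt ?_
  have e : ∀ φ : ℝ, -287 / 128 + 10165 / 1728 * (1 - 7 / 8 * Real.sin φ ^ 2) -
        9125 / 3456 * (1 - 7 / 8 * Real.sin φ ^ 2) ^ 2 =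
      (-287 / 128 + 10165 / 1728 - 9125 / 3456) +
        ((-(10165 / 1728 * (7 / 8)) + 9125 / 3456 * (7 / 4)) * Real.sin φ ^ 2 +
          (-(9125 / 3456 * (49 / 64))) * Real.sin φ ^ 4) := fun φ => by ring
  simp only [e]
  rw [intervalIntegral.integral_add (Continuous.intervalIntegrable (by fun_prop) _ _)
      (Continuous.intervalIntegrable (by fun_prop) _ _),
    intervalIntegral.integral_add (Continuous.intervalIntegrable (by fun_prop) _ _)
      (Continuous.intervalIntegrable (by fun_prop) _ _),
    intervalIntegral.integral_const_mul, intervalIntegral.integral_const_mul, e2, e4,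
    intervalIntegral.integral_const, smul_eq_mul]
  have := Real.pi_pos
  nlinarith

/-- For `m = 0` the integral is `2π` and at `m = 7/8` it is negative, so it vanishes in between.
This is the condition `∫ cos u = 0` after the substitution by the amplitude. -/
theorem exists_modulus : ∃ m : ℝ, 0 < m ∧ m < 7 / 8 ∧
    ∫ φ in (0 : ℝ)..2 * π, (2 * ellipticDelta m φ - (ellipticDelta m φ)⁻¹) = 0 := by
  -- This parametrizes `[0, 7/8]` by the whole line, so that the integral becomes a continuous
  -- function on `ℝ`.
  set M : ℝ → ℝ := fun x => 7 / 8 * Real.sin x ^ 2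
  have hM0 : ∀ x, 0 ≤ M x := fun x => by positivity
  have hM1 : ∀ x, M x ≤ 7 / 8 := fun x => by
    simp only [M]; nlinarith [Real.sin_sq_le_one x]
  have hMlt : ∀ x, M x < 1 := fun x => (hM1 x).trans_lt (by norm_num)
  set A : ℝ → ℝ := fun m =>
    ∫ φ in (0 : ℝ)..2 * π, (2 * ellipticDelta m φ - (ellipticDelta m φ)⁻¹)
  have hc : Continuous fun p : ℝ × ℝ => ellipticDelta (M p.1) p.2 := by
    unfold ellipticDelta; fun_prop
  have hA : Continuous fun x => A (M x) :=
    intervalIntegral.continuous_parametric_intervalIntegral_of_continuous'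
      (f := fun x φ => 2 * ellipticDelta (M x) φ - (ellipticDelta (M x) φ)⁻¹)
      ((hc.const_mul 2).sub (hc.inv₀ fun p => (ellipticDelta_pos (hM0 _) (hMlt _) _).ne')) _ _
  have h0 : A (M 0) = 2 * π := by
    simp [A, M, ellipticDelta]
    ring
  have h1 : A (M (π / 2)) < 0 := by
    simpa [M] using integral_ellipticDelta_neg
  obtain ⟨x, hx⟩ := mem_range_of_exists_le_of_exists_ge hA ⟨π / 2, h1.le⟩
    ⟨0, h0.symm ▸ Real.two_pi_pos.le⟩
  have hx' : A (M x) = 0 := hx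
  refine ⟨M x, lt_of_le_of_ne (hM0 x) fun h => ?_, lt_of_le_of_ne (hM1 x) fun h => ?_, hx'⟩
  · rw [← h, show (0 : ℝ) = M 0 by simp [M], h0] at hx'
    exact Real.two_pi_pos.ne' (hx'.trans (by simp [M]))
  · rw [h, show (7 / 8 : ℝ) = M (π / 2) by simp [M]] at hx'
    exact h1.ne hx'

/-- The amplitude function: a solution of `φ' = ω √(1 - m sin² φ)` with `φ(t + π) = φ(t) + π`. -/
theorem exists_amplitude {m : ℝ} (hm0 : 0 ≤ m) (hm1 : m < 1) :
    ∃ (ω : ℝ) (φ : ℝ → ℝ), 2 * π * ω = ∫ x in (0 : ℝ)..2 * π, (ellipticDelta m x)⁻¹ ∧ 0 < ω ∧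
      (∀ t, HasDerivAt φ (ω * ellipticDelta m (φ t)) t) ∧ StrictMono φ ∧ φ 0 = 0 ∧
      ∀ t, φ (t + π) = φ t + π := by
  have hpos := ellipticDelta_pos hm0 hm1
  have hc : Continuous fun x => (ellipticDelta m x)⁻¹ :=
    (continuous_ellipticDelta m).inv₀ fun x => (hpos x).ne'
  have hper : Function.Periodic (fun x => (ellipticDelta m x)⁻¹) π := fun x => by
    simp [ellipticDelta, Real.sin_add_pi]
  -- The mean of the inverse of `ellipticDelta` is the constant for which the primitive `F` commutes
  -- with translation by `π`. The amplitude is the inverse of `F`.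
  set ω := (∫ x in (0 : ℝ)..π, (ellipticDelta m x)⁻¹) / π with hω
  have hω0 : 0 < ω := div_pos (intervalIntegral.intervalIntegral_pos_of_pos
    (hc.intervalIntegrable _ _) (fun x => inv_pos.2 (hpos x)) Real.pi_pos) Real.pi_pos
  have hωπ : ∫ x in (0 : ℝ)..π, (ellipticDelta m x)⁻¹ = ω * π := by
    rw [hω, div_mul_cancel₀ _ Real.pi_pos.ne']
  set F : ℝ → ℝ := fun x => (∫ y in (0 : ℝ)..x, (ellipticDelta m y)⁻¹) / ω with hF
  have hFd : ∀ x, HasDerivAt F ((ellipticDelta m x)⁻¹ / ω) x := fun x =>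
    (hasDerivAt_integral_zero hc x).div_const ω
  have hFc : Continuous F := continuous_iff_continuousAt.2 fun x => (hFd x).continuousAt
  have hmono : StrictMono F := strictMono_of_deriv_pos fun x => by
    rw [(hFd x).deriv]
    exact div_pos (inv_pos.2 (hpos x)) hω0
  have hF0 : F 0 = 0 := by simp [hF]
  have hFπ : ∀ x, F (x + π) = F x + π := by
    intro x
    have hi : ∀ a b, IntervalIntegrable (fun x => (ellipticDelta m x)⁻¹) MeasureTheory.volume a b :=
      fun a b => hc.intervalIntegrable a b
    have h1 := hper.intervalIntegral_add_eq x 0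
    simp only [zero_add] at h1
    simp only [hF]
    rw [← intervalIntegral.integral_add_adjacent_intervals (hi 0 x) (hi x (x + π)), h1, hωπ]
    field_simp
  have hFnat : ∀ n : ℤ, F (n * π) = n * π := by
    have hp : Function.Periodic (fun x => F x - x) π := fun x => by
      simp only [hFπ]; ring
    intro n
    have := hp.int_mul n 0
    simp only [zero_add, hF0, sub_zero] at this
    linarith
  have hsurj : Function.Surjective F := by
    intro y
    refine mem_range_of_exists_le_of_exists_ge hFc ⟨⌊y / π⌋ * π, ?_⟩ ⟨⌈y / π⌉ * π, ?_⟩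
    · rw [hFnat, ← le_div_iff₀ Real.pi_pos]; exact Int.floor_le _
    · rw [hFnat, ← div_le_iff₀ Real.pi_pos]; exact Int.le_ceil _
  set e := hmono.orderIsoOfSurjective F hsurj
  have hFe : ∀ t, F (e.symm t) = t := fun t => e.apply_symm_apply t
  refine ⟨ω, e.symm, ?_, hω0, fun t => ?_, e.symm.strictMono, ?_, fun t => ?_⟩
  · rw [integral_two_pi_eq_add hc]
    simp only [hper _, hωπ]
    ring
  · have h1 := (hFd (e.symm t)).of_local_left_inverse e.symm.continuous.continuousAt
      (div_pos (inv_pos.2 (hpos _)) hω0).ne' (Filter.Eventually.of_forall hFe)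
    refine h1.congr_deriv ?_
    rw [inv_div, div_inv_eq_mul]
  · exact hmono.injective (by rw [hFe, hF0])
  · exact hmono.injective (by rw [hFπ, hFe, hFe])

/-- The classical oscillation `u = 2 arcsin (√m sin φ)` is used. Its maximal velocity is `2 √m ω`,
so the quantity to be bounded is `ω² (1 - m)`, which serves to destabilize the multiply passed
eights. -/
theorem exists_isEightAngle :
    ∃ (ω : ℝ) (u u' : ℝ → ℝ), 0 < ω ∧ IsEightAngle ω u u' ∧ 1 / 4 < ω ^ 2 - u' 0 ^ 2 / 4 := by
  obtain ⟨m, hm0, hm7, hm⟩ := exists_modulus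
  have hm1 : m < 1 := hm7.trans (by norm_num)
  obtain ⟨ω, φ, hω, hω0, hφ, hmono, hφ0, hφπ⟩ := exists_amplitude hm0.le hm1
  have hpos := ellipticDelta_pos hm0.le hm1
  have hsq := ellipticDelta_sq hm0.le hm1
  have hc := continuous_ellipticDelta m
  have hci : Continuous fun x => (ellipticDelta m x)⁻¹ := hc.inv₀ fun x => (hpos x).ne'
  have hφc : Continuous φ := continuous_iff_continuousAt.2 fun t => (hφ t).continuousAt
  set k := √m with hk
  have hk0 : 0 < k := Real.sqrt_pos.2 hm0
  have hk2 : k ^ 2 = m := Real.sq_sqrt hm0.le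
  have hx2 : ∀ t, (k * Real.sin (φ t)) ^ 2 < 1 := fun t => by
    rw [mul_pow, hk2]; exact mul_sin_sq_lt_one hm0.le hm1 _
  have hx : ∀ t, |k * Real.sin (φ t)| < 1 := fun t => (sq_lt_one_iff_abs_lt_one _).1 (hx2 t)
  have hx' : ∀ t, -1 < k * Real.sin (φ t) ∧ k * Real.sin (φ t) < 1 := fun t =>
    _root_.abs_lt.1 (hx t)
  have hroot : ∀ t, √(1 - (k * Real.sin (φ t)) ^ 2) = ellipticDelta m (φ t) := fun t => by
    rw [mul_pow, hk2]; rfl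
  set u : ℝ → ℝ := fun t => 2 * Real.arcsin (k * Real.sin (φ t)) with hu
  set u' : ℝ → ℝ := fun t => 2 * k * ω * Real.cos (φ t) with hu'
  have hsinu : ∀ t, Real.sin (u t) = 2 * (k * Real.sin (φ t)) * ellipticDelta m (φ t) := fun t => by
    simp only [hu]
    rw [Real.sin_two_mul, Real.sin_arcsin (hx' t).1.le (hx' t).2.le, Real.cos_arcsin, hroot]
  have hcosu : ∀ t, Real.cos (u t) = 2 * ellipticDelta m (φ t) ^ 2 - 1 := fun t => by
    simp only [hu]
    rw [Real.cos_two_mul, Real.cos_arcsin, hroot]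
  have hpend : IsPendulum ω u u' := by
    refine ⟨fun t => ?_, fun t => ?_⟩
    · have h1 := (Real.hasDerivAt_arcsin (hx' t).1.ne' (hx' t).2.ne).comp t
        (((hφ t).sin).const_mul k)
      refine (h1.const_mul 2).congr_deriv ?_
      rw [hroot]
      have := (hpos (φ t)).ne'
      simp only [hu']
      field_simp
    · refine ((hφ t).cos.const_mul (2 * k * ω)).congr_deriv ?_
      rw [hsinu]; ring
  have height : IsEightAngle ω u u' :=
    { toIsPendulum := hpend
      zero := by simp [hu, hφ0]
      deriv_pos := by simp only [hu', hφ0, Real.cos_zero]; positivity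
      pos := fun t ht => by
        have h1 := hmono ht.1
        have h2 := hmono ht.2
        have h3 := hφπ 0
        rw [zero_add, hφ0] at h3
        rw [hφ0] at h1
        have h4 := Real.sin_pos_of_pos_of_lt_pi h1 (by linarith)
        exact mul_pos two_pos (Real.arcsin_pos.2 (by positivity))
      abs_lt := fun t => by
        simp only [hu, _root_.abs_lt]
        have h1 := Real.neg_pi_div_two_lt_arcsin.2 (hx' t).1
        have h2 := Real.arcsin_lt_pi_div_two.2 (hx' t).2
        constructor <;> linarith
      antiperiodic := fun t => by
        simp only [hu, hφπ, Real.sin_add_pi, mul_neg, Real.arcsin_neg]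
      integral_cos := by
        have h1 := intervalIntegral.integral_comp_mul_deriv (a := 0) (b := 2 * π)
          (g := fun x => 2 * ellipticDelta m x - (ellipticDelta m x)⁻¹)
          (fun t _ => hφ t) (Continuous.continuousOn (by fun_prop)) (by fun_prop)
        have h2 : φ (2 * π) = 2 * π := by
          rw [two_mul, hφπ]
          have := hφπ 0
          rw [zero_add, hφ0, zero_add] at this
          rw [this]
        rw [hφ0, h2, hm] at h1
        have h3 : ∀ t, ((fun x => 2 * ellipticDelta m x - (ellipticDelta m x)⁻¹) ∘ φ) t *
            (ω * ellipticDelta m (φ t)) = ω * Real.cos (u t) := fun t => by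
          have := (hpos (φ t)).ne'
          rw [hcosu]
          simp only [Function.comp]
          field_simp
        simp only [h3, intervalIntegral.integral_const_mul] at h1
        exact (mul_eq_zero.1 h1).resolve_left hω0.ne' }
  refine ⟨ω, u, u', hω0, height, ?_⟩
  -- By the choice of `m`, both `2Δ` and `1/Δ` have integral `2πω`. Pointwise `2Δ + 1/Δ ≥ 2√2`.
  -- Together with `1 - m > 1/8` this gives the strict bound `1/4`.
  have hω2 : √2 ≤ ω := by
    rw [intervalIntegral.integral_sub ((hc.const_mul 2).intervalIntegrable _ _)
      (hci.intervalIntegrable _ _)] at hm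
    have h1 : ∫ _x in (0 : ℝ)..2 * π, (2 * √2) ≤
        ∫ x in (0 : ℝ)..2 * π, (2 * ellipticDelta m x + (ellipticDelta m x)⁻¹) := by
      refine intervalIntegral.integral_mono Real.two_pi_pos.le
        (continuous_const.intervalIntegrable _ _)
        (((hc.const_mul 2).add hci).intervalIntegrable _ _) fun x => ?_
      have hp := hpos x
      have h2 : 0 ≤ (√2 * ellipticDelta m x - 1) ^ 2 / ellipticDelta m x := by positivity
      have h3 : (√2 * ellipticDelta m x - 1) ^ 2 / ellipticDelta m x =
          2 * ellipticDelta m x + (ellipticDelta m x)⁻¹ - 2 * √2 := by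
        have := Real.sq_sqrt (zero_le_two (α := ℝ))
        field_simp
        rw [sub_sq, mul_pow, this]
        ring
      simp only
      linarith
    rw [intervalIntegral.integral_add ((hc.const_mul 2).intervalIntegrable _ _)
      (hci.intervalIntegrable _ _), intervalIntegral.integral_const, smul_eq_mul] at h1
    have h2 : 2 * π * √2 ≤ 2 * π * ω := by linarith
    exact le_of_mul_le_mul_left h2 Real.two_pi_pos
  have hω3 : 2 ≤ ω ^ 2 := by
    have := pow_le_pow_left₀ (Real.sqrt_nonneg 2) hω2 2
    rwa [Real.sq_sqrt zero_le_two] at this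
  simp only [hu', hφ0, Real.cos_zero, mul_one, mul_pow, hk2]
  nlinarith

/-! ### Arc length curves and their tangent angles -/

theorem hasDerivAt_exp_mul_I {α : ℝ → ℝ} {a t : ℝ} (h : HasDerivAt α a t) :
    HasDerivAt (fun t => exp (α t * I)) (exp (α t * I) * (a * I)) t :=
  (h.ofReal_comp.mul_const I).cexp

theorem continuous_of_forall_hasDerivAt {E : Type*} [NormedAddCommGroup E] [NormedSpace ℝ E]
    {f f' : ℝ → E} (h : ∀ t, HasDerivAt f (f' t) t) : Continuous f :=
  continuous_iff_continuousAt.2 fun t => (h t).continuousAt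

theorem hasWhitneyIndex_of_angle {γ : ℝ → ℂ} {α : ℝ → ℝ} {n : ℤ} (hα : Continuous α)
    (hγ : ∀ t, deriv γ t = exp (α t * I)) (hn : ∀ t, α (t + 2 * π) = α t + 2 * π * n) :
    HasWhitneyIndex γ n := by
  refine ⟨α, hα, fun t => ?_, ?_⟩
  · rw [hγ, Complex.norm_exp_ofReal_mul_I]; simp
  · have := hn 0
    rw [zero_add] at this
    rw [this]; ring

theorem eulerFunctional_eq {γ : ℝ → ℂ} {α α' : ℝ → ℝ} (hα : ∀ t, HasDerivAt α (α' t) t)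
    (hγ : ∀ t, deriv γ t = exp (α t * I)) :
    eulerFunctional γ = ∫ t in (0 : ℝ)..2 * π, α' t ^ 2 := by
  refine intervalIntegral.integral_congr fun t _ => ?_
  have h1 : deriv γ = fun t => exp (α t * I) := funext hγ
  have h2 : deriv (deriv γ) t = exp (α t * I) * (α' t * I) := by
    rw [h1]; exact (hasDerivAt_exp_mul_I (hα t)).deriv
  have h3 : conj (exp (α t * I)) * (exp (α t * I) * (α' t * I)) = α' t * I := by
    rw [← mul_assoc, ← Complex.normSq_eq_conj_mul_self, Complex.normSq_eq_norm_sq,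
      Complex.norm_exp_ofReal_mul_I]
    simp
  simp only [signedCurvature]
  rw [h2, hγ, Complex.norm_exp_ofReal_mul_I, h3]
  simp

/-- The curve with initial point `p` and tangent angle `α`. -/
noncomputable def curveOfAngle (p : ℂ) (α : ℝ → ℝ) (t : ℝ) : ℂ :=
  p + ∫ s in (0 : ℝ)..t, exp (α s * I)

theorem hasDerivAt_curveOfAngle {p : ℂ} {α : ℝ → ℝ} (hα : Continuous α) (t : ℝ) :
    HasDerivAt (curveOfAngle p α) (exp (α t * I)) t :=
  (hasDerivAt_integral_zero (f := fun s => exp (α s * I)) (by fun_prop) t).const_add p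

theorem isArcLengthCurve_curveOfAngle {p : ℂ} {α α' : ℝ → ℝ} {n : ℤ}
    (hα : ∀ t, HasDerivAt α (α' t) t) (hα' : Continuous α')
    (hn : ∀ t, α (t + 2 * π) = α t + 2 * π * n)
    (hclosed : ∫ t in (0 : ℝ)..2 * π, exp (α t * I) = 0) :
    IsArcLengthCurve (curveOfAngle p α) := by
  have hc := continuous_of_forall_hasDerivAt hα
  refine ⟨contDiff_two_of_hasDerivAt (hasDerivAt_curveOfAngle hc)
    (contDiff_one_of_hasDerivAt (fun t => hasDerivAt_exp_mul_I (hα t)) (by fun_prop)),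
    fun t => congrArg (p + ·) (periodic_integral_of_integral_eq_zero
      (f := fun s => exp (α s * I)) (by fun_prop) (fun t => ?_) hclosed t), fun t => ?_⟩
  · simp only [hn]
    exact Complex.exp_eq_exp_iff_exists_int.2 ⟨n, by push_cast; ring⟩
  · rw [(hasDerivAt_curveOfAngle hc t).deriv, Complex.norm_exp_ofReal_mul_I]

namespace IsArcLengthCurve

variable {γ : ℝ → ℂ}

theorem hasDerivAt (h : IsArcLengthCurve γ) (t : ℝ) : HasDerivAt γ (deriv γ t) t :=
  h.contDiff.hasDerivAt_deriv two_ne_zero t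

theorem isRegularClosedCurve (h : IsArcLengthCurve γ) : IsRegularClosedCurve 2 γ :=
  ⟨h.contDiff, h.periodic, fun t => norm_ne_zero_iff.1 (by rw [h.norm_deriv]; exact one_ne_zero)⟩

theorem continuous_deriv (h : IsArcLengthCurve γ) : Continuous (deriv γ) :=
  h.contDiff.continuous_deriv (by norm_num)

theorem exists_angle {n : ℤ} (h : IsArcLengthCurve γ) (hn : HasWhitneyIndex γ n) :
    ∃ α α' : ℝ → ℝ, (∀ t, HasDerivAt α (α' t) t) ∧ Continuous α' ∧
      (∀ t, deriv γ t = exp (α t * I)) ∧ ∀ t, α (t + 2 * π) = α t + 2 * π * n := by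
  obtain ⟨w, m, hw, hγ, hp⟩ := h.isRegularClosedCurve.exists_log
  obtain rfl := (hasWhitneyIndex_of_log hw.continuous hγ hp).unique
    h.isRegularClosedCurve.deriv_ne_zero hn
  have hre : ∀ t, (w t).re = 0 := fun t => by
    have h1 := h.norm_deriv t
    rw [hγ, Complex.norm_exp] at h1
    simpa using h1
  refine ⟨fun t => (w t).im, fun t => (deriv w t).im, fun t =>
    Complex.imCLM.hasFDerivAt.comp_hasDerivAt t (hw.hasDerivAt_deriv one_ne_zero t),
    Complex.continuous_im.comp (hw.continuous_deriv le_rfl), fun t => ?_, fun t => ?_⟩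
  · rw [hγ]
    conv_lhs => rw [← Complex.re_add_im (w t), hre t]
    simp
  · simp [hp]

theorem integral_exp_angle (h : IsArcLengthCurve γ) {α : ℝ → ℝ}
    (hγ : ∀ t, deriv γ t = exp (α t * I)) : ∫ t in (0 : ℝ)..2 * π, exp (α t * I) = 0 := by
  have h1 : ∫ t in (0 : ℝ)..2 * π, deriv γ t = γ (2 * π) - γ 0 :=
    intervalIntegral.integral_eq_sub_of_hasDerivAt (fun t _ => h.hasDerivAt t)
      (h.continuous_deriv.intervalIntegrable _ _)
  simp only [hγ] at h1
  rw [h1, sub_eq_zero]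
  simpa using h.periodic 0

/-- A period of the tangent of a closed curve is a period of the curve. -/
theorem periodic_of_deriv (h : IsArcLengthCurve γ) {T : ℝ}
    (hT : Function.Periodic (deriv γ) T) : Function.Periodic γ T := by
  have hd : ∀ t, HasDerivAt (fun t => γ (t + T) - γ t) 0 t := fun t =>
    (((h.hasDerivAt (t + T)).comp_add_const t T).sub (h.hasDerivAt t)).congr_deriv (by
      rw [hT, sub_self])
  have hconst : ∀ t, γ (t + T) - γ t = γ (0 + T) - γ 0 := fun t =>
    is_const_of_deriv_eq_zero (fun t => (hd t).differentiableAt) (fun t => (hd t).deriv) t 0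
  set C := γ (0 + T) - γ 0
  have hn : ∀ n : ℕ, γ (n * T) = γ 0 + n * C := by
    intro n
    induction n with
    | zero => simp
    | succ n ih =>
      have := hconst (n * T)
      rw [show ((n + 1 : ℕ) : ℝ) * T = n * T + T by push_cast; ring]
      push_cast
      linear_combination this + ih
  -- A shift by `T` adds a constant `C` to the curve; iterating it contradicts boundedness unless `C
  -- = 0`.
  have hbdd : ∃ M, ∀ t, ‖γ t‖ ≤ M := by
    have hc : Continuous γ := h.contDiff.continuous
    obtain ⟨a, _, hmax⟩ := isCompact_Icc.exists_isMaxOn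
      (Set.nonempty_Icc.2 Real.two_pi_pos.le) hc.norm.continuousOn
    refine ⟨‖γ a‖, fun t => ?_⟩
    obtain ⟨s, hs, e⟩ := h.periodic.exists_mem_Ico₀ Real.two_pi_pos t
    rw [e]
    exact hmax (Set.Ico_subset_Icc_self hs)
  obtain ⟨M, hM⟩ := hbdd
  have hC : C = 0 := by
    by_contra hC
    obtain ⟨n, hlt⟩ := exists_nat_gt (2 * M / ‖C‖)
    rw [div_lt_iff₀ (norm_pos_iff.2 hC)] at hlt
    have h1 : (n : ℂ) * C = γ (n * T) - γ 0 := by rw [hn]; ring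
    have h2 : (n : ℝ) * ‖C‖ ≤ M + M := by
      rw [← Complex.norm_natCast n, ← norm_mul, h1]
      exact (norm_sub_le _ _).trans (add_le_add (hM _) (hM _))
    linarith
  intro t
  have := hconst t
  rw [hC, sub_eq_zero] at this
  exact this

end IsArcLengthCurve

theorem sameShape_of_angle {γ₁ γ₂ : ℝ → ℂ} {α₁ α₂ : ℝ → ℝ} {τ c : ℝ} (h₁ : IsArcLengthCurve γ₁)
    (h₂ : IsArcLengthCurve γ₂) (hγ₁ : ∀ t, deriv γ₁ t = exp (α₁ t * I))
    (hγ₂ : ∀ t, deriv γ₂ t = exp (α₂ t * I)) (hα : ∀ t, α₂ t = α₁ (t + τ) + c) :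
    SameShape γ₁ γ₂ := by
  have hd : ∀ t, HasDerivAt (fun t => γ₂ t - exp (c * I) * γ₁ (t + τ)) 0 t := fun t => by
    refine ((h₂.hasDerivAt t).sub
      (((h₁.hasDerivAt (t + τ)).comp_add_const t τ).const_mul _)).congr_deriv ?_
    rw [hγ₁, hγ₂, hα, ← Complex.exp_add, sub_eq_zero]
    congr 1
    push_cast
    ring
  refine ⟨exp (c * I), γ₂ 0 - exp (c * I) * γ₁ (0 + τ), τ, Complex.norm_exp_ofReal_mul_I c,
    fun t => ?_⟩
  have : γ₂ t - exp (c * I) * γ₁ (t + τ) = γ₂ 0 - exp (c * I) * γ₁ (0 + τ) :=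
    is_const_of_deriv_eq_zero (fun t => (hd t).differentiableAt) (fun t => (hd t).deriv) t 0
  linear_combination this

theorem SameShape.isArcLengthCurve {γ₁ γ₂ : ℝ → ℂ} (h : SameShape γ₁ γ₂)
    (h₁ : IsArcLengthCurve γ₁) : IsArcLengthCurve γ₂ := by
  obtain ⟨a, b, τ, ha, hγ⟩ := h
  obtain rfl : γ₂ = fun t => a * γ₁ (t + τ) + b := funext hγ
  refine ⟨?_, fun t => ?_, fun t => ?_⟩
  · exact (contDiff_const.mul (h₁.contDiff.comp (contDiff_id.add contDiff_const))).add contDiff_const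
  · simp only [add_right_comm, h₁.periodic _]
  · rw [((((h₁.hasDerivAt (t + τ)).comp_add_const t τ).const_mul a).add_const b).deriv, norm_mul,
      ha, h₁.norm_deriv, mul_one]

theorem SameShape.exists_angle {γ₁ γ₂ : ℝ → ℂ} (h : SameShape γ₁ γ₂) (h₁ : IsArcLengthCurve γ₁) :
    ∃ τ c : ℝ, ∀ α : ℝ → ℝ, (∀ t, deriv γ₁ t = exp (α t * I)) →
      ∀ t, deriv γ₂ t = exp ((α (t + τ) + c : ℝ) * I) := by
  obtain ⟨a, b, τ, ha, hγ⟩ := h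
  obtain rfl : γ₂ = fun t => a * γ₁ (t + τ) + b := funext hγ
  refine ⟨τ, a.arg, fun α hα t => ?_⟩
  rw [((((h₁.hasDerivAt (t + τ)).comp_add_const t τ).const_mul a).add_const b).deriv, hα]
  conv_lhs => rw [← Complex.norm_mul_exp_arg_mul_I a, ha]
  rw [Complex.ofReal_one, one_mul, ← Complex.exp_add]
  push_cast
  congr 1
  ring

theorem SameShape.refl (γ : ℝ → ℂ) : SameShape γ γ := ⟨1, 0, 0, by simp, fun t => by simp⟩

theorem SameShape.hasWhitneyIndex {γ₁ γ₂ : ℝ → ℂ} {n : ℤ} (h : SameShape γ₁ γ₂)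
    (h₁ : IsArcLengthCurve γ₁) (hn : HasWhitneyIndex γ₁ n) : HasWhitneyIndex γ₂ n := by
  obtain ⟨α, α', hα, -, hγ, hp⟩ := h₁.exists_angle hn
  obtain ⟨τ, c, hτ⟩ := h.exists_angle h₁
  have hc := continuous_of_forall_hasDerivAt hα
  refine hasWhitneyIndex_of_angle (by fun_prop) (hτ α hγ) fun t => ?_
  rw [add_right_comm, hp]; ring

/-- A curve which minimizes the Euler functional among all curves of its index is a local
minimum. -/
theorem isEulerLocalMin_of_index {N : ℝ → ℂ} {n : ℤ} (hN : IsArcLengthCurve N)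
    (hn : HasWhitneyIndex N n) (hmin : ∀ γ, IsArcLengthCurve γ → HasWhitneyIndex γ n →
      eulerFunctional N ≤ eulerFunctional γ) : IsEulerLocalMin N := by
  refine ⟨hN, 1, one_pos, fun γ hγ hclose => hmin γ hγ ?_⟩
  refine hn.of_norm_sub_lt hN.continuous_deriv hγ.continuous_deriv hN.periodic.deriv
    hγ.periodic.deriv fun t => ?_
  have := hclose 1 one_le_two t
  rwa [iteratedDeriv_one, iteratedDeriv_one, ← hN.norm_deriv t] at this

/-! ### Multiply traversed circles -/

theorem isArcLengthCurve_multiCircle {n : ℤ} (hn : n ≠ 0) :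
    IsArcLengthCurve (multiCircle n) ∧
      ∀ t, deriv (multiCircle n) t = exp ((n * t + π / 2 : ℝ) * I) := by
  have hn' : (n : ℂ) ≠ 0 := by exact_mod_cast hn
  have hd : ∀ t : ℝ, HasDerivAt (multiCircle n) (exp ((n : ℂ) * t * I) * I) t := fun t => by
    have h1 : HasDerivAt (fun t : ℝ => (n : ℂ) * t * I) (n * I) t := by
      simpa using (((hasDerivAt_id t).ofReal_comp.const_mul (n : ℂ)).mul_const I)
    refine (h1.cexp.div_const (n : ℂ)).congr_deriv ?_
    field_simp
  have he : ∀ t : ℝ, exp ((n : ℂ) * t * I) * I = exp ((n * t + π / 2 : ℝ) * I) := fun t => by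
    push_cast
    rw [add_mul, Complex.exp_add, Complex.exp_pi_div_two_mul_I]
  refine ⟨⟨?_, fun t => ?_, fun t => ?_⟩, fun t => by rw [(hd t).deriv, he]⟩
  · unfold multiCircle
    exact ((((contDiff_const.mul Complex.ofRealCLM.contDiff).mul contDiff_const).cexp).div_const _)
  · unfold multiCircle
    congr 1
    exact Complex.exp_eq_exp_iff_exists_int.2 ⟨n, by push_cast; ring⟩
  · rw [(hd t).deriv, he, Complex.norm_exp_ofReal_mul_I]

/-- Expand `∫ (α' - n)² ≥ 0`, where `∫ α' = 2πn`. -/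
theorem two_pi_mul_sq_le_eulerFunctional {γ : ℝ → ℂ} {n : ℤ} (h : IsArcLengthCurve γ)
    (hn : HasWhitneyIndex γ n) : 2 * π * n ^ 2 ≤ eulerFunctional γ := by
  obtain ⟨α, α', hα, hα', hγ, hp⟩ := h.exists_angle hn
  rw [eulerFunctional_eq hα hγ]
  have h1 : ∫ t in (0 : ℝ)..2 * π, α' t = 2 * π * n := by
    rw [intervalIntegral.integral_eq_sub_of_hasDerivAt (fun t _ => hα t)
      (hα'.intervalIntegrable _ _)]
    have := hp 0
    rw [zero_add] at this
    rw [this]; ring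
  have h2 : 0 ≤ ∫ t in (0 : ℝ)..2 * π, (α' t - n) ^ 2 :=
    intervalIntegral.integral_nonneg Real.two_pi_pos.le fun t _ => sq_nonneg _
  have h3 : ∀ t, (α' t - n) ^ 2 = α' t ^ 2 - (2 * n * α' t - n ^ 2) := fun t => by ring
  simp only [h3] at h2
  rw [intervalIntegral.integral_sub (Continuous.intervalIntegrable (by fun_prop) _ _)
      (Continuous.intervalIntegrable (by fun_prop) _ _),
    intervalIntegral.integral_sub (Continuous.intervalIntegrable (by fun_prop) _ _)
      (Continuous.intervalIntegrable (by fun_prop) _ _),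
    intervalIntegral.integral_const_mul, h1, intervalIntegral.integral_const, smul_eq_mul] at h2
  linarith

theorem SameShape.isEulerLocalMin_of_multiCircle {N : ℝ → ℂ} {n : ℤ} (hn : n ≠ 0)
    (h : SameShape (multiCircle n) N) : IsEulerLocalMin N ∧ HasWhitneyIndex N n := by
  obtain ⟨hc, hd⟩ := isArcLengthCurve_multiCircle hn
  obtain ⟨τ, c, hτ⟩ := h.exists_angle hc
  have hN := h.isArcLengthCurve hc
  have hγ := hτ (fun t => n * t + π / 2) hd
  have hα : ∀ t, HasDerivAt (fun t : ℝ => n * (t + τ) + π / 2 + c) (n : ℝ) t := fun t => by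
    simpa using ((((hasDerivAt_id t).add_const τ).const_mul (n : ℝ)).add_const (π / 2)).add_const c
  have hidx : HasWhitneyIndex N n := by
    refine hasWhitneyIndex_of_angle (by fun_prop) hγ fun t => ?_
    ring
  refine ⟨isEulerLocalMin_of_index hN hidx fun γ h1 h2 => ?_, hidx⟩
  rw [eulerFunctional_eq hα hγ]
  simpa using two_pi_mul_sq_le_eulerFunctional h1 h2

theorem sameShape_multiCircle_of_angle {N : ℝ → ℂ} {n : ℤ} {c : ℝ} (hn : n ≠ 0)
    (hN : IsArcLengthCurve N) (hγ : ∀ t, deriv N t = exp ((n * t + c : ℝ) * I)) :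
    SameShape (multiCircle n) N := by
  obtain ⟨hc, hd⟩ := isArcLengthCurve_multiCircle hn
  exact sameShape_of_angle hc hN hd hγ (τ := 0) (c := c - π / 2) fun t => by ring

/-! ### Figure eight elasticae -/

/-- The normalized oscillation has some half period `τ ≤ π`. Then `2τ` is a period of the tangent,
hence of the closed curve, and minimality of the period `2π` gives `τ = π`. -/
theorem IsFigureEightElastica.exists_isEightAngle {γ : ℝ → ℂ} (h : IsFigureEightElastica γ) :
    ∃ (ω : ℝ) (u u' : ℝ → ℝ) (t₀ θ : ℝ), 0 < ω ∧ IsEightAngle ω u u' ∧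
      ∀ t, deriv γ t = exp ((u (t + t₀) + θ : ℝ) * I) := by
  obtain ⟨hγ, ⟨α, θ, ω, hω, hα, hαp, hγα, hode⟩, hmin⟩ := h
  have hP : IsPendulum ω α (deriv α) :=
    ⟨hα.hasDerivAt_deriv two_ne_zero, fun t => by
      have h1 : HasDerivAt (deriv α) (deriv (deriv α) t) t :=
        (ContDiff.contDiff_one_deriv hα).hasDerivAt_deriv one_ne_zero t
      exact h1.congr_deriv (by linarith [hode t])⟩
  have hcl := hγ.integral_exp_angle hγα
  have hcos : ∫ t in (0 : ℝ)..2 * π, Real.cos (α t) = 0 := by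
    have e : ∀ t, exp ((α t + θ : ℝ) * I) = exp (α t * I) * exp (θ * I) := fun t => by
      rw [← Complex.exp_add]; push_cast; ring_nf
    simp only [e, intervalIntegral.integral_mul_const] at hcl
    have h1 := (mul_eq_zero.1 hcl).resolve_right (Complex.exp_ne_zero _)
    rw [integral_exp_mul_I hP.continuous] at h1
    simpa using congrArg Complex.re h1
  obtain ⟨t₀, k, τ, v, v', hv, hαv, hτ0, hτπ, hv0, hv'0, hvpos, habs, hanti⟩ :=
    hP.exists_normalization hω hαp hcos
  have hγv : ∀ t, deriv γ t = exp ((v (t + -t₀) + (2 * π * k + θ) : ℝ) * I) := fun t => by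
    have h1 := hαv (t + -t₀)
    rw [neg_add_cancel_right] at h1
    rw [hγα, h1, add_assoc]
  have hper : Function.Periodic (deriv γ) (2 * τ) := fun t => by
    rw [hγv, hγv, show t + 2 * τ + -t₀ = (t + -t₀) + τ + τ by ring, hanti, hanti, neg_neg]
  have hτ : τ = π := by
    have := hmin (2 * τ) (by linarith) (hγ.periodic_of_deriv hper)
    linarith
  subst hτ
  refine ⟨ω, v, v', -t₀, 2 * π * k + θ, hω,
    { toIsPendulum := hv, zero := hv0, deriv_pos := hv'0, pos := hvpos, abs_lt := habs,
      antiperiodic := hanti, integral_cos := ?_ }, hγv⟩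
  have h2 := integral_comp_add_of_periodic (f := fun t => Real.cos (α t)) (T := 2 * π)
    (fun t => by simp only [hαp t]) t₀
  simp only [hαv, mul_comm (2 * π), Real.cos_add_int_mul_two_pi] at h2
  rwa [hcos] at h2

theorem Function.Antiperiodic.two_mul_le_of_periodic {v : ℝ → ℝ} {τ T : ℝ}
    (hv : Function.Antiperiodic v τ) (h0 : v 0 = 0) (hpos : ∀ t ∈ Set.Ioo 0 τ, 0 < v t)
    (hτ : 0 < τ) (hp : Function.Periodic v T) (hT : 0 < T) : 2 * τ ≤ T := by
  by_contra! hlt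
  have hT0 : v T = 0 := by simpa [h0] using hp 0
  rcases lt_trichotomy T τ with h1 | h1 | h1
  · exact (hpos T ⟨hT, h1⟩).ne' hT0
  · have h2 := hp (τ / 2)
    rw [h1, hv] at h2
    have := hpos (τ / 2) ⟨by linarith, by linarith⟩
    linarith
  · have h2 := hv.sub_eq T
    have := hpos (T - τ) ⟨by linarith, by linarith⟩
    linarith

theorem IsEightAngle.isFigureEightElastica {ω t₀ θ : ℝ} {u u' : ℝ → ℝ} {γ : ℝ → ℂ} (hω : 0 < ω)
    (h : IsEightAngle ω u u') (hγ : IsArcLengthCurve γ)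
    (hu : ∀ t, deriv γ t = exp ((u (t + t₀) + θ : ℝ) * I)) : IsFigureEightElastica γ := by
  have hs := h.toIsPendulum.comp_add_const t₀
  have hd : deriv (fun t => u (t + t₀)) = fun t => u' (t + t₀) :=
    funext fun t => (hs.hasDerivAt t).deriv
  refine ⟨hγ, ⟨fun t => u (t + t₀), θ, ω, hω, ?_, fun t => ?_, hu, fun t => ?_⟩, ?_⟩
  · have hc := h.continuous
    exact contDiff_two_of_hasDerivAt hs.hasDerivAt
      (contDiff_one_of_hasDerivAt hs.hasDerivAt' (by fun_prop))
  · simp only [add_right_comm, h.periodic _]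
  · rw [hd, (hs.hasDerivAt' t).deriv]; ring
  · intro T hT hper
    -- A period of the tangent determines the angle only modulo `2π`. The bound `|u| < π` removes
    -- the ambiguity.
    have huT : ∀ t, u (t + T) = u t := by
      intro t
      have h1 := hper.deriv (t - t₀)
      rw [hu, hu] at h1
      obtain ⟨k, hk⟩ := exp_ofReal_mul_I_inj h1
      rw [show t - t₀ + T + t₀ = t + T by ring, sub_add_cancel] at hk
      have h2 := _root_.abs_lt.1 (h.abs_lt (t + T))
      have h3 := _root_.abs_lt.1 (h.abs_lt t)
      have hk1 : (k : ℝ) < 1 := by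
        by_contra! hcon
        nlinarith [Real.pi_pos]
      have hk2 : (-1 : ℝ) < k := by
        by_contra! hcon
        nlinarith [Real.pi_pos]
      have hk0 : k = 0 := by
        have h4 : k < 1 := by exact_mod_cast hk1
        have h5 : -1 < k := by exact_mod_cast hk2
        omega
      rw [hk0] at hk
      simp at hk
      linarith
    exact h.antiperiodic.two_mul_le_of_periodic h.zero h.pos Real.pi_pos huT hT

theorem IsFigureEightElastica.isEulerLocalMin {N : ℝ → ℂ} (h : IsFigureEightElastica N) :
    IsEulerLocalMin N ∧ HasWhitneyIndex N 0 := by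
  obtain ⟨ω, u, u', t₀, θ, hω, hu, hN⟩ := h.exists_isEightAngle
  have hs : ∀ t, HasDerivAt (fun t => u (t + t₀) + θ) (u' (t + t₀)) t := fun t =>
    ((hu.hasDerivAt (t + t₀)).comp_add_const t t₀).add_const θ
  have hidx : HasWhitneyIndex N 0 := by
    refine hasWhitneyIndex_of_angle (continuous_of_forall_hasDerivAt hs) hN fun t => ?_
    rw [add_right_comm, hu.periodic]; simp
  refine ⟨isEulerLocalMin_of_index h.1 hidx fun γ hγ hγ0 => ?_, hidx⟩
  obtain ⟨β, β', hβ, hβ', hγβ, hp⟩ := hγ.exists_angle hγ0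
  rw [eulerFunctional_eq hs hN, eulerFunctional_eq hβ hγβ,
    integral_comp_add_of_periodic (f := fun t => u' t ^ 2)
      (fun t => by simp only [hu.periodic' t]) t₀]
  exact (hu.integral_sq_le hω hβ hβ' (fun t => by simpa using hp t)
    (hγ.integral_exp_angle hγβ)).1

theorem IsFigureEightElastica.sameShape_iff {N : ℝ → ℂ} (h : IsFigureEightElastica N)
    (N' : ℝ → ℂ) : IsFigureEightElastica N' ↔ SameShape N N' := by
  obtain ⟨ω, u, u', t₀, θ, hω, hu, hN⟩ := h.exists_isEightAngle
  constructor
  · intro h'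
    obtain ⟨ω', v, v', t₁, θ', hω', hv, hN'⟩ := h'.exists_isEightAngle
    obtain ⟨⟨τ, hτ⟩, -, -⟩ := hu.unique_shape hv hω hω'
    refine sameShape_of_angle h.1 h'.1 hN hN' (τ := t₁ - τ - t₀) (c := θ' - θ) fun t => ?_
    rw [show t + (t₁ - τ - t₀) + t₀ = t + t₁ - τ by ring, ← hτ, sub_add_cancel]
    ring
  · intro hs
    obtain ⟨τ, c, hτ⟩ := hs.exists_angle h.1
    refine hu.isFigureEightElastica hω (hs.isArcLengthCurve h.1) (t₀ := τ + t₀) (θ := θ + c)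
      fun t => ?_
    rw [hτ (fun t => u (t + t₀) + θ) hN t]
    simp only [add_assoc]

theorem exists_isFigureEightElastica : ∃ N, IsFigureEightElastica N := by
  obtain ⟨ω, u, u', hω, hu, -⟩ := exists_isEightAngle
  refine ⟨curveOfAngle 0 u, hu.isFigureEightElastica (t₀ := 0) (θ := 0) hω
    (isArcLengthCurve_curveOfAngle (n := 0) hu.hasDerivAt hu.continuous'
      (fun t => by simpa using hu.periodic t) (hu.integral_exp hω)) fun t => ?_⟩
  rw [(hasDerivAt_curveOfAngle hu.continuous t).deriv]
  simp

/-! ### Admissible variations of the tangent angle -/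

theorem exists_norm_le_of_periodic {E : Type*} [NormedAddCommGroup E] {f : ℝ → E} {T : ℝ}
    (hT : 0 < T) (hf : Continuous f) (hp : Function.Periodic f T) : ∃ M, ∀ t, ‖f t‖ ≤ M := by
  obtain ⟨a, _, hmax⟩ := isCompact_Icc.exists_isMaxOn
    (Set.nonempty_Icc.2 hT.le) hf.norm.continuousOn
  refine ⟨‖f a‖, fun t => ?_⟩
  obtain ⟨s, hs, e⟩ := hp.exists_mem_Ico₀ hT t
  rw [e]
  exact hmax (Set.Ico_subset_Icc_self hs)

theorem norm_exp_mul_I_sub_le (x y : ℝ) : ‖exp (x * I) - exp (y * I)‖ ≤ |x - y| := by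
  have h : exp (x * I) - exp (y * I) = exp (y * I) * (exp (I * (x - y : ℝ)) - 1) := by
    rw [mul_sub, ← Complex.exp_add, mul_one]; push_cast; ring_nf
  rw [h, norm_mul, Complex.norm_exp_ofReal_mul_I, one_mul]
  exact Real.norm_exp_I_mul_ofReal_sub_one_le

theorem norm_exp_mul_I_sub_sub_le {x y : ℝ} (h : |x - y| ≤ 1) :
    ‖exp (x * I) - exp (y * I) - (x - y : ℝ) * I‖ ≤ |x - y| * (|x - y| + |y|) := by
  have e : exp (x * I) - exp (y * I) - (x - y : ℝ) * I =
      exp (y * I) * (exp ((x - y : ℝ) * I) - 1 - (x - y : ℝ) * I) +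
        (x - y : ℝ) * I * (exp (y * I) - exp ((0 : ℝ) * I)) := by
    have : exp (y * I) * exp ((x - y : ℝ) * I) = exp (x * I) := by
      rw [← Complex.exp_add]; push_cast; ring_nf
    rw [mul_sub, mul_sub, this]
    simp
    ring
  have hn : ‖((x - y : ℝ) : ℂ) * I‖ = |x - y| := by
    rw [norm_mul, Complex.norm_I, mul_one, Complex.norm_real, Real.norm_eq_abs]
  rw [e]
  refine (norm_add_le _ _).trans ?_
  rw [norm_mul, norm_mul, Complex.norm_exp_ofReal_mul_I, one_mul, hn, mul_add]
  refine add_le_add ?_ (mul_le_mul_of_nonneg_left ?_ (abs_nonneg _))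
  · refine (Complex.norm_exp_sub_one_sub_id_le (by rw [hn]; exact h)).trans ?_
    rw [hn, sq]
  · simpa using norm_exp_mul_I_sub_le y 0

/-- The derivative of the closing defect `∫ e^{iα}` in the direction `a cos α + b sin α`,
divided by `i`. -/
noncomputable def closingMap (α : ℝ → ℝ) : ℂ →L[ℝ] ℂ :=
  Complex.reCLM.smulRight (∫ t in (0 : ℝ)..2 * π, Real.cos (α t) * exp (α t * I)) +
    Complex.imCLM.smulRight (∫ t in (0 : ℝ)..2 * π, Real.sin (α t) * exp (α t * I))

theorem closingMap_apply {α : ℝ → ℝ} (hα : Continuous α) (z : ℂ) :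
    closingMap α z = ∫ t in (0 : ℝ)..2 * π,
      ((z.re * Real.cos (α t) + z.im * Real.sin (α t) : ℝ) : ℂ) * exp (α t * I) := by
  simp only [closingMap, add_apply, ContinuousLinearMap.smulRight_apply,
    Complex.reCLM_apply, Complex.imCLM_apply, Complex.real_smul]
  rw [← intervalIntegral.integral_const_mul, ← intervalIntegral.integral_const_mul,
    ← intervalIntegral.integral_add (Continuous.intervalIntegrable (by fun_prop) _ _)
      (Continuous.intervalIntegrable (by fun_prop) _ _)]
  refine intervalIntegral.integral_congr fun t _ => ?_
  push_cast
  ring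

/-- The map is the Gram matrix of `cos α` and `sin α`: pairing the image of `z` with `z` gives `∫
f²` for `f = re z cos α + im z sin α`. If `f` vanished with `z ≠ 0`, then `α` would be constant and
the curve not closed. -/
theorem closingMap_injective {α α' : ℝ → ℝ} {n : ℤ} (hα : ∀ t, HasDerivAt α (α' t) t)
    (hn : ∀ t, α (t + 2 * π) = α t + 2 * π * n)
    (hclosed : ∫ t in (0 : ℝ)..2 * π, exp (α t * I) = 0) :
    Function.Injective (closingMap α) := by
  have hc := continuous_of_forall_hasDerivAt hα
  rw [injective_iff_map_eq_zero]
  intro z hz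
  rw [closingMap_apply hc] at hz
  set f : ℝ → ℝ := fun t => z.re * Real.cos (α t) + z.im * Real.sin (α t) with hf
  have hfc : Continuous f := by fun_prop
  have hn' : ∀ t, α (t + 2 * π) = α t + n * (2 * π) := fun t => by rw [hn]; ring
  have h0 : ∫ t in (0 : ℝ)..2 * π, f t ^ 2 = 0 := by
    have h1 : (∫ t in (0 : ℝ)..2 * π, conj z * ((f t : ℂ) * exp (α t * I))).re = 0 := by
      rw [intervalIntegral.integral_const_mul]
      simp only [hf, hz, mul_zero, Complex.zero_re]
    rw [← Complex.reCLM_apply, ← ContinuousLinearMap.intervalIntegral_comp_comm _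
      (Continuous.intervalIntegrable (by fun_prop) _ _)] at h1
    refine Eq.trans (intervalIntegral.integral_congr fun t _ => ?_) h1
    simp [hf, Complex.exp_mul_I, Complex.cos_ofReal_re, Complex.sin_ofReal_re]
    ring
  have hfz : ∀ t, f t = 0 := by
    have hp : Function.Periodic f (2 * π) := fun t => by
      simp only [hf, hn', Real.cos_add_int_mul_two_pi, Real.sin_add_int_mul_two_pi]
    intro t
    obtain ⟨s, hs, e⟩ := hp.exists_mem_Ico₀ Real.two_pi_pos t
    rw [e]
    exact pow_eq_zero_iff two_ne_zero |>.1 (eq_zero_of_integral_nonpos Real.two_pi_pos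
      (hfc.pow 2).continuousOn (fun t _ => sq_nonneg _) h0.le s (Set.Ico_subset_Icc_self hs))
  by_contra hz0
  have hα' : ∀ t, α' t = 0 := by
    intro t
    have h1 : HasDerivAt f ((-(z.re * Real.sin (α t)) + z.im * Real.cos (α t)) * α' t) t := by
      refine (((hα t).cos.const_mul z.re).add ((hα t).sin.const_mul z.im)).congr_deriv ?_
      ring
    have h2 : f = fun _ => 0 := funext hfz
    rw [h2] at h1
    refine (mul_eq_zero.1 (h1.unique (hasDerivAt_const t 0))).resolve_left fun h3 => ?_
    have h4 := hfz t
    simp only [hf] at h4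
    have h5 := Real.sin_sq_add_cos_sq (α t)
    have h6 : z.re ^ 2 + z.im ^ 2 = 0 := by
      have h7 : z.re ^ 2 + z.im ^ 2 =
          (z.re * Real.cos (α t) + z.im * Real.sin (α t)) ^ 2 +
            (-(z.re * Real.sin (α t)) + z.im * Real.cos (α t)) ^ 2 := by
        linear_combination (-(z.re ^ 2 + z.im ^ 2)) * h5
      rw [h7, h4, h3]; norm_num
    exact hz0 (Complex.ext (by simp; nlinarith [sq_nonneg z.re, sq_nonneg z.im])
      (by simp; nlinarith [sq_nonneg z.re, sq_nonneg z.im]))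
  have hconst : ∀ t, α t = α 0 := fun t =>
    is_const_of_deriv_eq_zero (fun t => (hα t).differentiableAt)
      (fun t => (hα t).deriv.trans (hα' t)) t 0
  simp only [hconst, intervalIntegral.integral_const] at hclosed
  simp [Real.pi_ne_zero] at hclosed

theorem closingMap_isInvertible {α α' : ℝ → ℝ} {n : ℤ} (hα : ∀ t, HasDerivAt α (α' t) t)
    (hn : ∀ t, α (t + 2 * π) = α t + 2 * π * n)
    (hclosed : ∫ t in (0 : ℝ)..2 * π, exp (α t * I) = 0) : (closingMap α).IsInvertible :=
  ⟨(LinearEquiv.ofInjectiveEndo (closingMap α : ℂ →ₗ[ℝ] ℂ)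
    (closingMap_injective hα hn hclosed)).toContinuousLinearEquiv, by ext; rfl⟩

/-- The closing defect of the angle `α + s η + a cos α + b sin α`, as a function of `s` and
`a + b i`. -/
noncomputable def closingDefect (α η : ℝ → ℝ) (p : ℝ × ℂ) : ℂ :=
  ∫ t in (0 : ℝ)..2 * π,
    exp ((α t + (p.1 * η t + (p.2.re * Real.cos (α t) + p.2.im * Real.sin (α t))) : ℝ) * I)

/-- The admissibility of `η` removes the derivative in `s`, leaving only the correction directions.
The strict form is what the implicit function theorem needs. -/
theorem hasStrictFDerivAt_closingDefect {α η : ℝ → ℝ} (hα : Continuous α) (hη : Continuous η)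
    (hadm : ∫ t in (0 : ℝ)..2 * π, (η t : ℂ) * exp (α t * I) = 0) :
    HasStrictFDerivAt (closingDefect α η)
      ((I • closingMap α) ∘L ContinuousLinearMap.snd ℝ ℝ ℂ) 0 := by
  obtain ⟨M₀, hM₀⟩ := isCompact_Icc.exists_bound_of_continuousOn (s := Set.Icc 0 (2 * π))
    hη.continuousOn
  set X : ℝ × ℂ → ℝ → ℝ := fun p t =>
    p.1 * η t + (p.2.re * Real.cos (α t) + p.2.im * Real.sin (α t)) with hX
  have hXc : ∀ p, Continuous (X p) := fun p => by fun_prop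
  have hXsub : ∀ p q t, X (p - q) t = X p t - X q t := fun p q t => by
    simp [hX]; ring
  set M := |M₀| + 2 with hM
  have hMpos : 0 < M := by positivity
  have hXle : ∀ p, ∀ t ∈ Set.Icc 0 (2 * π), |X p t| ≤ M * ‖p‖ := by
    intro p t ht
    have h1 : |p.1 * η t| ≤ ‖p‖ * |M₀| := by
      rw [abs_mul]
      exact mul_le_mul (norm_fst_le p) ((hM₀ t ht).trans (le_abs_self _)) (abs_nonneg _)
        (norm_nonneg _)
    have h2 : |p.2.re * Real.cos (α t)| ≤ ‖p‖ * 1 := by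
      rw [abs_mul]
      exact mul_le_mul ((Complex.abs_re_le_norm _).trans (norm_snd_le p)) (Real.abs_cos_le_one _)
        (abs_nonneg _) (norm_nonneg _)
    have h3 : |p.2.im * Real.sin (α t)| ≤ ‖p‖ * 1 := by
      rw [abs_mul]
      exact mul_le_mul ((Complex.abs_im_le_norm _).trans (norm_snd_le p)) (Real.abs_sin_le_one _)
        (abs_nonneg _) (norm_nonneg _)
    calc |X p t| ≤ |p.1 * η t| + (|p.2.re * Real.cos (α t)| + |p.2.im * Real.sin (α t)|) :=
        (abs_add_le _ _).trans (add_le_add_right (abs_add_le _ _) _)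
      _ ≤ M * ‖p‖ := by rw [hM]; linarith
  have hL : ∀ p : ℝ × ℂ, ((I • closingMap α) ∘L ContinuousLinearMap.snd ℝ ℝ ℂ) p =
      ∫ t in (0 : ℝ)..2 * π, exp (α t * I) * (X p t * I) := by
    intro p
    have h1 : ∀ t, exp (α t * I) * (X p t * I) = (p.1 * I) * ((η t : ℂ) * exp (α t * I)) +
        I * (((p.2.re * Real.cos (α t) + p.2.im * Real.sin (α t) : ℝ) : ℂ) * exp (α t * I)) :=
      fun t => by simp only [hX]; push_cast; ring
    simp only [h1]
    rw [intervalIntegral.integral_add (Continuous.intervalIntegrable (by fun_prop) _ _)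
      (Continuous.intervalIntegrable (by fun_prop) _ _), intervalIntegral.integral_const_mul,
      intervalIntegral.integral_const_mul, hadm, mul_zero, zero_add, ← closingMap_apply hα]
    simp
  rw [hasStrictFDerivAt_iff_isLittleO, Asymptotics.isLittleO_iff]
  intro c hc
  -- The first bound keeps angle differences below `1`, as the exponential estimate requires; the
  -- second makes the integrated error at most `c ‖p - q‖`.
  set δ := min (1 / (2 * M)) (c / (2 * π * M * (3 * M))) with hδ
  have hδ0 : 0 < δ := by positivity
  have hnhds : ∀ᶠ p : (ℝ × ℂ) × (ℝ × ℂ) in 𝓝 (0, 0), ‖p.1‖ < δ ∧ ‖p.2‖ < δ := by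
    have h1 : ∀ᶠ p : ℝ × ℂ in 𝓝 0, ‖p‖ < δ := by
      filter_upwards [Metric.ball_mem_nhds (0 : ℝ × ℂ) hδ0] with p hp
      simpa using hp
    rw [nhds_prod_eq]
    exact h1.prod_mk h1
  filter_upwards [hnhds] with ⟨p, q⟩ ⟨hp, hq⟩
  simp only at hp hq ⊢
  have hpq : ‖p - q‖ ≤ 2 * δ := (norm_sub_le p q).trans (by linarith)
  have hδ1 : M * (2 * δ) ≤ 1 := by
    have : δ ≤ 1 / (2 * M) := min_le_left _ _
    rw [le_div_iff₀ (by positivity)] at this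
    linarith
  have hδ2 : 2 * π * M * (3 * M) * δ ≤ c := by
    have : δ ≤ c / (2 * π * M * (3 * M)) := min_le_right _ _
    rw [le_div_iff₀ (by positivity)] at this
    linarith
  rw [hL]
  simp only [closingDefect]
  rw [← intervalIntegral.integral_sub (Continuous.intervalIntegrable (by fun_prop) _ _)
      (Continuous.intervalIntegrable (by fun_prop) _ _),
    ← intervalIntegral.integral_sub (Continuous.intervalIntegrable (by fun_prop) _ _)
      (Continuous.intervalIntegrable (by have := hXc (p - q); fun_prop) _ _)]
  refine (intervalIntegral.norm_integral_le_of_norm_le_const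
    (C := M * ‖p - q‖ * (3 * M * δ)) fun t ht => ?_).trans ?_
  · rw [Set.uIoc_of_le Real.two_pi_pos.le] at ht
    have ht' := Set.Ioc_subset_Icc_self ht
    have e : exp ((α t + X p t : ℝ) * I) - exp ((α t + X q t : ℝ) * I) -
        exp (α t * I) * (X (p - q) t * I) =
        exp (α t * I) * (exp (X p t * I) - exp (X q t * I) - (X p t - X q t : ℝ) * I) := by
      rw [hXsub]
      push_cast
      rw [add_mul, add_mul, Complex.exp_add, Complex.exp_add]
      ring
    rw [e, norm_mul, Complex.norm_exp_ofReal_mul_I, one_mul]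
    have h1 := hXle (p - q) t ht'
    rw [hXsub] at h1
    have h2 : |X p t - X q t| ≤ M * (2 * δ) :=
      h1.trans (mul_le_mul_of_nonneg_left hpq hMpos.le)
    have h3 : |X q t| ≤ M * δ := (hXle q t ht').trans (mul_le_mul_of_nonneg_left hq.le hMpos.le)
    refine (norm_exp_mul_I_sub_sub_le (h2.trans hδ1)).trans ?_
    exact mul_le_mul h1 (by linarith) (by positivity) (by positivity)
  · rw [sub_zero, abs_of_pos Real.two_pi_pos]
    calc M * ‖p - q‖ * (3 * M * δ) * (2 * π) = 2 * π * M * (3 * M) * δ * ‖p - q‖ := by ring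
      _ ≤ c * ‖p - q‖ := mul_le_mul_of_nonneg_right hδ2 (norm_nonneg _)

/-- An infinitesimally admissible variation `η` of the angle of a closed curve is tangent to a
family of angles of closed curves. -/
theorem exists_admissible_family {α α' η : ℝ → ℝ} {n : ℤ} (hα : ∀ t, HasDerivAt α (α' t) t)
    (hn : ∀ t, α (t + 2 * π) = α t + 2 * π * n)
    (hclosed : ∫ t in (0 : ℝ)..2 * π, exp (α t * I) = 0) (hη : Continuous η)
    (hadm : ∫ t in (0 : ℝ)..2 * π, (η t : ℂ) * exp (α t * I) = 0) :
    ∃ x y : ℝ → ℝ, Filter.Tendsto x (𝓝[≠] 0) (𝓝 0) ∧ Filter.Tendsto y (𝓝[≠] 0) (𝓝 0) ∧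
      ∀ᶠ s in 𝓝[≠] (0 : ℝ), ∫ t in (0 : ℝ)..2 * π,
        exp ((α t + s * (η t + (x s * Real.cos (α t) + y s * Real.sin (α t))) : ℝ) * I) = 0 := by
  have hc := continuous_of_forall_hasDerivAt hα
  have hD := hasStrictFDerivAt_closingDefect hc hη hadm
  set L : ℝ × ℂ →L[ℝ] ℂ := (I • closingMap α) ∘L ContinuousLinearMap.snd ℝ ℝ ℂ with hL
  have hinr : (L ∘L .inr ℝ ℝ ℂ).IsInvertible := by
    refine ⟨(LinearEquiv.ofInjectiveEndo ((I • closingMap α : ℂ →L[ℝ] ℂ) : ℂ →ₗ[ℝ] ℂ)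
      ?_).toContinuousLinearEquiv, by ext; rfl⟩
    intro z w hzw
    have h1 : I * closingMap α z = I * closingMap α w := hzw
    exact closingMap_injective hα hn hclosed (mul_left_cancel₀ Complex.I_ne_zero h1)
  set ψ := hD.implicitFunctionOfProdDomain hinr with hψ
  have hψd : HasDerivAt ψ 0 0 := by
    have h1 := (hD.hasStrictFDerivAt_implicitFunctionOfProdDomain hinr).hasFDerivAt
    have h2 : L ∘L .inl ℝ ℝ ℂ = 0 := by ext; simp [hL]
    rw [h2, ContinuousLinearMap.comp_zero] at h1
    simpa using h1.hasDerivAt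
  have hψ0 : ψ 0 = 0 :=
    (hD.eventually_apply_eq_iff_implicitFunctionOfProdDomain hinr).self_of_nhds.1 rfl
  have hψe := hD.eventually_apply_implicitFunctionOfProdDomain hinr
  -- The implicit correction `ψ` has derivative zero at the origin. After a factor `s` is taken out,
  -- the coefficients `x`, `y` still tend to zero.
  have hlim : Filter.Tendsto (fun s => ψ s / s) (𝓝[≠] 0) (𝓝 0) := by
    refine (hasDerivAt_iff_tendsto_slope.1 hψd).congr fun s => ?_
    rw [slope_def_module, hψ0, sub_zero, sub_zero, Complex.real_smul]
    push_cast
    rw [div_eq_inv_mul]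
  refine ⟨fun s => (ψ s / s).re, fun s => (ψ s / s).im,
    (Complex.continuous_re.tendsto 0).comp hlim, (Complex.continuous_im.tendsto 0).comp hlim, ?_⟩
  have h0 : closingDefect α η 0 = 0 := by simpa [closingDefect] using hclosed
  filter_upwards [hψe.filter_mono nhdsWithin_le_nhds, self_mem_nhdsWithin] with s hs hs0
  rw [h0] at hs
  rw [← hs]
  simp only [closingDefect]
  refine intervalIntegral.integral_congr fun t _ => ?_
  have hs0' : s ≠ 0 := hs0
  simp only [Complex.div_ofReal_re, Complex.div_ofReal_im]
  congr 3
  field_simp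
  simp only [hψ]
  ring

/-! ### First and second variation at a local minimum -/

theorem integral_deriv_mul_eq_neg {f f' g g' : ℝ → ℝ} {T : ℝ} (hf : ∀ t, HasDerivAt f (f' t) t)
    (hg : ∀ t, HasDerivAt g (g' t) t) (hf' : Continuous f') (hg' : Continuous g')
    (hfp : f T = f 0) (hgp : g T = g 0) :
    ∫ t in (0 : ℝ)..T, f t * g' t = -∫ t in (0 : ℝ)..T, f' t * g t := by
  rw [intervalIntegral.integral_mul_deriv_eq_deriv_mul (fun t _ => hf t) (fun t _ => hg t)
    (hf'.intervalIntegrable _ _) (hg'.intervalIntegrable _ _), hfp, hgp]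
  ring

/-- The tangent angle of a closed curve of index `n`, up to a rotation by `θ`. -/
structure IsClosedAngle (n : ℤ) (θ : ℝ) (N : ℝ → ℂ) (α α' : ℝ → ℝ) : Prop where
  hasDerivAt : ∀ t, HasDerivAt α (α' t) t
  continuous' : Continuous α'
  deriv_eq : ∀ t, deriv N t = exp ((α t + θ : ℝ) * I)
  add_two_pi : ∀ t, α (t + 2 * π) = α t + 2 * π * n
  isArcLengthCurve : IsArcLengthCurve N

namespace IsClosedAngle

variable {n : ℤ} {θ : ℝ} {N : ℝ → ℂ} {α α' η η' : ℝ → ℝ}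

theorem continuous (h : IsClosedAngle n θ N α α') : Continuous α :=
  continuous_of_forall_hasDerivAt h.hasDerivAt

theorem periodic' (h : IsClosedAngle n θ N α α') : Function.Periodic α' (2 * π) := by
  intro t
  have h1 := (h.hasDerivAt (t + 2 * π)).comp_add_const t (2 * π)
  rw [show (fun x => α (x + 2 * π)) = fun x => α x + 2 * π * n from funext h.add_two_pi] at h1
  exact h1.unique ((h.hasDerivAt t).add_const _)

theorem integral_exp (h : IsClosedAngle n θ N α α') :
    ∫ t in (0 : ℝ)..2 * π, exp (α t * I) = 0 := by
  have hcl := h.isArcLengthCurve.integral_exp_angle h.deriv_eq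
  have e : ∀ t, exp ((α t + θ : ℝ) * I) = exp (α t * I) * exp (θ * I) := fun t => by
    rw [← Complex.exp_add]; push_cast; ring_nf
  simp only [e, intervalIntegral.integral_mul_const] at hcl
  exact (mul_eq_zero.1 hcl).resolve_right (Complex.exp_ne_zero _)

theorem periodic_cos (h : IsClosedAngle n θ N α α') :
    Function.Periodic (fun t => Real.cos (α t)) (2 * π) := fun t => by
  simp only [h.add_two_pi, mul_comm (2 * π), Real.cos_add_int_mul_two_pi]

theorem periodic_sin (h : IsClosedAngle n θ N α α') :
    Function.Periodic (fun t => Real.sin (α t)) (2 * π) := fun t => by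
  simp only [h.add_two_pi, mul_comm (2 * π), Real.sin_add_int_mul_two_pi]

/-- A local minimum does not increase its energy under small variations of its angle through
angles of closed curves. -/
theorem exists_bound (h : IsClosedAngle n θ N α α') (hN : IsEulerLocalMin N) :
    ∃ δ > 0, ∀ ζ ζ' : ℝ → ℝ, (∀ t, HasDerivAt ζ (ζ' t) t) → Continuous ζ' →
      Function.Periodic ζ (2 * π) → ∫ t in (0 : ℝ)..2 * π, exp ((α t + ζ t : ℝ) * I) = 0 →
      (∀ t, |ζ t| ≤ δ) → (∀ t, |ζ' t| ≤ δ) →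
      0 ≤ ∫ t in (0 : ℝ)..2 * π, (2 * α' t * ζ' t + ζ' t ^ 2) := by
  obtain ⟨-, ε, hε, hmin⟩ := hN
  have hNc := h.isArcLengthCurve
  have hα'c := h.continuous'
  obtain ⟨A, hA⟩ := exists_norm_le_of_periodic Real.two_pi_pos h.continuous' h.periodic'
  have hA0 : 0 ≤ A := (norm_nonneg _).trans (hA 0)
  -- A change of at most `δ` in the angle and its derivative moves the curve by at most `2πδ`, its
  -- tangent by `δ` and its second derivative by `(A + 1) δ`, where `A` bounds `|α'|`.
  refine ⟨ε / (2 * (2 * π + 2 + A)), by positivity, fun ζ ζ' hζ hζ' hp hcl hb hb' => ?_⟩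
  set δ := ε / (2 * (2 * π + 2 + A)) with hδ
  have hδ0 : 0 ≤ δ := by positivity
  have hδε : δ * (2 * π + 2 + A) < ε := by
    rw [hδ]
    have : ε / (2 * (2 * π + 2 + A)) * (2 * π + 2 + A) = ε / 2 := by
      field_simp
    linarith
  have hζc := continuous_of_forall_hasDerivAt hζ
  have hαc := h.continuous
  set β : ℝ → ℝ := fun t => α t + θ + ζ t with hβ
  have hβd : ∀ t, HasDerivAt β (α' t + ζ' t) t := fun t =>
    ((h.hasDerivAt t).add_const θ).add (hζ t)
  have hβc : Continuous β := by fun_prop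
  have hβcl : ∫ t in (0 : ℝ)..2 * π, exp (β t * I) = 0 := by
    have e : ∀ t, exp (β t * I) = exp ((α t + ζ t : ℝ) * I) * exp (θ * I) := fun t => by
      rw [← Complex.exp_add]; simp only [hβ]; push_cast; ring_nf
    simp only [e, intervalIntegral.integral_mul_const, hcl, zero_mul]
  have hγ : IsArcLengthCurve (curveOfAngle (N 0) β) :=
    isArcLengthCurve_curveOfAngle (n := n) hβd (by fun_prop)
      (fun t => by simp only [hβ, h.add_two_pi, hp t]; ring) hβcl
  have hγd : ∀ t, deriv (curveOfAngle (N 0) β) t = exp (β t * I) := fun t =>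
    (hasDerivAt_curveOfAngle hβc t).deriv
  have hαθ : ∀ t, HasDerivAt (fun t => α t + θ) (α' t) t := fun t => (h.hasDerivAt t).add_const θ
  have hdist : ∀ t, ‖exp (β t * I) - exp ((α t + θ : ℝ) * I)‖ ≤ δ := fun t => by
    refine (norm_exp_mul_I_sub_le _ _).trans ?_
    simpa [hβ] using hb t
  have hclose : ∀ j ≤ 2, ∀ t,
      ‖iteratedDeriv j (curveOfAngle (N 0) β) t - iteratedDeriv j N t‖ < ε := by
    intro j hj t
    interval_cases j
    · simp only [iteratedDeriv_zero]
      have hpp : Function.Periodic (fun t => curveOfAngle (N 0) β t - N t) (2 * π) := fun t => by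
        simp only [hγ.periodic t, hNc.periodic t]
      obtain ⟨s, hs, e⟩ := hpp.exists_mem_Ico₀ Real.two_pi_pos t
      rw [e]
      have h1 : curveOfAngle (N 0) β s - N s =
          ∫ t in (0 : ℝ)..s, (exp (β t * I) - exp ((α t + θ : ℝ) * I)) := by
        rw [intervalIntegral.integral_sub (Continuous.intervalIntegrable (by fun_prop) _ _)
          (Continuous.intervalIntegrable (by fun_prop) _ _)]
        have h2 : ∫ t in (0 : ℝ)..s, exp ((α t + θ : ℝ) * I) = N s - N 0 := by
          refine intervalIntegral.integral_eq_sub_of_hasDerivAt (fun t _ => ?_)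
            (Continuous.intervalIntegrable (by fun_prop) _ _)
          rw [← h.deriv_eq]
          exact hNc.hasDerivAt t
        rw [h2]
        simp only [curveOfAngle]
        ring
      rw [h1]
      have h3 := intervalIntegral.norm_integral_le_of_norm_le_const (a := 0) (b := s) (C := δ)
        (f := fun t => exp (β t * I) - exp ((α t + θ : ℝ) * I)) fun t _ => hdist t
      rw [sub_zero, abs_of_nonneg hs.1] at h3
      nlinarith [hs.2]
    · simp only [iteratedDeriv_one, hγd, h.deriv_eq]
      have := hdist t
      nlinarith [Real.pi_pos]
    · simp only [iteratedDeriv_succ, iteratedDeriv_zero]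
      rw [funext hγd, funext h.deriv_eq, (hasDerivAt_exp_mul_I (hβd t)).deriv,
        (hasDerivAt_exp_mul_I (hαθ t)).deriv]
      have e : exp (β t * I) * ((α' t + ζ' t : ℝ) * I) - exp ((α t + θ : ℝ) * I) * (α' t * I) =
          (exp (β t * I) - exp ((α t + θ : ℝ) * I)) * (α' t * I) +
            exp (β t * I) * (ζ' t * I) := by
        push_cast; ring
      rw [e]
      refine (norm_add_le _ _).trans_lt ?_
      simp only [norm_mul, Complex.norm_exp_ofReal_mul_I, Complex.norm_I, Complex.norm_real,
        mul_one, one_mul]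
      have h1 : ‖exp (β t * I) - exp ((α t + θ : ℝ) * I)‖ * ‖α' t‖ ≤ δ * A :=
        mul_le_mul (hdist t) (hA t) (norm_nonneg _) hδ0
      have h2 : ‖ζ' t‖ ≤ δ := hb' t
      nlinarith [Real.pi_pos]
  have hle := hmin _ hγ hclose
  rw [eulerFunctional_eq hαθ h.deriv_eq, eulerFunctional_eq hβd hγd] at hle
  have e : ∀ t, (α' t + ζ' t) ^ 2 = α' t ^ 2 + (2 * α' t * ζ' t + ζ' t ^ 2) := fun t => by ring
  simp only [e] at hle
  rw [intervalIntegral.integral_add (Continuous.intervalIntegrable (by fun_prop) _ _)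
    (Continuous.intervalIntegrable (by fun_prop) _ _)] at hle
  linarith

/-- Small admissible variations at a local minimum do not decrease the energy. -/
theorem exists_family (h : IsClosedAngle n θ N α α') (hN : IsEulerLocalMin N)
    (hη : ∀ t, HasDerivAt η (η' t) t) (hη' : Continuous η') (hp : Function.Periodic η (2 * π))
    (hadm : ∫ t in (0 : ℝ)..2 * π, (η t : ℂ) * exp (α t * I) = 0) :
    ∃ x y : ℝ → ℝ, Filter.Tendsto x (𝓝[≠] 0) (𝓝 0) ∧ Filter.Tendsto y (𝓝[≠] 0) (𝓝 0) ∧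
      ∀ᶠ s in 𝓝[≠] (0 : ℝ), (∫ t in (0 : ℝ)..2 * π,
        exp ((α t + s * (η t + (x s * Real.cos (α t) + y s * Real.sin (α t))) : ℝ) * I) = 0) ∧
      0 ≤ ∫ t in (0 : ℝ)..2 * π,
        (2 * α' t * (s * (η' t + (-(x s * Real.sin (α t)) + y s * Real.cos (α t)) * α' t)) +
          (s * (η' t + (-(x s * Real.sin (α t)) + y s * Real.cos (α t)) * α' t)) ^ 2) := by
  obtain ⟨δ, hδ, hbound⟩ := h.exists_bound hN
  have hηc := continuous_of_forall_hasDerivAt hη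
  have hαc := h.continuous
  have hα'c := h.continuous'
  obtain ⟨x, y, hx, hy, hs⟩ :=
    exists_admissible_family h.hasDerivAt h.add_two_pi h.integral_exp hηc hadm
  have hηp' : Function.Periodic η' (2 * π) := by
    have : deriv η = η' := funext fun t => (hη t).deriv
    exact this ▸ hp.deriv
  obtain ⟨A, hA⟩ := exists_norm_le_of_periodic Real.two_pi_pos h.continuous' h.periodic'
  obtain ⟨B, hB⟩ := exists_norm_le_of_periodic Real.two_pi_pos hηc hp
  obtain ⟨B', hB'⟩ := exists_norm_le_of_periodic Real.two_pi_pos hη' hηp'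
  simp only [Real.norm_eq_abs] at hA hB hB'
  have hA0 : 0 ≤ A := (abs_nonneg _).trans (hA 0)
  have hB0 : 0 ≤ B := (abs_nonneg _).trans (hB 0)
  have hB0' : 0 ≤ B' := (abs_nonneg _).trans (hB' 0)
  refine ⟨x, y, hx, hy, ?_⟩
  have hx1 : ∀ᶠ s in 𝓝[≠] (0 : ℝ), |x s| < 1 := by
    filter_upwards [hx (Metric.ball_mem_nhds 0 one_pos)] with s hs
    simpa using hs
  have hy1 : ∀ᶠ s in 𝓝[≠] (0 : ℝ), |y s| < 1 := by
    filter_upwards [hy (Metric.ball_mem_nhds 0 one_pos)] with s hs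
    simpa using hs
  set M := B + B' + 2 + 2 * A with hM
  have hM0 : 0 < M := by positivity
  have hs1 : ∀ᶠ s in 𝓝[≠] (0 : ℝ), |s| < δ / M := by
    filter_upwards [nhdsWithin_le_nhds (Metric.ball_mem_nhds 0 (by positivity : 0 < δ / M))]
      with s hs
    simpa using hs
  filter_upwards [hs, hx1, hy1, hs1] with s hs hx1 hy1 hs1
  refine ⟨hs, hbound _ _ (fun t => ?_) ?_ (fun t => ?_) hs (fun t => ?_) fun t => ?_⟩
  · refine ((hη t).add (((h.hasDerivAt t).cos.const_mul (x s)).add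
      ((h.hasDerivAt t).sin.const_mul (y s)))).const_mul s |>.congr_deriv ?_
    ring
  · fun_prop
  · simp only [hp t, h.periodic_cos t, h.periodic_sin t]
  all_goals
    have hcx : |x s * Real.cos (α t)| ≤ 1 := by
      rw [abs_mul]; exact mul_le_one₀ hx1.le (abs_nonneg _) (Real.abs_cos_le_one _)
    have hsy : |y s * Real.sin (α t)| ≤ 1 := by
      rw [abs_mul]; exact mul_le_one₀ hy1.le (abs_nonneg _) (Real.abs_sin_le_one _)
    have hsx : |x s * Real.sin (α t)| ≤ 1 := by
      rw [abs_mul]; exact mul_le_one₀ hx1.le (abs_nonneg _) (Real.abs_sin_le_one _)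
    have hcy : |y s * Real.cos (α t)| ≤ 1 := by
      rw [abs_mul]; exact mul_le_one₀ hy1.le (abs_nonneg _) (Real.abs_cos_le_one _)
    rw [abs_mul]
    have hsM : |s| * M ≤ δ := by
      rw [lt_div_iff₀ hM0] at hs1
      exact hs1.le
    refine (mul_le_mul_of_nonneg_left ?_ (abs_nonneg s)).trans hsM
    refine (abs_add_le _ _).trans ?_
  · have := abs_add_le (x s * Real.cos (α t)) (y s * Real.sin (α t))
    linarith [hB t]
  · have h1 := abs_add_le (-(x s * Real.sin (α t))) (y s * Real.cos (α t))
    rw [abs_neg] at h1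
    have h2 : |(-(x s * Real.sin (α t)) + y s * Real.cos (α t)) * α' t| ≤ 2 * A := by
      rw [abs_mul]
      exact mul_le_mul (by linarith) (hA t) (abs_nonneg _) (by norm_num)
    linarith [hB' t]

/-- The energy increment is `s P` with `P` continuous in `s` and in the vanishing corrections. Its
sign for `s > 0` and for `s < 0` forces the limit of `P` to be zero. -/
theorem first_variation (h : IsClosedAngle n θ N α α') (hN : IsEulerLocalMin N)
    (hη : ∀ t, HasDerivAt η (η' t) t) (hη' : Continuous η') (hp : Function.Periodic η (2 * π))
    (hadm : ∫ t in (0 : ℝ)..2 * π, (η t : ℂ) * exp (α t * I) = 0) :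
    ∫ t in (0 : ℝ)..2 * π, α' t * η' t = 0 := by
  obtain ⟨x, y, hx, hy, hs⟩ := h.exists_family hN hη hη' hp hadm
  have hαc := h.continuous
  have hα'c := h.continuous'
  set ξ : ℝ × ℝ × ℝ → ℝ → ℝ := fun q t =>
    η' t + (-(q.2.1 * Real.sin (α t)) + q.2.2 * Real.cos (α t)) * α' t with hξ
  set P : ℝ × ℝ × ℝ → ℝ := fun q =>
    ∫ t in (0 : ℝ)..2 * π, (2 * α' t * ξ q t + q.1 * ξ q t ^ 2) with hP
  have hPc : Continuous P :=
    intervalIntegral.continuous_parametric_intervalIntegral_of_continuous'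
      (f := fun q t => 2 * α' t * ξ q t + q.1 * ξ q t ^ 2)
      (by unfold Function.uncurry; fun_prop) _ _
  have hlim : Filter.Tendsto (fun s => P (s, x s, y s)) (𝓝[≠] 0) (𝓝 (P (0, 0, 0))) :=
    (hPc.tendsto _).comp ((Filter.tendsto_id.mono_left nhdsWithin_le_nhds).prodMk_nhds
      (hx.prodMk_nhds hy))
  have hsP : ∀ᶠ s in 𝓝[≠] (0 : ℝ), 0 ≤ s * P (s, x s, y s) := by
    filter_upwards [hs] with s hs
    refine hs.2.trans_eq ?_
    simp only [hP, hξ]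
    rw [← intervalIntegral.integral_const_mul]
    refine intervalIntegral.integral_congr fun t _ => ?_
    ring
  have h1 : 0 ≤ P (0, 0, 0) := by
    refine ge_of_tendsto (hlim.mono_left (nhdsGT_le_nhdsNE 0)) ?_
    filter_upwards [hsP.filter_mono (nhdsGT_le_nhdsNE 0),
      self_mem_nhdsWithin] with s hs hs0
    exact nonneg_of_mul_nonneg_right hs hs0
  have h2 : P (0, 0, 0) ≤ 0 := by
    refine le_of_tendsto (hlim.mono_left (nhdsLT_le_nhdsNE 0)) ?_
    filter_upwards [hsP.filter_mono (nhdsLT_le_nhdsNE 0),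
      self_mem_nhdsWithin] with s hs hs0
    exact nonpos_of_mul_nonneg_right hs hs0
  have h3 : P (0, 0, 0) = 2 * ∫ t in (0 : ℝ)..2 * π, α' t * η' t := by
    rw [← intervalIntegral.integral_const_mul]
    simp only [hP, hξ]
    refine intervalIntegral.integral_congr fun t _ => ?_
    ring
  linarith

/-- The Euler-Lagrange equation of a local minimum. -/
theorem exists_hasDerivAt' (h : IsClosedAngle n θ N α α') (hN : IsEulerLocalMin N) :
    ∃ p q : ℝ, ∀ t, HasDerivAt α' (-(p * Real.cos (α t) + q * Real.sin (α t))) t := by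
  have hαc := h.continuous
  have hα'c := h.continuous'
  obtain ⟨e, he⟩ := closingMap_isInvertible h.hasDerivAt h.add_two_pi h.integral_exp
  set P := ∫ t in (0 : ℝ)..2 * π, α' t * (-Real.sin (α t) * α' t) with hP
  set Q := ∫ t in (0 : ℝ)..2 * π, α' t * (Real.cos (α t) * α' t) with hQ
  -- For a defect `w`, the functional `ℓ` is the first variation in the combination of `cos α` and
  -- `sin α` producing that defect. Subtracting this combination makes any `η` admissible, so `ℓ 1`
  -- and `ℓ I` are the Lagrange multipliers.
  set ℓ : ℂ →ₗ[ℝ] ℝ :=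
    (P • Complex.reLm + Q • Complex.imLm) ∘ₗ (e.symm.toLinearEquiv : ℂ →ₗ[ℝ] ℂ) with hℓ
  have hvar : ∀ η η' : ℝ → ℝ, (∀ t, HasDerivAt η (η' t) t) → Continuous η' →
      Function.Periodic η (2 * π) → ∫ t in (0 : ℝ)..2 * π, α' t * η' t =
        ∫ t in (0 : ℝ)..2 * π, (ℓ 1 * Real.cos (α t) + ℓ I * Real.sin (α t)) * η t := by
    intro η η' hη hη' hp
    have hηc := continuous_of_forall_hasDerivAt hη
    set w := ∫ t in (0 : ℝ)..2 * π, (η t : ℂ) * exp (α t * I) with hw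
    set z := e.symm w with hz
    have hez : closingMap α z = w := by
      rw [← he]; exact e.apply_symm_apply w
    have hadm : ∫ t in (0 : ℝ)..2 * π, ((η t -
        (z.re * Real.cos (α t) + z.im * Real.sin (α t)) : ℝ) : ℂ) * exp (α t * I) = 0 := by
      have h1 := hez
      rw [closingMap_apply hαc] at h1
      simp only [Complex.ofReal_sub, sub_mul]
      rw [intervalIntegral.integral_sub (Continuous.intervalIntegrable (by fun_prop) _ _)
        (Continuous.intervalIntegrable (by fun_prop) _ _), h1, sub_self]
    have h1 := h.first_variation hN
      (η := fun t => η t - (z.re * Real.cos (α t) + z.im * Real.sin (α t))) (η' := fun t => η' t - (z.re * (-Real.sin (α t) * α' t) +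
        z.im * (Real.cos (α t) * α' t)))
      (fun t => (hη t).sub (((h.hasDerivAt t).cos.const_mul z.re).add
        ((h.hasDerivAt t).sin.const_mul z.im))) (by fun_prop)
      (fun t => by
        have e1 := h.periodic_cos t
        have e2 := h.periodic_sin t
        simp only at e1 e2
        simp only [hp t, e1, e2]) hadm
    have h2 : ∀ t, α' t * (η' t - (z.re * (-Real.sin (α t) * α' t) +
        z.im * (Real.cos (α t) * α' t))) = α' t * η' t -
        (z.re * (α' t * (-Real.sin (α t) * α' t)) + z.im * (α' t * (Real.cos (α t) * α' t))) :=
      fun t => by ring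
    simp only [h2] at h1
    rw [intervalIntegral.integral_sub (Continuous.intervalIntegrable (by fun_prop) _ _)
        (Continuous.intervalIntegrable (by fun_prop) _ _),
      intervalIntegral.integral_add (Continuous.intervalIntegrable (by fun_prop) _ _)
        (Continuous.intervalIntegrable (by fun_prop) _ _),
      intervalIntegral.integral_const_mul, intervalIntegral.integral_const_mul, ← hP, ← hQ] at h1
    have h3 : ℓ w = P * z.re + Q * z.im := by simp [hℓ, hz]
    have h4 : ℓ w = w.re * ℓ 1 + w.im * ℓ I := by
      conv_lhs => rw [show w = w.re • (1 : ℂ) + w.im • I by simp [Complex.re_add_im]]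
      rw [map_add, map_smul, map_smul, smul_eq_mul, smul_eq_mul]
    have hre : w.re = ∫ t in (0 : ℝ)..2 * π, η t * Real.cos (α t) := by
      rw [hw, ← Complex.reCLM_apply, ← ContinuousLinearMap.intervalIntegral_comp_comm _
        (Continuous.intervalIntegrable (by fun_prop) _ _)]
      refine intervalIntegral.integral_congr fun t _ => ?_
      simp [Complex.exp_mul_I, Complex.cos_ofReal_re]
    have him : w.im = ∫ t in (0 : ℝ)..2 * π, η t * Real.sin (α t) := by
      rw [hw, ← Complex.imCLM_apply, ← ContinuousLinearMap.intervalIntegral_comp_comm _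
        (Continuous.intervalIntegrable (by fun_prop) _ _)]
      refine intervalIntegral.integral_congr fun t _ => ?_
      simp [Complex.exp_mul_I, Complex.sin_ofReal_re]
    have h5 : ∫ t in (0 : ℝ)..2 * π, (ℓ 1 * Real.cos (α t) + ℓ I * Real.sin (α t)) * η t =
        w.re * ℓ 1 + w.im * ℓ I := by
      rw [hre, him, ← intervalIntegral.integral_mul_const, ← intervalIntegral.integral_mul_const,
        ← intervalIntegral.integral_add (Continuous.intervalIntegrable (by fun_prop) _ _)
          (Continuous.intervalIntegrable (by fun_prop) _ _)]
      refine intervalIntegral.integral_congr fun t _ => ?_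
      ring
    rw [h5, ← h4, h3]
    linarith
  set g : ℝ → ℝ := fun t => ℓ 1 * Real.cos (α t) + ℓ I * Real.sin (α t) with hg
  have hgc : Continuous g := by fun_prop
  have hgp : Function.Periodic g (2 * π) := fun t => by
    have e1 := h.periodic_cos t
    have e2 := h.periodic_sin t
    simp only at e1 e2
    simp only [hg, e1, e2]
  have hg0 : ∫ t in (0 : ℝ)..2 * π, g t = 0 := by
    have := hvar (fun _ => 1) (fun _ => 0) (fun t => hasDerivAt_const t _) continuous_const
      (fun t => rfl)
    simpa using this.symm
  set G : ℝ → ℝ := fun t => ∫ s in (0 : ℝ)..t, g s with hG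
  have hGd : ∀ t, HasDerivAt G (g t) t := hasDerivAt_integral_zero hgc
  have hGc := continuous_of_forall_hasDerivAt hGd
  have hGp : Function.Periodic G (2 * π) := periodic_integral_of_integral_eq_zero hgc hgp hg0
  set m := (∫ t in (0 : ℝ)..2 * π, (α' t + G t)) / (2 * π) with hm
  -- The du Bois-Reymond argument: a periodic primitive of `κ` is used as test function, which gives
  -- `∫ κ² = 0` and thereby the extra regularity of `α'`.
  set κ : ℝ → ℝ := fun t => α' t + G t - m with hκ
  have hκc : Continuous κ := by fun_prop
  have hκp : Function.Periodic κ (2 * π) := fun t => by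
    simp only [hκ, h.periodic' t, hGp t]
  have hκ0 : ∫ t in (0 : ℝ)..2 * π, κ t = 0 := by
    simp only [hκ]
    rw [intervalIntegral.integral_sub (Continuous.intervalIntegrable (by fun_prop) _ _)
      (Continuous.intervalIntegrable (by fun_prop) _ _), intervalIntegral.integral_const,
      smul_eq_mul, sub_zero, hm, mul_div_cancel₀ _ Real.two_pi_pos.ne', sub_self]
  set K : ℝ → ℝ := fun t => ∫ s in (0 : ℝ)..t, κ s with hK
  have hKd : ∀ t, HasDerivAt K (κ t) t := hasDerivAt_integral_zero hκc
  have hKp : Function.Periodic K (2 * π) := periodic_integral_of_integral_eq_zero hκc hκp hκ0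
  have h1 := hvar K κ hKd hκc hKp
  have h2 := integral_deriv_mul_eq_neg hGd hKd hgc hκc (by simpa using hGp 0) (by simpa using hKp 0)
  have hKc := continuous_of_forall_hasDerivAt hKd
  have hsq : ∫ t in (0 : ℝ)..2 * π, κ t ^ 2 = 0 := by
    have e : ∀ t, κ t ^ 2 = α' t * κ t + (G t * κ t - m * κ t) := fun t => by
      simp only [hκ]; ring
    simp only [e]
    rw [intervalIntegral.integral_add (Continuous.intervalIntegrable (by fun_prop) _ _)
      (Continuous.intervalIntegrable (by fun_prop) _ _),
      intervalIntegral.integral_sub (Continuous.intervalIntegrable (by fun_prop) _ _)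
      (Continuous.intervalIntegrable (by fun_prop) _ _), intervalIntegral.integral_const_mul, hκ0,
      h1, h2]
    ring
  have hκz : ∀ t, κ t = 0 := by
    intro t
    obtain ⟨s, hs, e⟩ := hκp.exists_mem_Ico₀ Real.two_pi_pos t
    rw [e]
    exact pow_eq_zero_iff two_ne_zero |>.1 (eq_zero_of_integral_nonpos Real.two_pi_pos
      (hκc.pow 2).continuousOn (fun t _ => sq_nonneg _) hsq.le s (Set.Ico_subset_Icc_self hs))
  refine ⟨ℓ 1, ℓ I, fun t => ?_⟩
  have hα'eq : α' = fun t => m - G t := funext fun t => by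
    have := hκz t
    simp only [hκ] at this
    linarith
  rw [hα'eq]
  exact (hGd t).const_sub m

/-- The tangent angle of a local minimum solves, up to a rotation, the pendulum equation. -/
theorem exists_isPendulum (h : IsClosedAngle n θ N α α') (hN : IsEulerLocalMin N) :
    ∃ (ω ψ : ℝ), 0 ≤ ω ∧ IsClosedAngle n (θ + ψ) N (fun t => α t - ψ) α' ∧
      IsPendulum ω (fun t => α t - ψ) α' := by
  obtain ⟨p, q, hpq⟩ := h.exists_hasDerivAt' hN
  -- With this `z`, the right side of the Euler-Lagrange equation is `-‖z‖ sin (α - arg z)`.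
  set z : ℂ := q - p * I with hz
  have h1 : ‖z‖ * Real.cos z.arg = q := by rw [Complex.norm_mul_cos_arg]; simp [hz]
  have h2 : ‖z‖ * Real.sin z.arg = -p := by rw [Complex.norm_mul_sin_arg]; simp [hz]
  refine ⟨√‖z‖, z.arg, Real.sqrt_nonneg _, ⟨fun t => (h.hasDerivAt t).sub_const _, h.continuous',
    fun t => ?_, fun t => ?_, h.isArcLengthCurve⟩, fun t => (h.hasDerivAt t).sub_const _,
    fun t => (hpq t).congr_deriv ?_⟩
  · rw [h.deriv_eq]; congr 3; ring
  · rw [h.add_two_pi]; ring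
  · rw [Real.sq_sqrt (norm_nonneg _), Real.sin_sub, mul_sub]
    have h3 : ‖z‖ * (Real.sin (α t) * Real.cos z.arg) = Real.sin (α t) * q := by rw [← h1]; ring
    have h4 : ‖z‖ * (Real.cos (α t) * Real.sin z.arg) = Real.cos (α t) * -p := by
      rw [← h2]; ring
    rw [h3, h4]
    ring

end IsClosedAngle

theorem cos_add_sub_cos_le {a z : ℝ} (hz : |z| ≤ 1) :
    Real.cos (a + z) - Real.cos a + z * Real.sin a ≤ -(Real.cos a * z ^ 2 / 2) + |z| ^ 3 := by
  have h0 := abs_nonneg z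
  have h4 : |z| ^ 4 ≤ |z| ^ 3 := pow_le_pow_of_le_one h0 hz (by norm_num)
  have h3 : 0 ≤ |z| ^ 3 := by positivity
  have hc : |Real.cos z - (1 - z ^ 2 / 2)| ≤ |z| ^ 3 * (5 / 96) :=
    (Real.cos_bound hz).trans (mul_le_mul_of_nonneg_right h4 (by norm_num))
  have hs : |Real.sin z - z| ≤ |z| ^ 3 * (1 / 6 + 5 / 96) := by
    have h1 := Real.sin_bound hz
    have h2 : |z ^ 3 / 6| = |z| ^ 3 / 6 := by rw [abs_div, abs_pow]; norm_num
    have h5 : Real.sin z - z = (Real.sin z - (z - z ^ 3 / 6)) + -(z ^ 3 / 6) := by ring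
    rw [h5]
    refine (abs_add_le _ _).trans ?_
    rw [abs_neg, h2]
    have h5' : |z| ^ 5 ≤ |z| ^ 3 := pow_le_pow_of_le_one h0 hz (by norm_num)
    linarith
  have e : Real.cos (a + z) - Real.cos a + z * Real.sin a = -(Real.cos a * z ^ 2 / 2) +
      (Real.cos a * (Real.cos z - (1 - z ^ 2 / 2)) + -(Real.sin a * (Real.sin z - z))) := by
    rw [Real.cos_add]; ring
  rw [e]
  have h6 : |Real.cos a * (Real.cos z - (1 - z ^ 2 / 2))| ≤ 1 * (|z| ^ 3 * (5 / 96)) := by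
    rw [abs_mul]
    exact mul_le_mul (Real.abs_cos_le_one a) hc (abs_nonneg _) zero_le_one
  have h7 : |Real.sin a * (Real.sin z - z)| ≤ 1 * (|z| ^ 3 * (1 / 6 + 5 / 96)) := by
    rw [abs_mul]
    exact mul_le_mul (Real.abs_sin_le_one a) hs (abs_nonneg _) zero_le_one
  have h8 := le_abs_self (Real.cos a * (Real.cos z - (1 - z ^ 2 / 2)))
  have h9 := neg_le_abs (Real.sin a * (Real.sin z - z))
  linarith

namespace IsClosedAngle

variable {n : ℤ} {θ ω : ℝ} {N : ℝ → ℂ} {α α' η η' : ℝ → ℝ}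

theorem integral_cos (h : IsClosedAngle n θ N α α') :
    ∫ t in (0 : ℝ)..2 * π, Real.cos (α t) = 0 := by
  have h1 := h.integral_exp
  rw [integral_exp_mul_I h.continuous] at h1
  simpa using congrArg Complex.re h1

/-- Closedness gives `∫ cos (α + sξ) = ∫ cos α = 0`, so a multiple of the difference of cosines may
be added to the energy increment. By the pendulum equation the terms linear in `s` then cancel.
Dividing by `s²` leaves the quadratic form; the corrections need only tend to zero. -/
theorem second_variation (h : IsClosedAngle n θ N α α') (hP : IsPendulum ω α α')
    (hN : IsEulerLocalMin N) (hη : ∀ t, HasDerivAt η (η' t) t) (hη' : Continuous η')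
    (hp : Function.Periodic η (2 * π))
    (hadm : ∫ t in (0 : ℝ)..2 * π, (η t : ℂ) * exp (α t * I) = 0) :
    0 ≤ ∫ t in (0 : ℝ)..2 * π, (η' t ^ 2 - ω ^ 2 * Real.cos (α t) * η t ^ 2) := by
  obtain ⟨x, y, hx, hy, hs⟩ := h.exists_family hN hη hη' hp hadm
  have hαc := h.continuous
  have hα'c := h.continuous'
  have hηc := continuous_of_forall_hasDerivAt hη
  set ξ : ℝ × ℝ → ℝ → ℝ := fun q t =>
    η t + (q.1 * Real.cos (α t) + q.2 * Real.sin (α t)) with hξ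
  set ξ' : ℝ × ℝ → ℝ → ℝ := fun q t =>
    η' t + (-(q.1 * Real.sin (α t)) + q.2 * Real.cos (α t)) * α' t with hξ'
  have hξd : ∀ q t, HasDerivAt (ξ q) (ξ' q t) t := fun q t => by
    refine ((hη t).add (((h.hasDerivAt t).cos.const_mul q.1).add
      ((h.hasDerivAt t).sin.const_mul q.2))).congr_deriv ?_
    simp only [hξ']
    ring
  have hξc : ∀ q, Continuous (ξ q) := fun q => by fun_prop
  have hξc' : ∀ q, Continuous (ξ' q) := fun q => by fun_prop
  have hξp : ∀ q, ξ q (2 * π) = ξ q 0 := fun q => by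
    have e0 := hp 0
    have e1 := h.periodic_cos 0
    have e2 := h.periodic_sin 0
    simp only [zero_add] at e0 e1 e2
    simp only [hξ, e0, e1, e2]
  set B : ℝ × ℝ → ℝ := fun q =>
    ∫ t in (0 : ℝ)..2 * π, (ξ' q t ^ 2 - ω ^ 2 * Real.cos (α t) * ξ q t ^ 2) with hB
  have hBc : Continuous B :=
    intervalIntegral.continuous_parametric_intervalIntegral_of_continuous'
      (f := fun q t => ξ' q t ^ 2 - ω ^ 2 * Real.cos (α t) * ξ q t ^ 2)
      (by unfold Function.uncurry; fun_prop) _ _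
  have hB0 : B (0, 0) = ∫ t in (0 : ℝ)..2 * π, (η' t ^ 2 - ω ^ 2 * Real.cos (α t) * η t ^ 2) := by
    simp [hB, hξ, hξ']
  obtain ⟨M₀, hM₀⟩ := exists_norm_le_of_periodic Real.two_pi_pos hηc hp
  simp only [Real.norm_eq_abs] at hM₀
  have hM₀0 : 0 ≤ M₀ := (abs_nonneg _).trans (hM₀ 0)
  set M := M₀ + 2 with hM
  have hMpos : 0 < M := by positivity
  -- The extra term is the cubic Taylor remainder integrated over the period and divided by `s²`.
  have hlim : Filter.Tendsto (fun s => B (x s, y s) + 4 * π * ω ^ 2 * M ^ 3 * |s|) (𝓝[≠] 0)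
      (𝓝 (B (0, 0) + 4 * π * ω ^ 2 * M ^ 3 * |0|)) :=
    ((hBc.tendsto _).comp (hx.prodMk_nhds hy)).add
      ((continuous_abs.tendsto 0).mono_left nhdsWithin_le_nhds |>.const_mul _)
  rw [abs_zero, mul_zero, add_zero] at hlim
  rw [← hB0]
  refine ge_of_tendsto hlim ?_
  have hx1 : ∀ᶠ s in 𝓝[≠] (0 : ℝ), |x s| < 1 := by
    filter_upwards [hx (Metric.ball_mem_nhds 0 one_pos)] with s hs
    simpa using hs
  have hy1 : ∀ᶠ s in 𝓝[≠] (0 : ℝ), |y s| < 1 := by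
    filter_upwards [hy (Metric.ball_mem_nhds 0 one_pos)] with s hs
    simpa using hs
  have hs1 : ∀ᶠ s in 𝓝[≠] (0 : ℝ), |s| < 1 / M := by
    filter_upwards [nhdsWithin_le_nhds (Metric.ball_mem_nhds 0 (by positivity : 0 < 1 / M))]
      with s hs
    simpa using hs
  filter_upwards [hs, hx1, hy1, hs1, self_mem_nhdsWithin] with s hs hx1 hy1 hs1 hs0
  have hs2 : 0 < s ^ 2 := by
    have : s ≠ 0 := hs0
    positivity
  set q : ℝ × ℝ := (x s, y s) with hq
  have hξq := hξc q
  have hξq' := hξc' q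
  have hξM : ∀ t, |ξ q t| ≤ M := fun t => by
    have hcx : |x s * Real.cos (α t)| ≤ 1 := by
      rw [abs_mul]; exact mul_le_one₀ hx1.le (abs_nonneg _) (Real.abs_cos_le_one _)
    have hsy : |y s * Real.sin (α t)| ≤ 1 := by
      rw [abs_mul]; exact mul_le_one₀ hy1.le (abs_nonneg _) (Real.abs_sin_le_one _)
    have h1 := abs_add_le (η t) (x s * Real.cos (α t) + y s * Real.sin (α t))
    have h2 := abs_add_le (x s * Real.cos (α t)) (y s * Real.sin (α t))
    have h3 := hM₀ t
    simp only [hξ, hq]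
    linarith
  have hcos : ∫ t in (0 : ℝ)..2 * π, Real.cos (α t + s * ξ q t) = 0 := by
    have h1 := hs.1
    rw [integral_exp_mul_I (by fun_prop)] at h1
    simpa [hξ, hq] using congrArg Complex.re h1
  have hparts : ∫ t in (0 : ℝ)..2 * π, α' t * ξ' q t =
      ∫ t in (0 : ℝ)..2 * π, ω ^ 2 * Real.sin (α t) * ξ q t := by
    rw [integral_deriv_mul_eq_neg hP.hasDerivAt' (hξd q) (by fun_prop) hξq'
      (by simpa using h.periodic' 0) (hξp q), ← intervalIntegral.integral_neg]
    refine intervalIntegral.integral_congr fun t _ => ?_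
    ring
  have henergy : 0 ≤ ∫ t in (0 : ℝ)..2 * π, (s ^ 2 * ξ' q t ^ 2 + 2 * ω ^ 2 *
      (Real.cos (α t + s * ξ q t) - Real.cos (α t) + s * ξ q t * Real.sin (α t))) := by
    have e1 : ∀ t, 2 * α' t * (s * ξ' q t) + (s * ξ' q t) ^ 2 =
        2 * s * (α' t * ξ' q t) + s ^ 2 * ξ' q t ^ 2 := fun t => by ring
    have e2 : ∀ t, s ^ 2 * ξ' q t ^ 2 + 2 * ω ^ 2 * (Real.cos (α t + s * ξ q t) -
        Real.cos (α t) + s * ξ q t * Real.sin (α t)) = 2 * s * (ω ^ 2 * Real.sin (α t) * ξ q t) +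
        s ^ 2 * ξ' q t ^ 2 + (2 * ω ^ 2 * Real.cos (α t + s * ξ q t) -
          2 * ω ^ 2 * Real.cos (α t)) := fun t => by ring
    have h1 : 0 ≤ ∫ t in (0 : ℝ)..2 * π, (2 * α' t * (s * ξ' q t) + (s * ξ' q t) ^ 2) := hs.2
    simp only [e1] at h1
    simp only [e2]
    rw [intervalIntegral.integral_add (Continuous.intervalIntegrable (by fun_prop) _ _)
      (Continuous.intervalIntegrable (by fun_prop) _ _), intervalIntegral.integral_const_mul,
      hparts] at h1
    rw [intervalIntegral.integral_add (Continuous.intervalIntegrable (by fun_prop) _ _)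
      (Continuous.intervalIntegrable (by fun_prop) _ _),
      intervalIntegral.integral_add (Continuous.intervalIntegrable (by fun_prop) _ _)
      (Continuous.intervalIntegrable (by fun_prop) _ _),
      intervalIntegral.integral_sub (Continuous.intervalIntegrable (by fun_prop) _ _)
      (Continuous.intervalIntegrable (by fun_prop) _ _), intervalIntegral.integral_const_mul,
      intervalIntegral.integral_const_mul (2 * ω ^ 2), intervalIntegral.integral_const_mul (2 * ω ^ 2),
      hcos, h.integral_cos]
    linarith
  have hle : ∫ t in (0 : ℝ)..2 * π, (s ^ 2 * ξ' q t ^ 2 + 2 * ω ^ 2 *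
      (Real.cos (α t + s * ξ q t) - Real.cos (α t) + s * ξ q t * Real.sin (α t))) ≤
      ∫ t in (0 : ℝ)..2 * π, (s ^ 2 * (ξ' q t ^ 2 - ω ^ 2 * Real.cos (α t) * ξ q t ^ 2) +
        2 * ω ^ 2 * (|s| ^ 3 * M ^ 3)) := by
    refine intervalIntegral.integral_mono Real.two_pi_pos.le
      (Continuous.intervalIntegrable (by fun_prop) _ _)
      (Continuous.intervalIntegrable (by fun_prop) _ _) fun t => ?_
    have hz : |s * ξ q t| ≤ |s| * M := by
      rw [abs_mul]; exact mul_le_mul_of_nonneg_left (hξM t) (abs_nonneg s)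
    have hz1 : |s * ξ q t| ≤ 1 := by
      refine hz.trans ?_
      rw [lt_div_iff₀ hMpos] at hs1
      exact hs1.le
    have h1 := cos_add_sub_cos_le (a := α t) hz1
    have h2 : |s * ξ q t| ^ 3 ≤ |s| ^ 3 * M ^ 3 := by
      rw [← mul_pow]; exact pow_le_pow_left₀ (abs_nonneg _) hz 3
    have h3 := mul_le_mul_of_nonneg_left (h1.trans (add_le_add_right h2 _))
      (by positivity : 0 ≤ 2 * ω ^ 2)
    linarith
  have h1 := henergy.trans hle
  rw [intervalIntegral.integral_add (Continuous.intervalIntegrable (by fun_prop) _ _)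
    (Continuous.intervalIntegrable (by fun_prop) _ _), intervalIntegral.integral_const_mul,
    intervalIntegral.integral_const, smul_eq_mul, sub_zero] at h1
  have h2 : |s| ^ 3 = s ^ 2 * |s| := by rw [← sq_abs s]; ring
  rw [h2] at h1
  have h3 : 0 ≤ s ^ 2 * (B q + 4 * π * ω ^ 2 * M ^ 3 * |s|) := by
    refine h1.trans_eq ?_
    simp only [hB]
    ring
  exact nonneg_of_mul_nonneg_right h3 hs2

/-! ### Classification of the local minima -/

/-- A closed elastica of nonzero index is a circle. -/
theorem omega_eq_zero (h : IsClosedAngle n θ N α α') (hn : n ≠ 0) (hP : IsPendulum ω α α') :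
    ω = 0 := by
  by_contra hω
  have hω2 : 0 < ω ^ 2 := by positivity
  have hαc := h.continuous
  have hα'c := h.continuous'
  -- At a zero of `α'` the solution is symmetric in time about that point, so `α` agrees at the two
  -- ends of a period and the index is zero.
  have hne : ∀ t, α' t ≠ 0 := by
    intro t ht
    have h1 := (hP.comp_const_sub (2 * t)).unique hP (t₀ := t) (by ring_nf)
      (by rw [show 2 * t - t = t by ring, ht, neg_zero]) (t + π)
    have h2 := h.add_two_pi (t - π)
    rw [show t - π + 2 * π = t + π by ring, ← h1, show 2 * t - (t + π) = t - π by ring] at h2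
    have h3 : 2 * π * (n : ℝ) = 0 := by linarith
    exact hn (by simpa [Real.pi_ne_zero] using h3)
  obtain ⟨σ, hσ2, hσ⟩ : ∃ σ : ℝ, σ ^ 2 = 1 ∧ ∀ t, 0 < σ * α' t := by
    by_cases hpos : ∀ t, 0 < α' t
    · exact ⟨1, by norm_num, fun t => by simpa using hpos t⟩
    · push Not at hpos
      obtain ⟨s, hs⟩ := hpos
      refine ⟨-1, by norm_num, fun t => ?_⟩
      by_contra! hcon
      obtain ⟨r, hr⟩ := mem_range_of_exists_le_of_exists_ge hα'c ⟨s, hs⟩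
        ⟨t, (by linarith : 0 ≤ α' t)⟩
      exact hne r hr
  set E := α' 0 ^ 2 / 2 - ω ^ 2 * Real.cos (α 0) with hE
  have hen : ∀ t, α' t ^ 2 = 2 * E + 2 * ω ^ 2 * Real.cos (α t) := fun t => by
    have := hP.energy t 0
    linarith
  have hcos := h.integral_cos
  -- If `E ≤ 0`, the energy identity makes `cos α` positive everywhere, against its zero integral.
  have hEpos : 0 < E := by
    by_contra! hcon
    have hc : ∀ t, 0 < Real.cos (α t) := fun t => by
      have h1 := hen t
      have h2 : 0 < α' t ^ 2 := by have := hne t; positivity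
      by_contra! h3
      nlinarith
    exact hcos.not_gt (intervalIntegral.intervalIntegral_pos_of_pos
      (Continuous.intervalIntegrable (by fun_prop) _ _) hc Real.two_pi_pos)
  set c := √(2 * E) with hc
  have hc0 : 0 < c := Real.sqrt_pos.2 (by linarith)
  have hc2 : c ^ 2 = 2 * E := Real.sq_sqrt (by linarith)
  have hkey : ∀ t, Real.cos (α t) * (σ * α' t - c) * (σ * α' t + c) =
      2 * ω ^ 2 * Real.cos (α t) ^ 2 := fun t => by
    have h1 : (σ * α' t) ^ 2 = 2 * E + 2 * ω ^ 2 * Real.cos (α t) := by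
      rw [mul_pow, hσ2, one_mul, hen]
    linear_combination Real.cos (α t) * (h1 - hc2)
  -- The speed `σ α'` exceeds its value `c` at `cos α = 0` exactly when the cosine is positive. The
  -- integral of this product vanishes, since `cos α` and `α' cos α` both integrate to zero.
  have hnonneg : ∀ t, 0 ≤ Real.cos (α t) * (σ * α' t - c) := fun t =>
    nonneg_of_mul_nonneg_left ((hkey t).symm ▸ (by positivity)) (add_pos (hσ t) hc0)
  have hint : ∫ t in (0 : ℝ)..2 * π, Real.cos (α t) * (σ * α' t - c) = 0 := by
    have h1 : ∫ t in (0 : ℝ)..2 * π, Real.cos (α t) * α' t = 0 := by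
      rw [intervalIntegral.integral_eq_sub_of_hasDerivAt (fun t _ => (h.hasDerivAt t).sin)
        (Continuous.intervalIntegrable (by fun_prop) _ _), sub_eq_zero]
      simpa using h.periodic_sin 0
    have e : ∀ t, Real.cos (α t) * (σ * α' t - c) =
        σ * (Real.cos (α t) * α' t) - c * Real.cos (α t) := fun t => by ring
    simp only [e]
    rw [intervalIntegral.integral_sub (Continuous.intervalIntegrable (by fun_prop) _ _)
      (Continuous.intervalIntegrable (by fun_prop) _ _), intervalIntegral.integral_const_mul,
      intervalIntegral.integral_const_mul, h1, hcos]
    ring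
  have hzero : ∀ t ∈ Set.Icc 0 (2 * π), Real.cos (α t) = 0 := by
    intro t ht
    have h1 := eq_zero_of_integral_nonpos Real.two_pi_pos
      (Continuous.continuousOn (by fun_prop)) (fun t _ => hnonneg t) hint.le t ht
    have h2 := hkey t
    rw [h1, zero_mul] at h2
    have h3 := (mul_eq_zero.1 h2.symm).resolve_left (by positivity)
    exact pow_eq_zero_iff two_ne_zero |>.1 h3
  have hev : (fun t => Real.cos (α t)) =ᶠ[𝓝 π] fun _ => 0 := by
    filter_upwards [Icc_mem_nhds Real.pi_pos (by linarith [Real.pi_pos] : π < 2 * π)] with t ht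
    exact hzero t ht
  have hd := (h.hasDerivAt π).cos.unique ((hasDerivAt_const π (0 : ℝ)).congr_of_eventuallyEq hev)
  have hsin := (mul_eq_zero.1 hd).resolve_right (hne π)
  have h5 := Real.sin_sq_add_cos_sq (α π)
  rw [neg_eq_zero.1 hsin, hzero π ⟨Real.pi_pos.le, by linarith [Real.pi_pos]⟩] at h5
  norm_num at h5

theorem eq_linear (h : IsClosedAngle n θ N α α') (hP : IsPendulum 0 α α') (t : ℝ) :
    α t = n * t + α 0 := by
  have hd : ∀ t, HasDerivAt α' 0 t := fun t => by simpa using hP.hasDerivAt' t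
  have h1 : ∀ t, α' t = α' 0 := fun t =>
    is_const_of_deriv_eq_zero (fun t => (hd t).differentiableAt) (fun t => (hd t).deriv) t 0
  have hd2 : ∀ t, HasDerivAt (fun t => α t - α' 0 * t) 0 t := fun t =>
    ((h.hasDerivAt t).sub ((hasDerivAt_id t).const_mul (α' 0))).congr_deriv (by rw [h1 t]; ring)
  have h2 : ∀ t, α t - α' 0 * t = α 0 - α' 0 * 0 := fun t =>
    is_const_of_deriv_eq_zero (fun t => (hd2 t).differentiableAt) (fun t => (hd2 t).deriv) t 0
  have h3 := h2 (2 * π)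
  have h4 := h.add_two_pi 0
  rw [zero_add] at h4
  have h5 : α' 0 = n := mul_left_cancel₀ Real.two_pi_pos.ne' (by linarith)
  have := h2 t
  rw [h5] at this
  linarith

end IsClosedAngle

/-! ### Instability of the multiply passed figure eight -/

/-- Translation by the period `2π / j` of `f` rotates the pair of integrals by that angle while
leaving them unchanged. For `j ≥ 2` the rotation is not the identity, so both vanish. -/
theorem integral_cos_mul_eq_zero {f : ℝ → ℂ} {j : ℕ} (hj : 2 ≤ j) (hf : Continuous f)
    (hp : Function.Periodic f (2 * π)) (hpj : Function.Periodic f (2 * π / j)) :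
    ∫ t in (0 : ℝ)..2 * π, (Real.cos t : ℂ) * f t = 0 ∧
      ∫ t in (0 : ℝ)..2 * π, (Real.sin t : ℂ) * f t = 0 := by
  set c := 2 * π / j with hc
  set C := ∫ t in (0 : ℝ)..2 * π, (Real.cos t : ℂ) * f t with hC
  set S := ∫ t in (0 : ℝ)..2 * π, (Real.sin t : ℂ) * f t with hS
  have h1 : ∫ t in (0 : ℝ)..2 * π, (Real.cos (t + c) : ℂ) * f (t + c) = C :=
    integral_comp_add_of_periodic (f := fun t => (Real.cos t : ℂ) * f t)
      (fun t => by simp only [Real.cos_add_two_pi, hp t]) c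
  have h2 : ∫ t in (0 : ℝ)..2 * π, (Real.sin (t + c) : ℂ) * f (t + c) = S :=
    integral_comp_add_of_periodic (f := fun t => (Real.sin t : ℂ) * f t)
      (fun t => by simp only [Real.sin_add_two_pi, hp t]) c
  have e1 : ∀ t, (Real.cos (t + c) : ℂ) * f (t + c) =
      (Real.cos c : ℂ) * ((Real.cos t : ℂ) * f t) - (Real.sin c : ℂ) * ((Real.sin t : ℂ) * f t) :=
    fun t => by rw [hpj t, Real.cos_add]; push_cast; ring
  have e2 : ∀ t, (Real.sin (t + c) : ℂ) * f (t + c) =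
      (Real.sin c : ℂ) * ((Real.cos t : ℂ) * f t) + (Real.cos c : ℂ) * ((Real.sin t : ℂ) * f t) :=
    fun t => by rw [hpj t, Real.sin_add]; push_cast; ring
  simp only [e1] at h1
  simp only [e2] at h2
  rw [intervalIntegral.integral_sub (Continuous.intervalIntegrable (by fun_prop) _ _)
    (Continuous.intervalIntegrable (by fun_prop) _ _), intervalIntegral.integral_const_mul,
    intervalIntegral.integral_const_mul] at h1
  rw [intervalIntegral.integral_add (Continuous.intervalIntegrable (by fun_prop) _ _)
    (Continuous.intervalIntegrable (by fun_prop) _ _), intervalIntegral.integral_const_mul,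
    intervalIntegral.integral_const_mul] at h2
  have hj' : (2 : ℝ) ≤ j := by exact_mod_cast hj
  have hcpos : 0 < c := by positivity
  have hclt : c < 2 * π := div_lt_self Real.two_pi_pos (by linarith)
  have hc1 : Real.cos c ≠ 1 := fun h => hcpos.ne'
    ((Real.cos_eq_one_iff_of_lt_of_lt (by linarith [Real.pi_pos]) hclt).1 h)
  have hcs : (Real.cos c : ℂ) ^ 2 + (Real.sin c : ℂ) ^ 2 = 1 := by
    exact_mod_cast Real.cos_sq_add_sin_sq c
  have hne : 2 * (1 - (Real.cos c : ℂ)) ≠ 0 := by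
    refine mul_ne_zero two_ne_zero (sub_ne_zero.2 fun h => hc1 ?_)
    exact_mod_cast h.symm
  constructor
  · refine (mul_eq_zero.1 (?_ : 2 * (1 - (Real.cos c : ℂ)) * C = 0)).resolve_left hne
    linear_combination ((Real.cos c : ℂ) - 1) * h1 + (Real.sin c : ℂ) * h2 - C * hcs
  · refine (mul_eq_zero.1 (?_ : 2 * (1 - (Real.cos c : ℂ)) * S = 0)).resolve_left hne
    linear_combination ((Real.cos c : ℂ) - 1) * h2 - (Real.sin c : ℂ) * h1 - S * hcs

/-- Otherwise the remainder of `2T` after subtracting multiples of `2τ` would be a positive period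
less than `2τ`. -/
theorem Function.Antiperiodic.exists_nat_mul_eq {v : ℝ → ℝ} {τ T : ℝ}
    (hv : Function.Antiperiodic v τ) (h0 : v 0 = 0) (hpos : ∀ t ∈ Set.Ioo 0 τ, 0 < v t)
    (hτ : 0 < τ) (hp : Function.Periodic v (2 * T)) (hT : τ ≤ T) :
    ∃ j : ℕ, 1 ≤ j ∧ j * τ = T := by
  have h1 := Nat.floor_le (div_nonneg (hτ.le.trans hT) hτ.le)
  have h2 := Nat.lt_floor_add_one (T / τ)
  rw [le_div_iff₀ hτ] at h1
  rw [div_lt_iff₀ hτ] at h2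
  refine ⟨⌊T / τ⌋₊, Nat.le_floor (by rwa [Nat.cast_one, one_le_div hτ]), ?_⟩
  by_contra hne
  have hlt := lt_of_le_of_ne h1 hne
  have hp' : Function.Periodic v (2 * T - ⌊T / τ⌋₊ * (2 * τ)) :=
    hp.sub_period (hv.periodic_two_mul.nat_mul _)
  have := hv.two_mul_le_of_periodic h0 hpos hτ hp' (by linarith)
  linarith

theorem IsPendulum.isEightAngle_div {ω τ : ℝ} {v v' : ℝ → ℝ} {j : ℕ} (h : IsPendulum ω v v')
    (hj : 1 ≤ j) (hτ : j * τ = π) (h0 : v 0 = 0) (h0' : 0 < v' 0)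
    (hpos : ∀ t ∈ Set.Ioo 0 τ, 0 < v t) (hlt : ∀ t, |v t| < π) (hv : Function.Antiperiodic v τ)
    (hcos : ∫ t in (0 : ℝ)..2 * π, Real.cos (v t) = 0) :
    IsEightAngle (ω / j) (fun t => v (t / j)) (fun t => v' (t / j) / j) := by
  have hj0 : (0 : ℝ) < j := by exact_mod_cast hj
  have hτ' : τ = π / j := by rw [eq_div_iff hj0.ne', mul_comm, hτ]
  have hdiv : ∀ t : ℝ, HasDerivAt (fun t : ℝ => t / j) (1 / j) t := fun t =>
    (hasDerivAt_id t).div_const _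
  exact
    { hasDerivAt := fun t =>
        ((h.hasDerivAt (t / j)).comp t (hdiv t)).congr_deriv (mul_one_div _ _)
      hasDerivAt' := fun t => by
        refine (((h.hasDerivAt' (t / j)).comp t (hdiv t)).div_const (j : ℝ)).congr_deriv ?_
        field_simp
      zero := by simpa using h0
      deriv_pos := by simpa using div_pos h0' hj0
      pos := fun t ht => hpos _ ⟨div_pos ht.1 hj0, hτ' ▸ (div_lt_div_iff_of_pos_right hj0).2 ht.2⟩
      abs_lt := fun t => hlt _
      antiperiodic := fun t => by simp only [add_div, ← hτ', hv _]
      integral_cos := by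
        have hp : Function.Periodic (fun t => Real.cos (v t)) (2 * τ) :=
          fun t => by simp only [hv.periodic_two_mul t]
        have h1 := hp.intervalIntegral_add_zsmul_eq j 0
        have h2 : (0 : ℝ) + (j : ℤ) • (2 * τ) = 2 * π := by
          rw [← hτ, zsmul_eq_mul]; push_cast; ring
        rw [h2, hcos, zero_add, zsmul_eq_mul] at h1
        replace h1 := h1 fun _ _ =>
          (Real.continuous_cos.comp h.continuous).intervalIntegrable _ _
        have h3 := (mul_eq_zero.1 h1.symm).resolve_left (by exact_mod_cast hj0.ne')
        rw [intervalIntegral.integral_comp_div (fun t => Real.cos (v t)) hj0.ne', zero_div,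
          mul_div_assoc, ← hτ', h3, smul_zero] }

namespace IsClosedAngle

variable {θ ω : ℝ} {N : ℝ → ℂ} {β β' : ℝ → ℝ}

/-- A closed elastica of index zero which is passed at least twice is not a local minimum. -/
theorem not_isEulerLocalMin (h : IsClosedAngle 0 θ N β β') (hP : IsPendulum ω β β')
    (hN : IsEulerLocalMin N) {j : ℕ} (hj : 2 ≤ j) (hpj : Function.Periodic β (2 * π / j))
    {t₀ : ℝ} (ht₀ : Real.cos (β t₀) = 1) (hlt : 1 < ω ^ 2 - β' t₀ ^ 2 / 4) : False := by
  have hβc := h.continuous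
  have hβ'c := h.continuous'
  have hp : Function.Periodic β (2 * π) := fun t => by simpa using h.add_two_pi t
  have hp' := h.periodic'
  set l := ω ^ 2 - β' t₀ ^ 2 / 4 with hl
  have hen : ∀ t, β' t ^ 2 = β' t₀ ^ 2 - 2 * ω ^ 2 + 2 * ω ^ 2 * Real.cos (β t) := fun t => by
    have := hP.energy t t₀
    rw [ht₀] at this
    linarith
  -- By conservation of energy `g'' + ω² cos β g = l g`, so `g` is an eigenfunction of the second
  -- variation.
  set g : ℝ → ℝ := fun t => Real.cos (β t / 2) with hg
  set g' : ℝ → ℝ := fun t => -(Real.sin (β t / 2) * (β' t / 2)) with hg'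
  have hgd : ∀ t, HasDerivAt g (g' t) t := fun t =>
    (((h.hasDerivAt t).div_const 2).cos).congr_deriv (by simp only [hg']; ring)
  have hgd' : ∀ t, HasDerivAt g' ((l - ω ^ 2 * Real.cos (β t)) * g t) t := fun t => by
    refine ((((h.hasDerivAt t).div_const 2).sin.mul
      ((hP.hasDerivAt' t).div_const 2)).neg).congr_deriv ?_
    have h1 := hen t
    have hc := Real.cos_two_mul (β t / 2)
    have hs := Real.sin_two_mul (β t / 2)
    have h2 := Real.sin_sq_add_cos_sq (β t / 2)
    rw [show 2 * (β t / 2) = β t by ring] at hc hs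
    rw [hc] at h1 ⊢
    rw [hs]
    simp only [hg, hl]
    linear_combination (-Real.cos (β t / 2) / 4) * h1 + ω ^ 2 * Real.cos (β t / 2) * h2
  have hgc : Continuous g := by fun_prop
  have hgc' : Continuous g' := by fun_prop
  have hgp : Function.Periodic g (2 * π) := fun t => by simp only [hg, hp t]
  have hgp' : Function.Periodic g' (2 * π) := fun t => by simp only [hg', hp t, hp' t]
  obtain ⟨hC, hS⟩ := integral_cos_mul_eq_zero (f := fun t => (g t : ℂ) * exp (β t * I)) hj
    (by fun_prop) (fun t => by simp only [hg, hp t]) (fun t => by simp only [hg, hpj t])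
  have h1 := h.second_variation hP hN (η := fun t => Real.cos t * g t)
    (fun t => (Real.hasDerivAt_cos t).mul (hgd t)) (by fun_prop)
    (fun t => by simp only [Real.cos_add_two_pi, hgp t])
    (by simpa only [ofReal_mul, mul_assoc] using hC)
  have h2 := h.second_variation hP hN (η := fun t => Real.sin t * g t)
    (fun t => (Real.hasDerivAt_sin t).mul (hgd t)) (by fun_prop)
    (fun t => by simp only [Real.sin_add_two_pi, hgp t])
    (by simpa only [ofReal_mul, mul_assoc] using hS)
  have h3 := add_nonneg h1 h2
  rw [← intervalIntegral.integral_add (Continuous.intervalIntegrable (by fun_prop) _ _)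
    (Continuous.intervalIntegrable (by fun_prop) _ _)] at h3
  -- In the sum of the two second variations the cross terms cancel, and the modulation costs just
  -- `g²`. The eigenvalue equation turns the total into `(1 - l) ∫ g² = (1 - l) π < 0`.
  have e : ∀ t, (-Real.sin t * g t + Real.cos t * g' t) ^ 2 -
      ω ^ 2 * Real.cos (β t) * (Real.cos t * g t) ^ 2 +
      ((Real.cos t * g t + Real.sin t * g' t) ^ 2 -
        ω ^ 2 * Real.cos (β t) * (Real.sin t * g t) ^ 2) =
      g' t * g' t + (g t ^ 2 - ω ^ 2 * Real.cos (β t) * g t ^ 2) := fun t => by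
    linear_combination (g t ^ 2 + g' t ^ 2 - ω ^ 2 * Real.cos (β t) * g t ^ 2) *
      Real.sin_sq_add_cos_sq t
  simp only [e] at h3
  rw [intervalIntegral.integral_add (Continuous.intervalIntegrable (by fun_prop) _ _)
    (Continuous.intervalIntegrable (by fun_prop) _ _),
    integral_deriv_mul_eq_neg hgd' hgd (by fun_prop) hgc' (by simpa using hgp' 0)
      (by simpa using hgp 0), ← intervalIntegral.integral_neg,
    ← intervalIntegral.integral_add (Continuous.intervalIntegrable (by fun_prop) _ _)
    (Continuous.intervalIntegrable (by fun_prop) _ _)] at h3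
  have e' : ∀ t, -((l - ω ^ 2 * Real.cos (β t)) * g t * g t) +
      (g t ^ 2 - ω ^ 2 * Real.cos (β t) * g t ^ 2) = (1 - l) * (1 / 2 + Real.cos (β t) / 2) :=
    fun t => by
      have hc := Real.cos_two_mul (β t / 2)
      rw [show 2 * (β t / 2) = β t by ring] at hc
      simp only [hg]
      linear_combination -(1 - l) / 2 * hc
  simp only [e'] at h3
  rw [intervalIntegral.integral_const_mul, intervalIntegral.integral_add
    (Continuous.intervalIntegrable (by fun_prop) _ _)
    (Continuous.intervalIntegrable (by fun_prop) _ _), intervalIntegral.integral_div,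
    intervalIntegral.integral_div, h.integral_cos] at h3
  simp only [intervalIntegral.integral_const, smul_eq_mul] at h3
  nlinarith [Real.pi_pos]

theorem isFigureEightElastica (h : IsClosedAngle 0 θ N β β') (hP : IsPendulum ω β β')
    (hω : 0 < ω) (hN : IsEulerLocalMin N) : IsFigureEightElastica N := by
  have hp : Function.Periodic β (2 * π) := fun t => by simpa using h.add_two_pi t
  obtain ⟨t₀, k, τ, v, v', hv, huv, hτ, hτπ, h0, h0', hpos, hlt, hanti⟩ :=
    hP.exists_normalization hω hp h.integral_cos
  have hvβ : ∀ t, v t = β (t + t₀) - 2 * π * k := fun t => by rw [huv]; ring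
  have hvp : Function.Periodic v (2 * π) := fun t => by
    rw [hvβ, hvβ, add_right_comm, hp]
  have hβv : ∀ t, β t = v (t - t₀) + 2 * π * k := fun t => by rw [← huv, sub_add_cancel]
  have hcos : ∫ t in (0 : ℝ)..2 * π, Real.cos (v t) = 0 := by
    have h1 : ∀ t, Real.cos (v t) = Real.cos (β (t + t₀)) := fun t => by
      rw [huv, mul_comm, Real.cos_add_int_mul_two_pi]
    simp only [h1]
    rw [integral_comp_add_of_periodic (f := fun t => Real.cos (β t)) (fun t => by
      simp only [hp t]), h.integral_cos]
  obtain ⟨j, hj, hjτ⟩ := hanti.exists_nat_mul_eq h0 hpos hτ hvp hτπ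
  have hE := hv.isEightAngle_div hj hjτ h0 h0' hpos hlt hanti hcos
  have hj0 : (0 : ℝ) < j := by exact_mod_cast hj
  rcases hj.eq_or_lt with rfl | hj2
  · refine hE.isFigureEightElastica (t₀ := -t₀) (θ := θ + 2 * π * k) (by simpa using hω)
      h.isArcLengthCurve fun t => ?_
    rw [h.deriv_eq, hβv]
    simp only [Nat.cast_one, div_one, ← sub_eq_add_neg]
    congr 3
    ring
  -- Slowed down by the factor `j`, the angle is that of an eight, so it shares the parameters of
  -- the explicit one. Undoing the scaling multiplies the bound `1/4` by `j² ≥ 4`.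
  · obtain ⟨ω₀, w, w', hω₀, hw, hlt₀⟩ := exists_isEightAngle
    obtain ⟨-, h1, h2⟩ := hw.unique_shape hE hω₀ (div_pos hω hj0)
    have hv'0 : β' t₀ = v' 0 := by
      have h3 := ((h.hasDerivAt (0 + t₀)).comp_add_const 0 t₀).sub_const (2 * π * k)
      rw [zero_add] at h3
      exact (h3.congr_of_eventuallyEq (Filter.Eventually.of_forall hvβ)).unique (hv.hasDerivAt 0)
    refine (h.not_isEulerLocalMin hP hN hj2 (fun t => ?_) (t₀ := t₀) ?_ ?_).elim
    · rw [hβv, hβv, add_sub_right_comm, ← hjτ,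
        show 2 * (j * τ) / j = 2 * τ by field_simp, hanti.periodic_two_mul]
    · rw [hβv, sub_self, h0, zero_add, mul_comm, Real.cos_int_mul_two_pi]
    · rw [hv'0]
      rw [← h1, ← h2, zero_div, div_pow, div_pow] at hlt₀
      have hj2' : (2 : ℝ) ≤ j := by exact_mod_cast hj2
      have h3 : ω ^ 2 / j ^ 2 - v' 0 ^ 2 / j ^ 2 / 4 = (ω ^ 2 - v' 0 ^ 2 / 4) / j ^ 2 := by ring
      rw [h3, lt_div_iff₀ (by positivity)] at hlt₀
      nlinarith

end IsClosedAngle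

/-! ### Shapes of the local minima and the final classification -/

namespace IsEulerLocalMin

theorem exists_isClosedAngle {N : ℝ → ℂ} {n : ℤ} (h : IsEulerLocalMin N) (hn : HasWhitneyIndex N n) :
    ∃ (ω θ : ℝ) (α α' : ℝ → ℝ), 0 ≤ ω ∧ IsClosedAngle n θ N α α' ∧ IsPendulum ω α α' := by
  obtain ⟨α, α', hα, hα', hN, hp⟩ := h.1.exists_angle hn
  have hc : IsClosedAngle n 0 N α α' := ⟨hα, hα', fun t => by simpa using hN t, hp, h.1⟩
  obtain ⟨ω, ψ, hω, hψ⟩ := hc.exists_isPendulum h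
  exact ⟨ω, _, _, _, hω, hψ⟩

theorem sameShape_multiCircle {N : ℝ → ℂ} {n : ℤ} (h : IsEulerLocalMin N)
    (hn : HasWhitneyIndex N n) (hn0 : n ≠ 0) : SameShape (multiCircle n) N := by
  obtain ⟨ω, θ, α, α', -, hα, hP⟩ := h.exists_isClosedAngle hn
  obtain rfl := hα.omega_eq_zero hn0 hP
  refine sameShape_multiCircle_of_angle hn0 h.1 (c := α 0 + θ) fun t => ?_
  rw [hα.deriv_eq, hα.eq_linear hP, add_assoc]

theorem isFigureEightElastica {N : ℝ → ℂ} (h : IsEulerLocalMin N) (hn : HasWhitneyIndex N 0) :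
    IsFigureEightElastica N := by
  obtain ⟨ω, θ, α, α', hω, hα, hP⟩ := h.exists_isClosedAngle hn
  refine hα.isFigureEightElastica hP (hω.lt_of_ne' fun h0 => ?_) h
  subst h0
  have h1 : ∀ t, α t = α 0 := fun t => by simpa using hα.eq_linear hP t
  have h2 := hα.integral_exp
  simp only [h1, intervalIntegral.integral_const, smul_eq_zero, exp_ne_zero, or_false] at h2
  linarith [Real.pi_pos]

end IsEulerLocalMin

theorem isEulerLocalMin_iff_sameShape_multiCircle (N : ℝ → ℂ) {n : ℤ} (hn : n ≠ 0) :
    (IsEulerLocalMin N ∧ HasWhitneyIndex N n) ↔ SameShape (multiCircle n) N :=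
  ⟨fun h => h.1.sameShape_multiCircle h.2 hn, fun h => h.isEulerLocalMin_of_multiCircle hn⟩

theorem isEulerLocalMin_iff_isFigureEightElastica (N : ℝ → ℂ) :
    (IsEulerLocalMin N ∧ HasWhitneyIndex N 0) ↔ IsFigureEightElastica N :=
  ⟨fun h => h.1.isFigureEightElastica h.2, fun h => h.isEulerLocalMin⟩

theorem exists_isEulerLocalMin_iff_sameShape (n : ℤ) :
    ∃ N, ∀ N', (IsEulerLocalMin N' ∧ HasWhitneyIndex N' n) ↔ SameShape N N' := by
  rcases eq_or_ne n 0 with rfl | hn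
  · obtain ⟨N, hN⟩ := exists_isFigureEightElastica
    exact ⟨N, fun N' => (isEulerLocalMin_iff_isFigureEightElastica N').trans (hN.sameShape_iff N')⟩
  · exact ⟨multiCircle n, fun N' => isEulerLocalMin_iff_sameShape_multiCircle N' hn⟩

theorem IsRegularClosedCurve.existsUnique_whitneyIndex {γ : ℝ → ℂ}
    (h : IsRegularClosedCurve 2 γ) : ∃! n : ℤ, HasWhitneyIndex γ n := by
  obtain ⟨w, n, hw, hγ, hp⟩ := h.exists_log
  exact ⟨n, hasWhitneyIndex_of_log hw.continuous hγ hp, fun m hm =>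
    hm.unique h.deriv_ne_zero (hasWhitneyIndex_of_log hw.continuous hγ hp)⟩

theorem regularlyHomotopic_iff {r : ℕ} (hr : 1 ≤ r) (hr' : r ≤ 2) {γ₁ γ₂ : ℝ → ℂ} {n₁ n₂ : ℤ}
    (h₁ : IsRegularClosedCurve 2 γ₁) (h₂ : IsRegularClosedCurve 2 γ₂)
    (hn₁ : HasWhitneyIndex γ₁ n₁) (hn₂ : HasWhitneyIndex γ₂ n₂) :
    RegularlyHomotopic r γ₁ γ₂ ↔ n₁ = n₂ := by
  constructor
  · intro h
    exact (h.hasWhitneyIndex hr hn₁).unique h₂.deriv_ne_zero hn₂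
  · rintro rfl
    exact regularlyHomotopic_of_hasWhitneyIndex hr' h₁ h₂ hn₁ hn₂

/-- Since the index decides regular homotopy, the homotopy condition in a normal form reduces to a
condition on the index. -/
theorem isNormalFormOf_iff {r : ℕ} (hr : 1 ≤ r) (hr' : r ≤ 2) {γ : ℝ → ℂ} {n : ℤ}
    (h : IsRegularClosedCurve 2 γ) (hn : HasWhitneyIndex γ n) (N : ℝ → ℂ) :
    IsNormalFormOf r γ N ↔ IsEulerLocalMin N ∧ HasWhitneyIndex N n := by
  refine and_congr_right fun hN => ⟨fun hh => hh.hasWhitneyIndex hr hn, fun hm => ?_⟩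
  exact (regularlyHomotopic_iff hr hr' h hN.1.isRegularClosedCurve hn hm).2 rfl

theorem exists_isNormalFormOf {r : ℕ} (hr : 1 ≤ r) (hr' : r ≤ 2) {γ : ℝ → ℂ}
    (h : IsRegularClosedCurve 2 γ) :
    ∃ N, IsNormalFormOf r γ N ∧ ∀ N', IsNormalFormOf r γ N' ↔ SameShape N N' := by
  obtain ⟨n, hn, -⟩ := h.existsUnique_whitneyIndex
  obtain ⟨N, hN⟩ := exists_isEulerLocalMin_iff_sameShape n
  have key : ∀ N', IsNormalFormOf r γ N' ↔ SameShape N N' := fun N' =>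
    (isNormalFormOf_iff hr hr' h hn N').trans (hN N')
  exact ⟨N, (key N).2 (SameShape.refl N), key⟩

theorem theorem2p2 (r : ℕ) (hr : r = 1 ∨ r = 2) :
    -- every regular `C²` curve has a normal form, and exactly one up to `SameShape`
    (∀ γ : ℝ → ℂ, IsRegularClosedCurve 2 γ →
      ∃ N, IsNormalFormOf r γ N ∧ ∀ N', IsNormalFormOf r γ N' ↔ SameShape N N') ∧
    -- regularly homotopic if and only if the normal forms are the same
    (∀ γ₁ γ₂ : ℝ → ℂ, IsRegularClosedCurve 2 γ₁ → IsRegularClosedCurve 2 γ₂ →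
      (RegularlyHomotopic r γ₁ γ₂ ↔
        ∃ N₁ N₂, IsNormalFormOf r γ₁ N₁ ∧ IsNormalFormOf r γ₂ N₂ ∧ SameShape N₁ N₂)) ∧
    -- Whitney-Graustein: the Whitney index classifies regular curves up to regular homotopy
    (∀ γ : ℝ → ℂ, IsRegularClosedCurve 2 γ → ∃! n : ℤ, HasWhitneyIndex γ n) ∧
    (∀ (γ₁ γ₂ : ℝ → ℂ) (n₁ n₂ : ℤ), IsRegularClosedCurve 2 γ₁ → IsRegularClosedCurve 2 γ₂ →
      HasWhitneyIndex γ₁ n₁ → HasWhitneyIndex γ₂ n₂ →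
      (RegularlyHomotopic r γ₁ γ₂ ↔ n₁ = n₂)) ∧
    -- the local minima correspond bijectively, up to `SameShape`, to the Whitney indices
    (∀ n : ℤ, ∃ N, ∀ N',
      (IsEulerLocalMin N' ∧ HasWhitneyIndex N' n) ↔ SameShape N N') ∧
    -- they are the multiply traversed circles and the figure eight
    (∀ (N : ℝ → ℂ) (n : ℤ), n ≠ 0 →
      ((IsEulerLocalMin N ∧ HasWhitneyIndex N n) ↔ SameShape (multiCircle n) N)) ∧
    (∀ N : ℝ → ℂ,
      (IsEulerLocalMin N ∧ HasWhitneyIndex N 0) ↔ IsFigureEightElastica N) := by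
  have hr1 : 1 ≤ r := by omega
  have hr2 : r ≤ 2 := by omega
  refine ⟨fun γ h => exists_isNormalFormOf hr1 hr2 h, fun γ₁ γ₂ h₁ h₂ => ?_,
    fun γ h => h.existsUnique_whitneyIndex,
    fun γ₁ γ₂ n₁ n₂ h₁ h₂ hn₁ hn₂ => regularlyHomotopic_iff hr1 hr2 h₁ h₂ hn₁ hn₂,
    exists_isEulerLocalMin_iff_sameShape,
    fun N n hn => isEulerLocalMin_iff_sameShape_multiCircle N hn,
    isEulerLocalMin_iff_isFigureEightElastica⟩
  obtain ⟨n₁, hn₁, -⟩ := h₁.existsUnique_whitneyIndex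
  obtain ⟨n₂, hn₂, -⟩ := h₂.existsUnique_whitneyIndex
  constructor
  · intro h
    obtain rfl := (regularlyHomotopic_iff hr1 hr2 h₁ h₂ hn₁ hn₂).1 h
    obtain ⟨N, hN, -⟩ := exists_isNormalFormOf hr1 hr2 h₁
    refine ⟨N, N, hN, ?_, SameShape.refl N⟩
    rwa [isNormalFormOf_iff hr1 hr2 h₂ hn₂, ← isNormalFormOf_iff hr1 hr2 h₁ hn₁]
  · rintro ⟨N₁, N₂, hN₁, hN₂, hs⟩
    rw [isNormalFormOf_iff hr1 hr2 h₁ hn₁] at hN₁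
    rw [isNormalFormOf_iff hr1 hr2 h₂ hn₂] at hN₂
    rw [regularlyHomotopic_iff hr1 hr2 h₁ h₂ hn₁ hn₂]
    exact (hs.hasWhitneyIndex hN₁.1.1 hN₁.2).unique
      hN₂.1.1.isRegularClosedCurve.deriv_ne_zero hN₂.2
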